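/- Let $N\ge 2$ be an integer, $\mathbb T=\{z\in\mathbb C:|z|=1\}$ with normalized Haar measure $\mu$, and let $m_0:\mathbb T\to\mathbb C$ be Lipschitz with finitely many zeros. Let $R_{m_0}$ be the operator on $C(\mathbb T)$ (complex-valued continuous functions) $$(R_{m_0}f)(z)=\frac1N\sum_{w^N=z}|m_0(w)|^2f(w),$$ and assume $R_{m_0}1=1$. An $(m_0,N)$-cycle is a finite set $C=\{z_1,\dots,z_p\}\subset\mathbb T$, $p\geq 1$, with $z_i^N=z_{i+1}$ for $i<p$, $z_p^N=z_1$, and $|m_0(z_i)|^2=N$ for all $i$. A finite positive Borel measure $\nu$ on $\mathbb T$ is called invariant if $\nu(R_{m_0}f)=\nu(f)$ for all $f\in C(\mathbb T)$, where $\nu(f)=\int f\,d\nu$. The wavelet representation associated to $(m_0,1)$ is the system $(H,U,T,\varphi)$, unique up to unitary equivalence, of a complex Hilbert space $H$, unitary operators $U,T$ on $H$ and a vector $\varphi\in H$ such that $UTU^{-1}=T^N$, $U\varphi=m_0(T)\varphi$, $\langle\varphi\mid f(T)\varphi\rangle=\int_{\mathbb T}f\,d\mu$ for all $f\in C(\mathbb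 T)$, and the vectors $U^{-n}f(T)\varphi$ ($n\ge0$, $f\in C(\mathbb T)$) span a dense subspace of $H$. On $L^2(\mathbb R)$ put $(U_0\xi)(x)=N^{-1/2}\xi(x/N)$ and $(T_0\xi)(x)=\xi(x-1)$. The cyclic amplification of $L^2(\mathbb R)$ along an $(m_0,N)$-cycle $C$ is the space $\bigoplus_{z\in C}L^2(\mathbb R)$ with the operators $(U_C\xi)_z=\frac{m_0(z)}{\sqrt N}\,U_0\,\xi_{z^N}$ and $(T_C\xi)_z=z\,T_0\,\xi_z$. Then exactly one of the following holds. (i) There exists an $(m_0,N)$-cycle. In this case every invariant measure $\nu$ is atomic and supported on the $(m_0,N)$-cycles: with $Z$ the union of all $(m_0,N)$-cycles, $\nu(\mathbb T\setminus Z)=0$ and $\nu=\sum_{z\in Z}\nu(\{z\})\delta_z$. Moreover the wavelet representation associated to $(m_0,1)$ exists and is unitarily equivalent, by a unitary intertwining the operators $U$ and $T$, to the direct sum over all $(m_0,N)$-cycles $C$ of the cyclic amplifications of $L^2(\mathbb R)$ along $C$. (ii) There are no $(m_0,N)$-cycles. In this case $R_{m_0}$ has no eigenvalue $\lambda\ne1$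 on $C(\mathbb T)$ with $|\lambda|=1$, and $1$ is a simple eigenvalue (its eigenspace and its generalized eigenspace both have dimension one). There exists a unique invariant probability measure $\nu$ on $\mathbb T$, and for every $f\in C(\mathbb T)$, $$\lim_{n\to\infty}R_{m_0}^nf=\nu(f)\quad\text{uniformly on }\mathbb T.$$ -/

import Mathlib

open MeasureTheory Filter Topology
open scoped ENNReal

/-- The Borel sigma-algebra of the circle group `𝕋`. -/
noncomputable instance instMeasurableSpaceTorus : MeasurableSpace Circle := borel Circle

instance instBorelSpaceTorus : BorelSpace Circle := ⟨rfl⟩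

/-! ### The transfer operator -/

/-- The function `z ↦ (1/N) ∑_{w^N = z} |m₀(w)|² f(w)` on `𝕋`. -/
noncomputable def transferFun (N : ℕ) (m₀ f : Circle → ℂ) (z : Circle) : ℂ :=
  (1 / (N : ℂ)) * ∑ᶠ (w : Circle) (_ : w ^ N = z), ((‖m₀ w‖ ^ 2 : ℝ) : ℂ) * f w

theorem setOf_pow_eq_exp (N : ℕ) (hN : N ≠ 0) (t : ℝ) :
    {w : Circle | w ^ N = Circle.exp t} =
      (fun k : ℕ => Circle.exp ((t + 2 * Real.pi * k) / N)) '' (Finset.range N : Set ℕ) := by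
  have hN' : (N : ℝ) ≠ 0 := Nat.cast_ne_zero.mpr hN
  have hNpos : (0 : ℝ) < N := Nat.cast_pos.mpr (Nat.pos_of_ne_zero hN)
  ext w
  simp only [Set.mem_ofPred_eq, Set.mem_image, Finset.coe_range, Set.mem_Iio]
  constructor
  · intro h
    obtain ⟨s, rfl⟩ := Circle.exp_surjective w
    rw [← Circle.exp_nsmul, Circle.exp_eq_exp] at h
    obtain ⟨m, hm⟩ := h
    have hNZ : (0 : ℤ) < N := by exact_mod_cast Nat.pos_of_ne_zero hN
    refine ⟨(m % N).toNat, ?_, ?_⟩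
    · have h1 := Int.emod_lt_of_pos m hNZ
      have h2 := Int.emod_nonneg m hNZ.ne'
      omega
    · rw [Circle.exp_eq_exp]
      refine ⟨-(m / N), ?_⟩
      have h2 := Int.emod_nonneg m hNZ.ne'
      have h3 : (((m % N).toNat : ℕ) : ℝ) = ((m % N : ℤ) : ℝ) := by
        exact_mod_cast congrArg (Int.cast : ℤ → ℝ) (Int.toNat_of_nonneg h2)
      have h4 : ((m : ℤ) : ℝ) = ((m % N : ℤ) : ℝ) + N * ((m / N : ℤ) : ℝ) := by
        exact_mod_cast congrArg (Int.cast : ℤ → ℝ) (Int.emod_add_mul_ediv m N).symm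
      rw [h3]
      simp only [nsmul_eq_mul] at hm
      push_cast
      rw [div_eq_iff hN', add_mul]
      rw [h4] at hm
      linear_combination -hm
  · rintro ⟨k, -, rfl⟩
    rw [← Circle.exp_nsmul, Circle.exp_eq_exp]
    refine ⟨k, ?_⟩
    simp only [nsmul_eq_mul]
    push_cast
    field_simp

theorem injOn_exp_root (N : ℕ) (hN : N ≠ 0) (t : ℝ) :
    Set.InjOn (fun k : ℕ => Circle.exp ((t + 2 * Real.pi * k) / N))
      (Finset.range N : Set ℕ) := by
  intro a ha b hb hab
  have hN' : (N : ℝ) ≠ 0 := Nat.cast_ne_zero.mpr hN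
  simp only [Finset.coe_range, Set.mem_Iio] at ha hb
  obtain ⟨m, hm⟩ := Circle.exp_eq_exp.mp hab
  have hpi := Real.pi_pos.ne'
  have h : (a : ℝ) = b + m * N := by
    field_simp at hm
    have : 2 * Real.pi * ((a : ℝ) - (b + m * N)) = 0 := by linear_combination hm
    have := (mul_eq_zero.mp this).resolve_left (by positivity)
    linarith
  have h' : (a : ℤ) = b + m * N := by exact_mod_cast h
  have : (a : ℤ) = b := by
    have e1 : (a : ℤ) % N = a := Int.emod_eq_of_lt (by positivity) (by exact_mod_cast ha)
    have e2 : (b : ℤ) % N = b := Int.emod_eq_of_lt (by positivity) (by exact_mod_cast hb)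
    rw [← e1, h', Int.add_mul_emod_self_right, e2]
  exact_mod_cast this

theorem finite_setOf_pow_eq (N : ℕ) (hN : N ≠ 0) (z : Circle) :
    {w : Circle | w ^ N = z}.Finite := by
  obtain ⟨t, rfl⟩ := Circle.exp_surjective z
  rw [setOf_pow_eq_exp N hN t]
  exact (Finset.finite_toSet _).image _

theorem transferFun_exp (N : ℕ) (hN : N ≠ 0) (m₀ f : Circle → ℂ) (t : ℝ) :
    transferFun N m₀ f (Circle.exp t) = (1 / (N : ℂ)) * ∑ k ∈ Finset.range N,
      ((‖m₀ (Circle.exp ((t + 2 * Real.pi * k) / N))‖ ^ 2 : ℝ) : ℂ) *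
        f (Circle.exp ((t + 2 * Real.pi * k) / N)) := by
  unfold transferFun
  congr 1
  have := finsum_mem_image (s := (Finset.range N : Set ℕ))
    (f := fun w : Circle => ((‖m₀ w‖ ^ 2 : ℝ) : ℂ) * f w) (injOn_exp_root N hN t)
  rw [← setOf_pow_eq_exp N hN t] at this
  simp only [Set.mem_ofPred_eq] at this
  rw [this, finsum_mem_coe_finset]

theorem continuous_transferFun (N : ℕ) (m₀ f : C(Circle, ℂ)) :
    Continuous (transferFun N m₀ f) := by
  rcases eq_or_ne N 0 with rfl | hN
  · have : transferFun 0 m₀ f = fun _ => 0 := by funext z; simp [transferFun]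
    rw [this]; exact continuous_const
  · have hq : IsQuotientMap Circle.exp :=
      Circle.isCoveringMap_exp.isLocalHomeomorph.isOpenMap.isQuotientMap
        Circle.exp.continuous Circle.exp_surjective
    rw [hq.continuous_iff]
    have : (transferFun N m₀ f) ∘ Circle.exp = fun t : ℝ => (1 / (N : ℂ)) *
        ∑ k ∈ Finset.range N, ((‖m₀ (Circle.exp ((t + 2 * Real.pi * k) / N))‖ ^ 2 : ℝ) : ℂ) *
          f (Circle.exp ((t + 2 * Real.pi * k) / N)) := by
      funext t; exact transferFun_exp N hN m₀ f t
    rw [this]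
    fun_prop

/-- The transfer (Ruelle) operator `R_{m₀}` on `C(𝕋)`,
`(R_{m₀} f)(z) = (1/N) ∑_{w^N = z} |m₀(w)|² f(w)`. -/
noncomputable def transferOp (N : ℕ) (m₀ : C(Circle, ℂ)) : C(Circle, ℂ) →ₗ[ℂ] C(Circle, ℂ) where
  toFun f := ⟨transferFun N m₀ f, continuous_transferFun N m₀ f⟩
  map_add' f g := by
    ext z
    rcases eq_or_ne N 0 with rfl | hN
    · simp [transferFun]
    · have := finsum_mem_add_distrib (f := fun w : Circle => ((‖m₀ w‖ ^ 2 : ℝ) : ℂ) * f w)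
        (g := fun w : Circle => ((‖m₀ w‖ ^ 2 : ℝ) : ℂ) * g w) (finite_setOf_pow_eq N hN z)
      simp only [Set.mem_ofPred_eq] at this
      simp only [transferFun, ContinuousMap.coe_mk, ContinuousMap.add_apply, mul_add, this]
  map_smul' c f := by
    ext z
    rcases eq_or_ne N 0 with rfl | hN
    · simp [transferFun]
    · have := mul_finsum_mem' (fun w : Circle => ((‖m₀ w‖ ^ 2 : ℝ) : ℂ) * f w) c
        (finite_setOf_pow_eq N hN z)
      simp only [Set.mem_ofPred_eq] at this
      simp only [transferFun, ContinuousMap.coe_mk, ContinuousMap.smul_apply, smul_eq_mul,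
        RingHom.id_apply]
      rw [mul_left_comm c, this]
      congr 1
      refine finsum_congr fun w => finsum_congr fun _ => ?_
      ring

/-- A Borel measure `ν` on `𝕋` is invariant if `ν(R_{m₀} f) = ν(f)` for all `f ∈ C(𝕋)`. -/
def IsInvariantMeasure (N : ℕ) (m₀ : C(Circle, ℂ)) (ν : Measure Circle) : Prop :=
  ∀ f : C(Circle, ℂ), ∫ z, transferOp N m₀ f z ∂ν = ∫ z, f z ∂ν

/-! ### Cycles -/

/-- `C` is an `(m₀, N)`-cycle: `C = {z₀, …, z_p}` with `z_i ^ N = z_{i+1}`, `z_p ^ N = z₀`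
(the addition in `Fin (p + 1)` is cyclic), and `|m₀(z_i)|² = N` for all `i`. -/
def IsFilterCycle (N : ℕ) (m₀ : C(Circle, ℂ)) (C : Finset Circle) : Prop :=
  ∃ (p : ℕ) (z : Fin (p + 1) → Circle), (C : Set Circle) = Set.range z ∧
    ∀ i, z i ^ N = z (i + 1) ∧ ‖m₀ (z i)‖ ^ 2 = N

/-- The type of all `(m₀, N)`-cycles. -/
abbrev FilterCycle (N : ℕ) (m₀ : C(Circle, ℂ)) : Type :=
  {C : Finset Circle // IsFilterCycle N m₀ C}

/-- The union of all `(m₀, N)`-cycles. -/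
def cyclePoints (N : ℕ) (m₀ : C(Circle, ℂ)) : Set Circle :=
  {z | ∃ C : Finset Circle, IsFilterCycle N m₀ C ∧ z ∈ C}

theorem IsFilterCycle.pow_mem {N : ℕ} {m₀ : C(Circle, ℂ)} {C : Finset Circle}
    (hC : IsFilterCycle N m₀ C) {z : Circle} (hz : z ∈ C) : z ^ N ∈ C := by
  obtain ⟨p, y, hy, h⟩ := hC
  rw [← Finset.mem_coe, hy] at hz ⊢
  obtain ⟨i, rfl⟩ := hz
  exact ⟨i + 1, ((h i).1).symm⟩

/-! ### Wavelet representations -/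

/-- `f(T)` for a unitary operator `T` and `f ∈ C(𝕋)`, by the continuous functional calculus
(`f` is extended by `0` off the unit circle, which contains the spectrum of `T`). -/
noncomputable def unitaryCalculus {H : Type*} [NormedAddCommGroup H] [InnerProductSpace ℂ H]
    [CompleteSpace H] (T : H ≃ₗᵢ[ℂ] H) (f : C(Circle, ℂ)) : H →L[ℂ] H :=
  cfc (Function.extend Circle.coeHom f 0) ((T : H ≃L[ℂ] H) : H →L[ℂ] H)

/-- The integral over `𝕋` with respect to normalized Haar measure,
`(1/2π) ∫₀^{2π} f(e^{iθ}) dθ`. -/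
noncomputable def haarIntegral (f : Circle → ℂ) : ℂ :=
  (1 / (2 * Real.pi) : ℝ) • ∫ θ in (0 : ℝ)..(2 * Real.pi), f (Circle.exp θ)

/-- `(H, U, T, φ)` is the wavelet representation associated to `(m₀, h)`: `U` and `T` are
unitary operators on the Hilbert space `H` with `U T U⁻¹ = T ^ N`, the vector `φ` satisfies the
scaling identity `U φ = m₀(T) φ`, the correlation function of `φ` is `h`, and `φ` is cyclic, i.e.
the vectors `U⁻ⁿ f(T) φ` span a dense subspace. -/
structure IsWaveletRepresentation {H : Type*} [NormedAddCommGroup H] [InnerProductSpace ℂ H]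
    [CompleteSpace H] (N : ℕ) (m₀ h : C(Circle, ℂ)) (U T : H ≃ₗᵢ[ℂ] H) (φ : H) : Prop where
  covariance : U * T * U⁻¹ = T ^ N
  scaling : U φ = unitaryCalculus T m₀ φ
  correlation : ∀ f : C(Circle, ℂ),
    inner ℂ φ (unitaryCalculus T f φ) = haarIntegral fun z => f z * h z
  cyclic : (Submodule.span ℂ
    {x : H | ∃ (n : ℕ) (f : C(Circle, ℂ)), x = (U⁻¹ ^ n) (unitaryCalculus T f φ)}).topologicalClosure
      = ⊤

/-- The Hilbert space `L²(ℝ)` (Lebesgue measure). -/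
abbrev L2R : Type := Lp ℂ 2 (volume : Measure ℝ)

/-- Translation on `L²(ℝ)`: `(T f)(x) = f(x - 1)`. -/
noncomputable def translationL2 (f : L2R) : L2R :=
  Lp.compMeasurePreserving (fun x : ℝ => x - 1) (measurePreserving_sub_right volume 1) f

theorem memLp_comp_div (N : ℕ) (f : L2R) :
    MemLp (fun x : ℝ => ((1 / Real.sqrt N : ℝ) : ℂ) * f (x / N)) 2 volume := by
  rcases eq_or_ne N 0 with rfl | hN
  · simp
  · have hN' : ((N : ℝ)⁻¹) ≠ 0 := inv_ne_zero (Nat.cast_ne_zero.mpr hN)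
    have hm : MemLp (f : ℝ → ℂ) 2 (Measure.map (· * (N : ℝ)⁻¹) volume) := by
      rw [Real.map_volume_mul_right hN']
      exact (Lp.memLp f).smul_measure ENNReal.ofReal_ne_top
    have h2 := hm.comp_of_map (measurable_mul_const _).aemeasurable
    exact (h2.const_mul _ :)

/-- Dilation on `L²(ℝ)`: `(U f)(x) = N ^ (-1/2) f(x / N)`. -/
noncomputable def dilationL2 (N : ℕ) (f : L2R) : L2R := (memLp_comp_div N f).toLp _

/-- The Hilbert space `L²(ℝ)^p` of the cyclic amplification of `L²(ℝ)` along a cycle `C` of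
length `p`: its vectors are the families `(ξ_z)_{z ∈ C}` in `L²(ℝ)`. -/
abbrev AmplificationSpace (C : Finset Circle) : Type := PiLp 2 (fun _ : C => L2R)

/-- The translation operator of the cyclic amplification: `(T_C ξ)_z = z • T ξ_z`. -/
noncomputable def amplifiedTranslation (C : Finset Circle) (ξ : AmplificationSpace C) :
    AmplificationSpace C :=
  WithLp.toLp 2 fun z => ((z : Circle) : ℂ) • translationL2 (ξ z)

/-- The dilation operator of the cyclic amplification:
`(U_C ξ)_z = (m₀(z) / √N) • U ξ_{z^N}`; the scalar has modulus one for `z` on a cycle. -/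
noncomputable def amplifiedDilation (N : ℕ) (m₀ : C(Circle, ℂ)) (C : FilterCycle N m₀)
    (ξ : AmplificationSpace C.1) : AmplificationSpace C.1 :=
  WithLp.toLp 2 fun z =>
    (m₀ z / ((Real.sqrt N : ℝ) : ℂ)) • dilationL2 N (ξ ⟨(z : Circle) ^ N, C.2.pow_mem z.2⟩)

/-- `(H, U, T)` is unitarily equivalent to the Hilbert space direct sum, over all `(m₀, N)`-cycles
`C`, of the cyclic amplifications of `L²(ℝ)` along `C`: isometries `W C` embed the amplifications
as mutually orthogonal summands of `H` and intertwine the operators. -/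
def IsSumOfCyclicAmplifications {H : Type*} [NormedAddCommGroup H] [InnerProductSpace ℂ H]
    [CompleteSpace H] (N : ℕ) (m₀ : C(Circle, ℂ)) (U T : H ≃ₗᵢ[ℂ] H) : Prop :=
  ∃ W : ∀ C : FilterCycle N m₀, AmplificationSpace C.1 →ₗᵢ[ℂ] H,
    IsHilbertSum ℂ (fun C : FilterCycle N m₀ => AmplificationSpace C.1) W ∧
      ∀ (C : FilterCycle N m₀) (ξ : AmplificationSpace C.1),
        U (W C ξ) = W C (amplifiedDilation N m₀ C ξ) ∧
          T (W C ξ) = W C (amplifiedTranslation C.1 ξ)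

/-! ### The power map on the circle -/

/-! Since `R 1 = 1`, the weights `|m₀|²/N` over the `N`-th roots of a point add up to one, so `R`
averages over one backward step of a Markov chain. Both alternatives rest on
`BackwardInvariant.eq_univ_or_exists_cycle`: a nonempty closed set that contains every root of
nonzero weight of its points is the circle or contains a cycle. To see this, take a minimal such
set. If no root leaves it, density of the `Nⁿ`-th roots makes it the circle. If a root `q` leaves
it, then, as only finitely many roots can leave (they are zeros of `m₀`) and the power map is open,
`q ^ N` is isolated in the set. By minimality every backward tree in the set is dense in it and hits
`q ^ N`. So the set is a finite periodic orbit, and each of its points carries the full weight of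
its fibre.

Without cycles, the support of an invariant probability measure `ν` is closed and backward
invariant, hence the whole circle. The iterates of a Lipschitz function `f` stay in a compact class
(`transferOp_mem_lipschitzClass`), and `∫ |Rⁿ f|² dν` decreases. On a limit point `F` of the orbit
the decrease has stopped, so the variances over all fibres vanish
(`apply_eq_transferOp_of_integral_eq`). Then `F` factors through every power `z ^ Nⁿ` and is
constant, equal to `ν(f)`. Density of the Lipschitz functions gives uniform convergence `Rⁿ f →
ν(f)` for all `f`, and the spectral statements and uniqueness of `ν` follow from that.

With cycles, consider the backward orbits that approach a cycle: a cycle point `ζ` and a real `x`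
encode the orbit of `ζ e^{-2πix}` whose `k`-th ancestor is `ζ_k e^{-2πix/N^k}`, with `ζ_k` the
`k`-th predecessor of `ζ` in its cycle. The infinite product `φ̂_ζ(x)` of the ratios of `m₀` at the
ancestors to `m₀` at the `ζ_k` converges because `m₀` is Lipschitz, and `|φ̂_ζ(x)|²` is the
probability of the path. The total probability of the paths that end at `u` is `R`-harmonic, lower
semicontinuous and at most one; its minimum set is closed and backward invariant, so it contains a
cycle point, where the total is at least one. Hence the total is one everywhere
(`IsLipschitzFilter.fiberSum_pathWeight`): almost every backward path converges to a cycle.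

This has two consequences. The iterates of the distance to the cycle points tend to zero pointwise,
so invariant measures live on the cycle points. And the family `φ̂` in `⨁_ζ L²(ℝ)`, with
multiplication by `ζ e^{-2πix}` and dilation along the cycles, satisfies the scaling identity with
constant correlation function one; it is a model of the wavelet representation
(`IsLipschitzFilter.isWaveletRepresentation_model`). The Plancherel transform identifies the model
with the sum of the cyclic amplifications. Any other wavelet representation has the same Gram
matrix, hence is equivalent to the model. -/

theorem isQuotientMap_circleExp : IsQuotientMap Circle.exp :=
  Circle.isCoveringMap_exp.isLocalHomeomorph.isOpenMap.isQuotientMap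
    Circle.exp.continuous Circle.exp_surjective

/-- Through the open covering `Circle.exp`, the power map lifts to multiplication by `N` on the
line, a homeomorphism. -/
theorem isOpenMap_circle_pow (N : ℕ) (hN : N ≠ 0) : IsOpenMap fun w : Circle => w ^ N := by
  intro U hU
  have hN' : (N : ℝ) ≠ 0 := Nat.cast_ne_zero.mpr hN
  have h : (fun w : Circle => w ^ N) '' U =
      Circle.exp '' ((fun t : ℝ => (N : ℝ) * t) '' (Circle.exp ⁻¹' U)) := by
    rw [← Set.image_preimage_eq U Circle.exp_surjective, Set.preimage_image_preimage,
      Set.image_image, Set.image_image]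
    simp only [← nsmul_eq_mul, Circle.exp_nsmul]
  rw [h]
  exact Circle.isCoveringMap_exp.isLocalHomeomorph.isOpenMap _
    ((Homeomorph.mulLeft₀ _ hN').isOpenMap _ (hU.preimage Circle.exp.continuous))

theorem lipschitzWith_circleExp : LipschitzWith 1 Circle.exp := by
  refine LipschitzWith.of_dist_le_mul fun s t => ?_
  have := (lipschitzWith_circleMap 0 1).dist_le_mul s t
  have h : dist (Circle.exp s) (Circle.exp t) =
    dist (Complex.exp (s * Complex.I)) (Complex.exp (t * Complex.I)) := rfl
  rw [h]
  simpa [circleMap] using this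

/-- Roots of order `N` of a given point are `2π/N`-dense in the circle. -/
theorem exists_pow_eq_dist_le (N : ℕ) (hN : N ≠ 0) (z u : Circle) :
    ∃ w : Circle, w ^ N = z ∧ dist w u ≤ 2 * Real.pi / N := by
  obtain ⟨t, rfl⟩ := Circle.exp_surjective z
  obtain ⟨s, rfl⟩ := Circle.exp_surjective u
  have hNpos : (0 : ℝ) < N := Nat.cast_pos.mpr (Nat.pos_of_ne_zero hN)
  have hpi := Real.pi_pos
  -- With this `j` the angle `(t + 2πj)/N` is the last root angle not exceeding `s`; consecutive
  -- root angles differ by `2π/N`.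
  set j : ℤ := ⌊(N * s - t) / (2 * Real.pi)⌋
  refine ⟨Circle.exp ((t + 2 * Real.pi * j) / N), ?_, ?_⟩
  · rw [← Circle.exp_nsmul, Circle.exp_eq_exp]
    refine ⟨j, ?_⟩
    simp only [nsmul_eq_mul]
    field_simp
  · have h1 := Int.floor_le ((N * s - t) / (2 * Real.pi))
    have h2 := Int.lt_floor_add_one ((N * s - t) / (2 * Real.pi))
    rw [le_div_iff₀ (by positivity)] at h1
    rw [div_lt_iff₀ (by positivity)] at h2
    refine (lipschitzWith_circleExp.dist_le_mul _ _).trans ?_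
    rw [NNReal.coe_one, one_mul, Real.dist_eq, div_sub' hNpos.ne', abs_div, abs_of_pos hNpos]
    refine div_le_div_of_nonneg_right ?_ hNpos.le
    rw [abs_le]
    constructor <;> nlinarith

theorem tendsto_two_pi_div_pow {N : ℕ} (hN : 2 ≤ N) :
    Tendsto (fun n : ℕ => 2 * Real.pi / ((N ^ n : ℕ) : ℝ)) atTop (𝓝 0) := by
  have h1 : (1 : ℝ) < N := by exact_mod_cast hN
  simpa using tendsto_const_nhds.div_atTop (tendsto_pow_atTop_atTop_of_one_lt h1)

/-- The points whose `Nⁿ`-th power is prescribed approximate every point as `n → ∞`. -/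
theorem exists_seq_pow_eq_tendsto {N : ℕ} (hN : 2 ≤ N) (z : ℕ → Circle) (u : Circle) :
    ∃ w : ℕ → Circle, (∀ n, w n ^ N ^ n = z n) ∧ Tendsto w atTop (𝓝 u) := by
  choose w hw hd using fun n => exists_pow_eq_dist_le (N ^ n) (by positivity) (z n) u
  exact ⟨w, hw, tendsto_iff_dist_tendsto_zero.2
    (squeeze_zero (fun _ => dist_nonneg) hd (tendsto_two_pi_div_pow hN))⟩

/-- Stability under `N`-th roots passes to `Nⁿ`-th roots, and the `Nⁿ`-th roots of a single point of
`K` accumulate at every point. -/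
theorem eq_univ_of_pow_mem {N : ℕ} (hN : 2 ≤ N) {K : Set Circle} (hK : IsClosed K)
    (hne : K.Nonempty) (h : ∀ w : Circle, w ^ N ∈ K → w ∈ K) : K = Set.univ := by
  obtain ⟨z, hz⟩ := hne
  refine Set.eq_univ_of_forall fun u => ?_
  obtain ⟨w, hw, hlim⟩ := exists_seq_pow_eq_tendsto hN (fun _ => z) u
  have hn : ∀ n (v : Circle), v ^ N ^ n ∈ K → v ∈ K := by
    intro n
    induction n with
    | zero => intro v hv; simpa using hv
    | succ n ih => intro v hv; exact ih v (h _ (by rwa [← pow_mul, ← pow_succ]))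
  exact hK.mem_of_tendsto hlim (Eventually.of_forall fun n => hn n _ (by rwa [hw]))

/-! ### The transfer operator as a finite sum -/

/-- The finite set of `N`-th roots of a point of the circle. -/
noncomputable def rootFinset (N : ℕ) [NeZero N] (z : Circle) : Finset Circle :=
  (finite_setOf_pow_eq N (NeZero.ne N) z).toFinset

@[simp] theorem mem_rootFinset {N : ℕ} [NeZero N] {z w : Circle} :
    w ∈ rootFinset N z ↔ w ^ N = z := by
  simp [rootFinset]

/-- The transition weight `|m₀|² / N`. -/
noncomputable def weight (N : ℕ) (m₀ : C(Circle, ℂ)) (w : Circle) : ℝ := ‖m₀ w‖ ^ 2 / N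

section weight
variable {N : ℕ} {m₀ : C(Circle, ℂ)}

theorem weight_nonneg (w : Circle) : 0 ≤ weight N m₀ w := by unfold weight; positivity

variable [NeZero N]

theorem weight_eq_zero_iff {w : Circle} : weight N m₀ w = 0 ↔ m₀ w = 0 := by
  simp [weight, NeZero.ne N]

theorem weight_eq_one_iff {w : Circle} : weight N m₀ w = 1 ↔ ‖m₀ w‖ ^ 2 = N := by
  have : (N : ℝ) ≠ 0 := Nat.cast_ne_zero.2 (NeZero.ne N)
  rw [weight, div_eq_one_iff_eq this]

theorem transferOp_apply (f : C(Circle, ℂ)) (z : Circle) :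
    transferOp N m₀ f z = ∑ w ∈ rootFinset N z, (weight N m₀ w : ℂ) * f w := by
  change transferFun N m₀ f z = _
  have h := finsum_mem_coe_finset (fun w => ((‖m₀ w‖ ^ 2 : ℝ) : ℂ) * f w) (rootFinset N z)
  simp only [Finset.mem_coe, mem_rootFinset] at h
  rw [transferFun, h, Finset.mul_sum]
  refine Finset.sum_congr rfl fun w _ => ?_
  simp only [weight]
  push_cast
  ring

theorem sum_weight (h1 : transferOp N m₀ 1 = 1) (z : Circle) :
    ∑ w ∈ rootFinset N z, weight N m₀ w = 1 := by
  have := congrArg (fun f : C(Circle, ℂ) => f z) h1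
  simp only [transferOp_apply, ContinuousMap.one_apply, mul_one] at this
  exact_mod_cast this

theorem exists_root_ne_zero (h1 : transferOp N m₀ 1 = 1) (z : Circle) :
    ∃ w : Circle, w ^ N = z ∧ m₀ w ≠ 0 := by
  by_contra! h
  have := sum_weight h1 z
  rw [Finset.sum_eq_zero fun w hw => weight_eq_zero_iff.2 (h w (mem_rootFinset.1 hw))] at this
  exact zero_ne_one this

/-- The weights over a fibre sum to one, so a root that is alone in having nonzero weight takes all
of it. -/
theorem weight_eq_one_of_unique (h1 : transferOp N m₀ 1 = 1) {v : Circle}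
    (h : ∀ w : Circle, w ^ N = v ^ N → m₀ w ≠ 0 → w = v) : ‖m₀ v‖ ^ 2 = N := by
  rw [← weight_eq_one_iff, ← sum_weight h1 (v ^ N), Finset.sum_eq_single_of_mem v (by simp)]
  intro w hw hwv
  rw [weight_eq_zero_iff]
  by_contra hne
  exact hwv (h w (mem_rootFinset.1 hw) hne)

/-- A root of weight one leaves no mass for the other roots in its fibre. -/
theorem eq_zero_of_pow_eq_of_ne (h1 : transferOp N m₀ 1 = 1) {v w : Circle}
    (hv : ‖m₀ v‖ ^ 2 = N) (h : w ^ N = v ^ N) (hne : w ≠ v) : m₀ w = 0 := by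
  classical
  have hs := sum_weight h1 (v ^ N)
  rw [← Finset.add_sum_erase _ _ (mem_rootFinset.2 rfl), weight_eq_one_iff.2 hv,
    add_eq_left, Finset.sum_eq_zero_iff_of_nonneg fun _ _ => weight_nonneg _] at hs
  exact weight_eq_zero_iff.1 (hs w (Finset.mem_erase.2 ⟨hne, mem_rootFinset.2 h⟩))

end weight

/-! ### Closed sets that are stable under the transition tree -/

/-- A set is backward invariant if it contains all the points `w` with `m₀(w) ≠ 0` whose `N`-th
power it contains. -/
def BackwardInvariant (N : ℕ) (m₀ : C(Circle, ℂ)) (K : Set Circle) : Prop :=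
  ∀ w : Circle, w ^ N ∈ K → m₀ w ≠ 0 → w ∈ K

/-- One step of the backward transition tree. -/
def TreeStep (N : ℕ) (m₀ : C(Circle, ℂ)) (z w : Circle) : Prop := w ^ N = z ∧ m₀ w ≠ 0

theorem exists_pow_of_transGen {N : ℕ} {m₀ : C(Circle, ℂ)} {z w : Circle}
    (h : Relation.TransGen (TreeStep N m₀) z w) : ∃ n : ℕ, w ^ N ^ (n + 1) = z := by
  induction h with
  | single h => exact ⟨0, by simpa using h.1⟩
  | tail _ h ih =>
    obtain ⟨n, hn⟩ := ih
    exact ⟨n + 1, by rw [pow_succ' N, pow_mul, h.1, hn]⟩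

/-- Zorn's lemma: a chain of nonempty closed sets has nonempty intersection by compactness, and
backward invariance survives intersections. -/
theorem exists_minimal_backwardInvariant {N : ℕ} {m₀ : C(Circle, ℂ)} {K : Set Circle}
    (hK : IsClosed K) (hne : K.Nonempty) (hinv : BackwardInvariant N m₀ K) :
    ∃ K₀ ⊆ K, IsClosed K₀ ∧ K₀.Nonempty ∧ BackwardInvariant N m₀ K₀ ∧
      ∀ S ⊆ K₀, IsClosed S → S.Nonempty → BackwardInvariant N m₀ S → S = K₀ := by
  obtain ⟨K₀, hle, hmin⟩ := zorn_superset_nonempty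
    {S : Set Circle | IsClosed S ∧ S.Nonempty ∧ BackwardInvariant N m₀ S} (by
      intro c hc hchain hcne
      refine ⟨⋂₀ c, ⟨isClosed_sInter fun S hS => (hc hS).1, ?_, ?_⟩,
        fun S hS => Set.sInter_subset_of_mem hS⟩
      · have : Nonempty c := hcne.to_subtype
        rw [Set.sInter_eq_iInter]
        exact IsCompact.nonempty_iInter_of_directed_nonempty_isCompact_isClosed _
          (fun a b => by
            obtain h | h := hchain.total a.2 b.2
            · exact ⟨a, subset_rfl, h⟩
            · exact ⟨b, h, subset_rfl⟩)
          (fun S => (hc S.2).2.1) (fun S => (hc S.2).1.isCompact) (fun S => (hc S.2).1)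
      · intro w hw hw0 S hS
        exact (hc hS).2.2 w (hw S hS) hw0) K ⟨hK, hne, hinv⟩
  refine ⟨K₀, hle, hmin.prop.1, hmin.prop.2.1, hmin.prop.2.2, fun S hS h1 h2 h3 => ?_⟩
  exact hS.antisymm (hmin.le_of_le ⟨h1, h2, h3⟩ hS)

section dichotomy
variable {N : ℕ} {m₀ : C(Circle, ℂ)}

/-- The power map is open: a neighbourhood of `w` on which `m₀` does not vanish has as image a
neighbourhood of `w ^ N`. This meets the tree, and a preimage of the common point is one step
further in the tree. -/
theorem backwardInvariant_closure_tree (hN : N ≠ 0) (z : Circle) :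
    BackwardInvariant N m₀ (closure {w | Relation.TransGen (TreeStep N m₀) z w}) := by
  intro w hw hw0
  rw [mem_closure_iff] at hw ⊢
  intro O hO hwO
  have hU : IsOpen (O ∩ {v | m₀ v ≠ 0}) := hO.inter (isOpen_ne_fun m₀.continuous continuous_const)
  obtain ⟨_, ⟨v, ⟨hvO, hv0⟩, rfl⟩, ht⟩ := hw _ (isOpenMap_circle_pow N hN _ hU) ⟨w, ⟨hwO, hw0⟩, rfl⟩
  exact ⟨v, hvO, Relation.TransGen.tail ht ⟨rfl, hv0⟩⟩

/-- A periodic point all of whose orbit is isolated in the transition tree is a cycle. -/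
theorem isFilterCycle_of_finite_orbit (h1 : transferOp N m₀ 1 = 1) (hN : N ≠ 0) {K : Set Circle}
    (hinv : BackwardInvariant N m₀ K) {a : Circle} {p : ℕ} (hp : a ^ N ^ (p + 1) = a)
    (hK : K = Set.range fun n : ℕ => a ^ N ^ n) :
    ∃ C : Finset Circle, IsFilterCycle N m₀ C ∧ (C : Set Circle) = K := by
  have : NeZero N := ⟨hN⟩
  have hcyc : ∀ n : ℕ, a ^ N ^ n = a ^ N ^ (n % (p + 1)) := by
    intro n
    have : ∀ k, a ^ N ^ ((p + 1) * k) = a := by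
      intro k
      induction k with
      | zero => simp
      | succ k ih => rw [Nat.mul_succ, pow_add, pow_mul, ih, hp]
    conv_lhs => rw [← Nat.div_add_mod n (p + 1), pow_add, pow_mul, this]
  have hper : ∀ w ∈ K, w ^ N ^ (p + 1) = w := by
    rw [hK]
    rintro _ ⟨n, rfl⟩
    simp only
    rw [← pow_mul, mul_comm, pow_mul, hp]
  -- The power map is injective on `K` because its `(p + 1)`-st iterate is the identity there.
  have hinj : ∀ v ∈ K, ∀ w ∈ K, w ^ N = v ^ N → w = v := by
    intro v hv w hw h
    rw [← hper v hv, ← hper w hw, pow_succ', pow_mul, pow_mul, h]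
  have hrange : K = Set.range fun i : Fin (p + 1) => a ^ N ^ (i : ℕ) := by
    rw [hK]
    ext w
    constructor
    · rintro ⟨n, rfl⟩
      exact ⟨⟨n % (p + 1), Nat.mod_lt _ (Nat.succ_pos p)⟩, (hcyc n).symm⟩
    · rintro ⟨i, rfl⟩
      exact ⟨i, rfl⟩
  refine ⟨(hrange ▸ Set.finite_range _ : K.Finite).toFinset, ⟨p, fun i => a ^ N ^ (i : ℕ), ?_, ?_⟩,
    by simp⟩
  · simpa using hrange
  · intro i
    refine ⟨?_, weight_eq_one_of_unique h1 fun w hw hw0 => ?_⟩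
    · simp only
      rw [Fin.val_add, Fin.val_one', Nat.add_mod_mod, ← hcyc, pow_succ, pow_mul]
    -- A root of nonzero weight of a point of `K` lies in `K`, where the power map is injective; so
    -- there is only one such root.
    · have hi : a ^ N ^ (i : ℕ) ∈ K := by rw [hK]; exact ⟨i, rfl⟩
      refine hinj _ hi w (hinv w ?_ hw0) hw
      rw [hw, hK, ← pow_mul, ← pow_succ]
      exact ⟨i + 1, rfl⟩

/-- A nonempty closed backward invariant set is the whole circle or contains a cycle. -/
theorem BackwardInvariant.eq_univ_or_exists_cycle (hN : 2 ≤ N)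
    (h_zeros : {z : Circle | m₀ z = 0}.Finite) (h1 : transferOp N m₀ 1 = 1) {K : Set Circle}
    (hK : IsClosed K) (hne : K.Nonempty) (hinv : BackwardInvariant N m₀ K) :
    K = Set.univ ∨ ∃ C : Finset Circle, IsFilterCycle N m₀ C ∧ (C : Set Circle) ⊆ K := by
  have hN0 : N ≠ 0 := by omega
  have : NeZero N := ⟨hN0⟩
  obtain ⟨K₀, hsub, hcl, hne₀, hinv₀, hmin⟩ := exists_minimal_backwardInvariant hK hne hinv
  -- The roots of nonzero weight of points of `K₀` have a closure that is again backward invariant,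
  -- hence is `K₀` by minimality. The power map sends these roots into the closed set `K₀`, and so
  -- all of `K₀`.
  have hpow : ∀ w ∈ K₀, w ^ N ∈ K₀ := by
    set P : Set Circle := {w | w ^ N ∈ K₀ ∧ m₀ w ≠ 0} with hP
    have hPK : closure P ⊆ K₀ := closure_minimal (fun w hw => hinv₀ w hw.1 hw.2) hcl
    have hPe : closure P = K₀ := by
      refine hmin _ hPK isClosed_closure ?_ fun w hw hw0 => subset_closure ⟨hPK hw, hw0⟩
      obtain ⟨z, hz⟩ := hne₀
      obtain ⟨w, rfl, hw0⟩ := exists_root_ne_zero h1 z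
      exact ⟨w, subset_closure ⟨hz, hw0⟩⟩
    have : closure P ⊆ {w | w ^ N ∈ K₀} :=
      closure_minimal (fun w hw => hw.1) (hcl.preimage (continuous_pow N))
    intro w hw
    exact this (hPe ▸ hw)
  by_cases hfull : ∀ w : Circle, w ^ N ∈ K₀ → w ∈ K₀
  · left
    rw [eq_univ_of_pow_mem hN hcl hne₀ hfull] at hsub
    exact Set.univ_subset_iff.1 hsub
  right
  push Not at hfull
  obtain ⟨q, hqa, hq⟩ := hfull
  -- The roots that leave `K₀` must be zeros of `m₀`, so there are finitely many.
  set F : Set Circle := {w | w ^ N ∈ K₀ ∧ w ∉ K₀} with hF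
  have hFfin : F.Finite := h_zeros.subset fun w hw => by
    by_contra h0
    exact hw.2 (hinv₀ w hw.1 h0)
  -- Deleting from the complement of `K₀` all escaping roots but `q` leaves an open set. Its image
  -- under the power map is a neighbourhood of `q ^ N` that meets `K₀` only in `q ^ N`.
  have hU : IsOpen (K₀ᶜ \ (F \ {q})) := hcl.isOpen_compl.sdiff (hFfin.subset Set.sdiff_subset).isClosed
  have hV := isOpenMap_circle_pow N hN0 _ hU
  have hiso : ∀ y ∈ (fun w : Circle => w ^ N) '' (K₀ᶜ \ (F \ {q})), y ∈ K₀ → y = q ^ N := by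
    rintro _ ⟨w, ⟨hw, hw'⟩, rfl⟩ hy
    by_contra hne
    exact hw' ⟨⟨hy, hw⟩, fun h => hne (by rw [Set.mem_singleton_iff.1 h])⟩
  -- By minimality the tree of any `z` in `K₀` is dense in `K₀`, so it contains the isolated point
  -- `q ^ N`.
  have htree : ∀ z ∈ K₀, Relation.TransGen (TreeStep N m₀) z (q ^ N) := by
    intro z hz
    have hsubT : ∀ w, Relation.TransGen (TreeStep N m₀) z w → w ∈ K₀ := by
      intro w hw
      induction hw with
      | single h => exact hinv₀ _ (h.1 ▸ hz) h.2
      | tail _ h ih => exact hinv₀ _ (h.1 ▸ ih) h.2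
    have hT := hmin (closure {w | Relation.TransGen (TreeStep N m₀) z w})
      (closure_minimal (fun w hw => hsubT w hw) hcl) isClosed_closure
      (by
        obtain ⟨w, hw, hw0⟩ := exists_root_ne_zero h1 z
        exact ⟨w, subset_closure (Relation.TransGen.single ⟨hw, hw0⟩)⟩)
      (backwardInvariant_closure_tree hN0 z)
    have hmem : q ^ N ∈ closure {w | Relation.TransGen (TreeStep N m₀) z w} := hT ▸ hqa
    obtain ⟨y, hyV, hyT⟩ := mem_closure_iff.1 hmem _ hV
      ⟨q, ⟨hq, fun h => h.2 rfl⟩, rfl⟩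
    rwa [hiso y hyV (hsubT y hyT)] at hyT
  -- Applied to `q ^ N` itself, this gives periodicity; applied to any `z` in `K₀`, it shows that `q
  -- ^ N` lies on the forward orbit of `z`, so `z` is a descendant and equals a forward iterate of
  -- `q ^ N`.
  obtain ⟨p, hp⟩ := exists_pow_of_transGen (htree _ hqa)
  have horb : K₀ = Set.range fun n : ℕ => (q ^ N) ^ N ^ n := by
    ext z
    constructor
    · intro hz
      obtain ⟨n, hn⟩ := exists_pow_of_transGen (htree z hz)
      exact ⟨n + 1, hn⟩
    · rintro ⟨n, rfl⟩
      induction n with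
      | zero => simpa using hqa
      | succ n ih =>
        have := hpow _ ih
        simpa only [← pow_mul, ← pow_succ, mul_assoc] using this
  obtain ⟨C, hC, hCK⟩ := isFilterCycle_of_finite_orbit h1 hN0 hinv₀ hp horb
  exact ⟨C, hC, hCK ▸ hsub⟩

end dichotomy

/-! ### The transfer operator is a Markov operator -/

/-- A real continuous function regarded as a complex one. -/
noncomputable def ofRealMap (F : C(Circle, ℝ)) : C(Circle, ℂ) := ⟨fun z => (F z : ℂ), by fun_prop⟩

@[simp] theorem ofRealMap_apply (F : C(Circle, ℝ)) (z : Circle) : ofRealMap F z = (F z : ℂ) := rfl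

theorem exists_eq_ofRealMap_add (f : C(Circle, ℂ)) :
    ∃ F G : C(Circle, ℝ), f = ofRealMap F + Complex.I • ofRealMap G := by
  refine ⟨⟨fun z => (f z).re, by fun_prop⟩, ⟨fun z => (f z).im, by fun_prop⟩, ?_⟩
  ext z
  simp [mul_comm Complex.I]

theorem transferOp_pow_one {N : ℕ} {m₀ : C(Circle, ℂ)} (h1 : transferOp N m₀ 1 = 1) (n : ℕ) : (transferOp N m₀ ^ n) 1 = 1 := by
  induction n with
  | zero => simp
  | succ n ih => rw [pow_succ, Module.End.mul_apply, h1, ih]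

section markov
variable {N : ℕ} [NeZero N] {m₀ : C(Circle, ℂ)}

/-- The transfer operator on real continuous functions. -/
noncomputable def transferReal (N : ℕ) (m₀ : C(Circle, ℂ)) (F : C(Circle, ℝ)) : C(Circle, ℝ) :=
  ⟨fun z => (transferOp N m₀ (ofRealMap F) z).re,
    Complex.continuous_re.comp (transferOp N m₀ (ofRealMap F)).continuous⟩

theorem transferReal_apply (F : C(Circle, ℝ)) (z : Circle) :
    transferReal N m₀ F z = ∑ w ∈ rootFinset N z, weight N m₀ w * F w := by
  simp [transferReal, transferOp_apply]

theorem transferOp_ofRealMap (F : C(Circle, ℝ)) :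
    transferOp N m₀ (ofRealMap F) = ofRealMap (transferReal N m₀ F) := by
  ext z
  rw [ofRealMap_apply, transferReal_apply, transferOp_apply]
  simp

theorem transferReal_nonneg {F : C(Circle, ℝ)} (hF : ∀ z, 0 ≤ F z) (z : Circle) :
    0 ≤ transferReal N m₀ F z := by
  rw [transferReal_apply]
  exact Finset.sum_nonneg fun w _ => mul_nonneg (weight_nonneg w) (hF w)

theorem norm_transferOp_apply_le (h1 : transferOp N m₀ 1 = 1) {f : C(Circle, ℂ)} {B : ℝ}
    (hB : ∀ w, ‖f w‖ ≤ B) (z : Circle) : ‖transferOp N m₀ f z‖ ≤ B := by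
  rw [transferOp_apply]
  refine (norm_sum_le _ _).trans ?_
  calc ∑ w ∈ rootFinset N z, ‖(weight N m₀ w : ℂ) * f w‖
      ≤ ∑ w ∈ rootFinset N z, weight N m₀ w * B := Finset.sum_le_sum fun w _ => by
        rw [norm_mul, Complex.norm_of_nonneg (weight_nonneg w)]
        exact mul_le_mul_of_nonneg_left (hB w) (weight_nonneg w)
    _ = B := by rw [← Finset.sum_mul, sum_weight h1, one_mul]

theorem norm_transferOp_pow_apply_le (h1 : transferOp N m₀ 1 = 1) {f : C(Circle, ℂ)} {B : ℝ}
    (hB : ∀ w, ‖f w‖ ≤ B) (n : ℕ) (z : Circle) : ‖(transferOp N m₀ ^ n) f z‖ ≤ B := by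
  induction n generalizing z with
  | zero => simpa using hB z
  | succ n ih =>
    rw [pow_succ', Module.End.mul_apply]
    exact norm_transferOp_apply_le h1 ih z

theorem norm_transferOp_pow_le (h1 : transferOp N m₀ 1 = 1) (f : C(Circle, ℂ)) (n : ℕ) :
    ‖(transferOp N m₀ ^ n) f‖ ≤ ‖f‖ :=
  (ContinuousMap.norm_le _ (norm_nonneg _)).2
    (norm_transferOp_pow_apply_le h1 f.norm_coe_le_norm n)

theorem continuous_transferOp (h1 : transferOp N m₀ 1 = 1) : Continuous (transferOp N m₀) :=
  AddMonoidHomClass.continuous_of_bound (transferOp N m₀) 1 fun f => by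
    simpa using norm_transferOp_pow_le h1 f 1

/-- The variance of a function with respect to the transition probabilities. -/
theorem transferOp_variance (h1 : transferOp N m₀ 1 = 1) (f : C(Circle, ℂ)) (z : Circle) :
    (transferOp N m₀ (f * star f) - transferOp N m₀ f * star (transferOp N m₀ f)) z =
      ((∑ w ∈ rootFinset N z, weight N m₀ w * ‖f w - transferOp N m₀ f z‖ ^ 2 : ℝ) : ℂ) := by
  set c := transferOp N m₀ f z with hc
  have hs : ∑ w ∈ rootFinset N z, (weight N m₀ w : ℂ) = 1 := by exact_mod_cast sum_weight h1 z
  have hf : ∑ w ∈ rootFinset N z, (weight N m₀ w : ℂ) * f w = c := by rw [hc, transferOp_apply]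
  have hf' : ∑ w ∈ rootFinset N z, (weight N m₀ w : ℂ) * star (f w) = star c := by
    rw [← hf]
    simp
  have key : ∀ w, ((weight N m₀ w * ‖f w - c‖ ^ 2 : ℝ) : ℂ) =
      weight N m₀ w * (f w * star (f w)) - star c * (weight N m₀ w * f w)
        - c * (weight N m₀ w * star (f w)) + (c * star c) * weight N m₀ w := by
    intro w
    have : ((‖f w - c‖ ^ 2 : ℝ) : ℂ) = (f w - c) * star (f w - c) := by
      rw [Complex.star_def, Complex.mul_conj, Complex.normSq_eq_norm_sq]
    rw [Complex.ofReal_mul, this, star_sub]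
    ring
  rw [Complex.ofReal_sum, Finset.sum_congr rfl fun w _ => key w, Finset.sum_add_distrib,
    Finset.sum_sub_distrib, Finset.sum_sub_distrib, ← Finset.mul_sum, ← Finset.mul_sum,
    ← Finset.mul_sum, hs, hf, hf']
  simp only [ContinuousMap.sub_apply, ContinuousMap.mul_apply, ContinuousMap.star_apply, ← hc,
    transferOp_apply (f := f * star f)]
  ring

end markov

/-! ### Compactness of orbits of Lipschitz functions -/

/-- The inclusion of the circle into the complex plane. -/
noncomputable def circleCoord : C(Circle, ℂ) := ⟨fun z => (z : ℂ), by fun_prop⟩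

@[simp] theorem circleCoord_apply (z : Circle) : circleCoord z = (z : ℂ) := rfl

/-- Functions on the circle that are bounded by `B` and `L`-Lipschitz in the angle. -/
def lipschitzClass (L B : ℝ) : Set C(Circle, ℂ) :=
  {f | (∀ z, ‖f z‖ ≤ B) ∧ ∀ s t : ℝ, ‖f (Circle.exp s) - f (Circle.exp t)‖ ≤ L * |s - t|}

theorem isCompact_lipschitzClass (L B : ℝ) : IsCompact (lipschitzClass L B) := by
  apply ArzelaAscoli.isCompact_of_equicontinuous
  -- A Lipschitz bound in the angle already forces continuity on the circle. So the class, seen in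
  -- the product space, is defined by closed pointwise conditions inside a product of compact balls.
  · have himg : ContinuousMap.toFun '' lipschitzClass L B = {f : Circle → ℂ | (∀ z, ‖f z‖ ≤ B) ∧
        ∀ s t : ℝ, ‖f (Circle.exp s) - f (Circle.exp t)‖ ≤ L * |s - t|} := by
      ext f
      constructor
      · rintro ⟨g, hg, rfl⟩
        exact hg
      · intro hf
        refine ⟨⟨f, ?_⟩, hf, rfl⟩
        rw [isQuotientMap_circleExp.continuous_iff]
        refine (LipschitzWith.of_dist_le_mul (K := L.toNNReal) fun s t => ?_).continuous
        rw [dist_eq_norm, Real.dist_eq]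
        exact (hf.2 s t).trans (mul_le_mul_of_nonneg_right (Real.le_coe_toNNReal L) (abs_nonneg _))
    rw [himg]
    refine (isCompact_univ_pi fun _ : Circle => isCompact_closedBall (0 : ℂ) B).of_isClosed_subset
      ?_ ?_
    · simp only [Set.ofPred_and, Set.ofPred_forall]
      refine (isClosed_iInter fun z => ?_).inter (isClosed_iInter fun s => isClosed_iInter fun t => ?_)
      · exact isClosed_le (by fun_prop) continuous_const
      · exact isClosed_le (by fun_prop) continuous_const
    · intro f hf z _
      simpa using hf.1 z
  · intro z
    obtain ⟨t, rfl⟩ := Circle.exp_surjective z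
    rw [Metric.equicontinuousAt_iff_right]
    intro ε hε
    have hL : 0 < |L| + 1 := by positivity
    have hnhds : Circle.exp '' Metric.ball t (ε / (|L| + 1)) ∈ 𝓝 (Circle.exp t) :=
      Circle.isCoveringMap_exp.isLocalHomeomorph.isOpenMap.image_mem_nhds
        (Metric.ball_mem_nhds _ (by positivity))
    filter_upwards [hnhds]
    rintro _ ⟨s, hs, rfl⟩ ⟨f, hf⟩
    rw [Metric.mem_ball, Real.dist_eq, abs_sub_comm, lt_div_iff₀ hL] at hs
    rw [dist_eq_norm]
    refine (hf.2 t s).trans_lt (lt_of_le_of_lt ?_ hs)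
    rw [mul_comm]
    exact mul_le_mul_of_nonneg_left (by linarith [le_abs_self L]) (abs_nonneg _)

/-- Roots move at speed `1/N` in the angle. The variation of `f` contributes `L/N` to the new
Lipschitz constant, because the weights average to one, and the variation of `|m₀|²` contributes
`GB/N ≤ L/N`. The total `2L/N` is at most `L` since `N ≥ 2`. -/
theorem transferOp_mem_lipschitzClass {N : ℕ} (hN : 2 ≤ N) {m₀ : C(Circle, ℂ)}
    (h1 : transferOp N m₀ 1 = 1) {G L B : ℝ}
    (hG : ∀ s t : ℝ, |‖m₀ (Circle.exp s)‖ ^ 2 - ‖m₀ (Circle.exp t)‖ ^ 2| ≤ G * |s - t|)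
    (hGL : G * B ≤ L) {f : C(Circle, ℂ)} (hf : f ∈ lipschitzClass L B) :
    transferOp N m₀ f ∈ lipschitzClass L B := by
  have hN0 : N ≠ 0 := by omega
  have : NeZero N := ⟨hN0⟩
  have hNpos : (0 : ℝ) < N := by positivity
  refine ⟨norm_transferOp_apply_le h1 hf.1, fun s t => ?_⟩
  have hB : 0 ≤ B := (norm_nonneg _).trans (hf.1 1)
  have hL : 0 ≤ L := by
    have := (norm_nonneg _).trans (hf.2 1 0)
    simpa using this
  have happ : ∀ (g : C(Circle, ℂ)) (t : ℝ), transferOp N m₀ g (Circle.exp t) = (1 / (N : ℂ)) *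
      ∑ k ∈ Finset.range N, ((‖m₀ (Circle.exp ((t + 2 * Real.pi * k) / N))‖ ^ 2 : ℝ) : ℂ) *
        g (Circle.exp ((t + 2 * Real.pi * k) / N)) := fun g t => transferFun_exp N hN0 m₀ g t
  have hsum : ∑ k ∈ Finset.range N, ‖m₀ (Circle.exp ((s + 2 * Real.pi * k) / N))‖ ^ 2 = N := by
    have := happ 1 s
    rw [h1] at this
    simp only [ContinuousMap.one_apply, mul_one] at this
    rw [← Complex.ofReal_sum, one_div, eq_inv_mul_iff_mul_eq₀ (Nat.cast_ne_zero.2 hN0), mul_one] at this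
    exact_mod_cast this.symm
  rw [happ, happ, ← mul_sub, ← Finset.sum_sub_distrib, norm_mul, norm_div, norm_one,
    Complex.norm_natCast, one_div, inv_mul_le_iff₀ hNpos]
  have hdiff : ∀ k : ℕ, |(s + 2 * Real.pi * k) / N - (t + 2 * Real.pi * k) / N| = |s - t| / N := by
    intro k
    rw [← sub_div, abs_div, abs_of_pos hNpos]
    congr 2
    ring
  have hterm : ∀ k ∈ Finset.range N,
      ‖((‖m₀ (Circle.exp ((s + 2 * Real.pi * k) / N))‖ ^ 2 : ℝ) : ℂ) *
          f (Circle.exp ((s + 2 * Real.pi * k) / N)) -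
        ((‖m₀ (Circle.exp ((t + 2 * Real.pi * k) / N))‖ ^ 2 : ℝ) : ℂ) *
          f (Circle.exp ((t + 2 * Real.pi * k) / N))‖ ≤
      ‖m₀ (Circle.exp ((s + 2 * Real.pi * k) / N))‖ ^ 2 * (L * (|s - t| / N)) +
        L * (|s - t| / N) := by
    intro k _
    set x := (s + 2 * Real.pi * k) / N with hx
    set y := (t + 2 * Real.pi * k) / N with hy
    have e : ((‖m₀ (Circle.exp x)‖ ^ 2 : ℝ) : ℂ) * f (Circle.exp x) -
        ((‖m₀ (Circle.exp y)‖ ^ 2 : ℝ) : ℂ) * f (Circle.exp y) =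
        ((‖m₀ (Circle.exp x)‖ ^ 2 : ℝ) : ℂ) * (f (Circle.exp x) - f (Circle.exp y)) +
        ((‖m₀ (Circle.exp x)‖ ^ 2 - ‖m₀ (Circle.exp y)‖ ^ 2 : ℝ) : ℂ) * f (Circle.exp y) := by
      push_cast
      ring
    rw [e]
    refine (norm_add_le _ _).trans (add_le_add ?_ ?_)
    · rw [norm_mul, Complex.norm_of_nonneg (by positivity)]
      exact mul_le_mul_of_nonneg_left ((hf.2 x y).trans_eq (by rw [hdiff])) (by positivity)
    · rw [norm_mul, Complex.norm_real, Real.norm_eq_abs]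
      have h2 := hG x y
      rw [hdiff] at h2
      calc _ ≤ (G * (|s - t| / N)) * B := mul_le_mul h2 (hf.1 _) (norm_nonneg _)
            ((abs_nonneg _).trans h2)
        _ = (G * B) * (|s - t| / N) := by ring
        _ ≤ _ := mul_le_mul_of_nonneg_right hGL (by positivity)
  refine (norm_sum_le _ _).trans ((Finset.sum_le_sum hterm).trans ?_)
  rw [Finset.sum_add_distrib, ← Finset.sum_mul, hsum, Finset.sum_const, Finset.card_range,
    nsmul_eq_mul]
  have h2N : (2 : ℝ) ≤ N := by exact_mod_cast hN
  have : (N : ℝ) * (L * (|s - t| / N)) = L * |s - t| := by field_simp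
  rw [this]
  have h0 : 0 ≤ L * |s - t| := by positivity
  nlinarith

theorem exists_lipschitz_normSq {m₀ : C(Circle, ℂ)} (h : ∃ K : NNReal, LipschitzWith K m₀) :
    ∃ G : ℝ, 0 ≤ G ∧
      ∀ s t : ℝ, |‖m₀ (Circle.exp s)‖ ^ 2 - ‖m₀ (Circle.exp t)‖ ^ 2| ≤ G * |s - t| := by
  obtain ⟨K, hK⟩ := h
  refine ⟨2 * ‖m₀‖ * K, by positivity, fun s t => ?_⟩
  have h2 := (hK.comp lipschitzWith_circleExp).dist_le_mul s t
  rw [Real.dist_eq, mul_one, dist_eq_norm] at h2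
  have h3 := (abs_norm_sub_norm_le _ _).trans h2
  rw [sq_sub_sq, abs_mul, mul_assoc]
  refine mul_le_mul ?_ h3 (abs_nonneg _) (by positivity)
  rw [abs_of_nonneg (by positivity), two_mul]
  exact add_le_add (m₀.norm_coe_le_norm _) (m₀.norm_coe_le_norm _)

/-- Functions that are Lipschitz in the angle are dense in `C(𝕋)`. -/
theorem dense_lipschitzClass : Dense {f : C(Circle, ℂ) | ∃ L B, f ∈ lipschitzClass L B} := by
  -- These functions form a star subalgebra that contains the coordinate, so Stone-Weierstrass
  -- applies.
  let A : StarSubalgebra ℂ C(Circle, ℂ) :=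
    { carrier := {f | ∃ L B, f ∈ lipschitzClass L B}
      mul_mem' := by
        rintro f g ⟨L, B, hf⟩ ⟨L', B', hg⟩
        have hB : 0 ≤ B := (norm_nonneg _).trans (hf.1 1)
        refine ⟨B * L' + L * B', B * B', fun z => ?_, fun s t => ?_⟩
        · rw [ContinuousMap.mul_apply, norm_mul]
          exact mul_le_mul (hf.1 z) (hg.1 z) (norm_nonneg _) hB
        · have e : (f * g) (Circle.exp s) - (f * g) (Circle.exp t) =
              f (Circle.exp s) * (g (Circle.exp s) - g (Circle.exp t)) +
              (f (Circle.exp s) - f (Circle.exp t)) * g (Circle.exp t) := by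
            simp only [ContinuousMap.mul_apply]
            ring
          rw [e, add_mul, mul_assoc, mul_right_comm]
          refine (norm_add_le _ _).trans (add_le_add ?_ ?_)
          · rw [norm_mul]
            exact mul_le_mul (hf.1 _) (hg.2 s t) (norm_nonneg _) hB
          · rw [norm_mul]
            exact mul_le_mul (hf.2 s t) (hg.1 _) (norm_nonneg _)
              ((norm_nonneg _).trans (hf.2 s t))
      add_mem' := by
        rintro f g ⟨L, B, hf⟩ ⟨L', B', hg⟩
        refine ⟨L + L', B + B', fun z => (norm_add_le _ _).trans (add_le_add (hf.1 z) (hg.1 z)),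
          fun s t => ?_⟩
        rw [add_mul, ContinuousMap.add_apply, ContinuousMap.add_apply, add_sub_add_comm]
        exact (norm_add_le _ _).trans (add_le_add (hf.2 s t) (hg.2 s t))
      algebraMap_mem' := fun c => ⟨0, ‖c‖, fun z => by simp [Algebra.algebraMap_eq_smul_one],
        fun s t => by simp [Algebra.algebraMap_eq_smul_one]⟩
      star_mem' := by
        rintro f ⟨L, B, hf⟩
        refine ⟨L, B, fun z => by simpa using hf.1 z, fun s t => ?_⟩
        rw [ContinuousMap.star_apply, ContinuousMap.star_apply, ← star_sub, norm_star]
        exact hf.2 s t }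
  have hsep : A.SeparatesPoints := by
    intro x y hxy
    refine ⟨_, ⟨circleCoord, ⟨1, 1, fun z => (Circle.norm_coe z).le, fun s t => ?_⟩, rfl⟩, ?_⟩
    · have := lipschitzWith_circleExp.dist_le_mul s t
      rw [Real.dist_eq] at this
      rw [← dist_eq_norm]
      exact this
    · exact fun h => hxy (Subtype.ext h)
  have := ContinuousMap.starSubalgebra_topologicalClosure_eq_top_of_separatesPoints A hsep
  rw [dense_iff_closure_eq]
  exact congrArg (fun S : StarSubalgebra ℂ C(Circle, ℂ) => (S : Set C(Circle, ℂ))) this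

/-! ### Invariant measures -/

section invariant
variable {N : ℕ} {m₀ : C(Circle, ℂ)}

theorem ContinuousMap.integrable_of_compactSpace {X E : Type*} [TopologicalSpace X] [CompactSpace X]
    [MeasurableSpace X] [BorelSpace X] [NormedAddCommGroup E] [SecondCountableTopology E]
    (ν : Measure X) [IsFiniteMeasure ν] (f : C(X, E)) : Integrable f ν := by
  refine Integrable.of_bound (C := ‖f‖) ?_ (ae_of_all _ f.norm_coe_le_norm)
  borelize E
  exact (f.continuous.measurable).aestronglyMeasurable

theorem continuous_integral_continuousMap (ν : Measure Circle) [IsFiniteMeasure ν] :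
    Continuous fun f : C(Circle, ℂ) => ∫ z, f z ∂ν := by
  rw [continuous_iff_continuousAt]
  intro f
  rw [ContinuousAt, tendsto_iff_dist_tendsto_zero]
  refine squeeze_zero (fun _ => dist_nonneg) (g := fun g => dist g f * ν.real Set.univ)
    (fun g => ?_) ?_
  · rw [dist_eq_norm, ← integral_sub (g.integrable_of_compactSpace ν) (f.integrable_of_compactSpace ν)]
    refine norm_integral_le_of_norm_le_const (ae_of_all _ fun z => ?_)
    rw [dist_eq_norm]
    exact (g - f).norm_coe_le_norm z
  · have : Tendsto (fun g : C(Circle, ℂ) => dist g f) (𝓝 f) (𝓝 0) :=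
      tendsto_iff_dist_tendsto_zero.1 tendsto_id
    simpa using this.mul_const (ν.real Set.univ)

theorem IsInvariantMeasure.integral_pow {ν : Measure Circle} (hν : IsInvariantMeasure N m₀ ν) (n : ℕ)
    (f : C(Circle, ℂ)) : ∫ z, (transferOp N m₀ ^ n) f z ∂ν = ∫ z, f z ∂ν := by
  induction n generalizing f with
  | zero => simp
  | succ n ih => rw [pow_succ, Module.End.mul_apply, ih, hν]

theorem measure_eq_of_integral_eq {ν ν' : Measure Circle} [IsFiniteMeasure ν] [IsFiniteMeasure ν']
    (h : ∀ f : C(Circle, ℂ), ∫ z, f z ∂ν = ∫ z, f z ∂ν') : ν = ν' := by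
  refine ext_of_forall_integral_eq_of_IsFiniteMeasure fun f => ?_
  have := h (ofRealMap f.toContinuousMap)
  simp only [ofRealMap_apply, integral_complex_ofReal] at this
  exact_mod_cast this

variable [NeZero N]

theorem IsInvariantMeasure.integral_transferReal {ν : Measure Circle}
    (hν : IsInvariantMeasure N m₀ ν) (F : C(Circle, ℝ)) :
    ∫ z, transferReal N m₀ F z ∂ν = ∫ z, F z ∂ν := by
  have := hν (ofRealMap F)
  simp only [transferOp_ofRealMap, ofRealMap_apply, integral_complex_ofReal] at this
  exact_mod_cast this

/-- The distance `F` to the support has integral zero, hence so does `R F`. If a root `w` of nonzero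
weight lay off the support while `w ^ N` lies in it, then `R F` would be positive near `w ^ N`, on a
set of positive measure. -/
theorem IsInvariantMeasure.backwardInvariant_support {ν : Measure Circle} [IsFiniteMeasure ν]
    (hν : IsInvariantMeasure N m₀ ν) : BackwardInvariant N m₀ ν.support := by
  intro w hw hw0
  by_contra hws
  set F : C(Circle, ℝ) := ⟨fun v => Metric.infDist v ν.support, Metric.continuous_infDist_pt _⟩
  have hF0 : ∀ v, 0 ≤ F v := fun v => Metric.infDist_nonneg
  have hint : ∫ z, F z ∂ν = 0 := by
    refine integral_eq_zero_of_ae ?_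
    filter_upwards [Measure.support_mem_ae (μ := ν)] with z hz
    exact Metric.infDist_zero_of_mem hz
  rw [← hν.integral_transferReal, integral_eq_zero_iff_of_nonneg (transferReal_nonneg hF0)
    (ContinuousMap.integrable_of_compactSpace ν _)] at hint
  have hpos : 0 < transferReal N m₀ F (w ^ N) := by
    rw [transferReal_apply]
    refine Finset.sum_pos' (fun v _ => mul_nonneg (weight_nonneg v) (hF0 v))
      ⟨w, mem_rootFinset.2 rfl, mul_pos ((weight_nonneg w).lt_of_ne' fun h =>
        hw0 (weight_eq_zero_iff.1 h)) ?_⟩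
    exact (Measure.isClosed_support.notMem_iff_infDist_pos ⟨_, hw⟩).1 hws
  have hU : {z | transferReal N m₀ F z ≠ 0} ∈ 𝓝 (w ^ N) :=
    (isOpen_ne_fun (transferReal N m₀ F).continuous continuous_const).mem_nhds hpos.ne'
  exact ((Measure.mem_support_iff_forall _).1 hw _ hU).ne' (ae_iff.1 hint)

end invariant

/-! ### Existence of an invariant probability measure -/

section existence
variable {N : ℕ} {m₀ : C(Circle, ℂ)}

/-- Cesàro means of the orbit of a function, evaluated at the point `1`. -/
noncomputable def cesaroMean (N : ℕ) (m₀ : C(Circle, ℂ)) (n : ℕ) : C(Circle, ℂ) →ₗ[ℂ] ℂ where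
  toFun f := ((n : ℂ) + 1)⁻¹ * ∑ k ∈ Finset.range (n + 1), (transferOp N m₀ ^ k) f 1
  map_add' f g := by simp [Finset.sum_add_distrib, mul_add]
  map_smul' c f := by simp [← Finset.mul_sum, mul_left_comm]

theorem cesaroMean_apply (n : ℕ) (f : C(Circle, ℂ)) : cesaroMean N m₀ n f =
    ((n : ℂ) + 1)⁻¹ * ∑ k ∈ Finset.range (n + 1), (transferOp N m₀ ^ k) f 1 := rfl

variable [NeZero N]

theorem norm_natCast_add_one_inv (n : ℕ) : ‖((n : ℂ) + 1)⁻¹‖ = ((n : ℝ) + 1)⁻¹ := by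
  rw [norm_inv, ← Nat.cast_add_one, Complex.norm_natCast, Nat.cast_add_one]

theorem norm_cesaroMean_le (h1 : transferOp N m₀ 1 = 1) (n : ℕ) (f : C(Circle, ℂ)) :
    ‖cesaroMean N m₀ n f‖ ≤ ‖f‖ := by
  rw [cesaroMean_apply, norm_mul, norm_natCast_add_one_inv, inv_mul_le_iff₀ (by positivity)]
  refine (norm_sum_le _ _).trans ((Finset.sum_le_sum fun k _ =>
    norm_transferOp_pow_apply_le h1 f.norm_coe_le_norm k 1).trans_eq ?_)
  simp

/-- The sum telescopes to two terms of norm at most `‖f‖`, divided by `n + 1`. -/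
theorem tendsto_cesaroMean_sub (h1 : transferOp N m₀ 1 = 1) (f : C(Circle, ℂ)) :
    Tendsto (fun n => cesaroMean N m₀ n (transferOp N m₀ f) - cesaroMean N m₀ n f) atTop (𝓝 0) := by
  have hlim : Tendsto (fun n : ℕ => ((n : ℝ) + 1)⁻¹ * (2 * ‖f‖)) atTop (𝓝 0) := by
    simpa using (tendsto_one_div_add_atTop_nhds_zero_nat (𝕜 := ℝ)).mul_const (2 * ‖f‖)
  refine squeeze_zero_norm (fun n => ?_) hlim
  have e : ∀ k, (transferOp N m₀ ^ k) (transferOp N m₀ f) = (transferOp N m₀ ^ (k + 1)) f :=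
    fun k => by rw [pow_succ, Module.End.mul_apply]
  rw [cesaroMean_apply, cesaroMean_apply, ← mul_sub, ← Finset.sum_sub_distrib,
    Finset.sum_congr rfl fun k _ => by rw [e k],
    Finset.sum_range_sub fun k => (transferOp N m₀ ^ k) f 1, norm_mul, norm_natCast_add_one_inv,
    two_mul]
  refine mul_le_mul_of_nonneg_left ((norm_sub_le _ _).trans (add_le_add ?_ ?_)) (by positivity)
  · exact norm_transferOp_pow_apply_le h1 f.norm_coe_le_norm _ 1
  · exact norm_transferOp_pow_apply_le h1 f.norm_coe_le_norm _ 1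

theorem transferOp_pow_ofRealMap_nonneg {F : C(Circle, ℝ)} (hF : ∀ z, 0 ≤ F z) (k : ℕ) :
    ∃ G : C(Circle, ℝ), (∀ z, 0 ≤ G z) ∧ (transferOp N m₀ ^ k) (ofRealMap F) = ofRealMap G := by
  induction k with
  | zero => exact ⟨F, hF, by simp⟩
  | succ k ih =>
    obtain ⟨G, hG, h⟩ := ih
    exact ⟨_, transferReal_nonneg hG, by
      rw [pow_succ', Module.End.mul_apply, h, transferOp_ofRealMap]⟩

theorem exists_cesaroMean_eq_ofReal_nonneg {F : C(Circle, ℝ)} (hF : ∀ z, 0 ≤ F z) (n : ℕ) :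
    ∃ r : ℝ, 0 ≤ r ∧ cesaroMean N m₀ n (ofRealMap F) = r := by
  choose G hG h using transferOp_pow_ofRealMap_nonneg (N := N) (m₀ := m₀) hF
  refine ⟨((n : ℝ) + 1)⁻¹ * ∑ k ∈ Finset.range (n + 1), G k 1,
    mul_nonneg (by positivity) (Finset.sum_nonneg fun k _ => hG k 1), ?_⟩
  simp [cesaroMean_apply, h]

/-- The transfer operator has an invariant positive normalized functional. -/
theorem exists_invariant_functional (h1 : transferOp N m₀ 1 = 1) :
    ∃ Λ : C(Circle, ℂ) →ₗ[ℂ] ℂ, Λ 1 = 1 ∧ (∀ f, Λ (transferOp N m₀ f) = Λ f) ∧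
      ∀ F : C(Circle, ℝ), (∀ z, 0 ≤ F z) → ∃ r : ℝ, 0 ≤ r ∧ Λ (ofRealMap F) = r := by
  -- Limits along one fixed free ultrafilter exist by boundedness for all `f` at once, and they
  -- depend linearly on `f`.
  have hlim : ∀ f : C(Circle, ℂ), ∃ l, Tendsto (fun n => cesaroMean N m₀ n f)
      (hyperfilter ℕ : Filter ℕ) (𝓝 l) := by
    intro f
    obtain ⟨l, -, hl⟩ := (isCompact_closedBall (0 : ℂ) ‖f‖).ultrafilter_le_nhds
      ((hyperfilter ℕ).map fun n => cesaroMean N m₀ n f) (by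
        rw [Ultrafilter.coe_map, le_principal_iff, mem_map]
        exact univ_mem' fun n => by simpa using norm_cesaroMean_le h1 n f)
    exact ⟨l, hl⟩
  choose Λ hΛ using hlim
  refine ⟨{ toFun := Λ, map_add' := fun f g => ?_, map_smul' := fun c f => ?_ }, ?_, fun f => ?_,
    fun F hF => ?_⟩
  · refine tendsto_nhds_unique (hΛ (f + g)) ?_
    simpa only [map_add] using (hΛ f).add (hΛ g)
  · refine tendsto_nhds_unique (hΛ (c • f)) ?_
    simpa only [map_smul, RingHom.id_apply] using (hΛ f).const_smul c
  · refine tendsto_nhds_unique (hΛ 1) ?_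
    have : ∀ n, cesaroMean N m₀ n 1 = 1 := by
      intro n
      have : (n : ℂ) + 1 ≠ 0 := Nat.cast_add_one_ne_zero n
      simp [cesaroMean_apply, transferOp_pow_one h1, this]
    simpa only [this] using tendsto_const_nhds
  · refine sub_eq_zero.1 (tendsto_nhds_unique ((hΛ (transferOp N m₀ f)).sub (hΛ f)) ?_)
    exact (tendsto_cesaroMean_sub h1 f).mono_left Nat.hyperfilter_le_atTop
  · choose r hr h using exists_cesaroMean_eq_ofReal_nonneg (N := N) (m₀ := m₀) hF
    have hcl : IsClosed {c : ℂ | 0 ≤ c.re ∧ c.im = 0} :=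
      (isClosed_le continuous_const Complex.continuous_re).inter
        (isClosed_eq Complex.continuous_im continuous_const)
    have := hcl.mem_of_tendsto (hΛ (ofRealMap F)) (univ_mem' fun n => by simp [h, hr])
    exact ⟨_, this.1, Complex.ext rfl this.2⟩

theorem exists_invariant_probabilityMeasure (h1 : transferOp N m₀ 1 = 1) :
    ∃ ν : Measure Circle, IsProbabilityMeasure ν ∧ IsInvariantMeasure N m₀ ν := by
  obtain ⟨Λ, hΛ1, hΛR, hΛpos⟩ := exists_invariant_functional h1
  have hadd : ∀ F G : C(Circle, ℝ), ofRealMap (F + G) = ofRealMap F + ofRealMap G := fun F G => by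
    ext; simp
  have hsmul : ∀ (c : ℝ) (F : C(Circle, ℝ)), ofRealMap (c • F) = (c : ℂ) • ofRealMap F :=
    fun c F => by ext; simp
  let ΛR : CompactlySupportedContinuousMap Circle ℝ →ₚ[ℝ] ℝ := PositiveLinearMap.mk₀
    { toFun := fun F => (Λ (ofRealMap F.toContinuousMap)).re
      map_add' := fun F G => by
        change (Λ (ofRealMap (F.toContinuousMap + G.toContinuousMap))).re = _
        rw [hadd, map_add, Complex.add_re]
      map_smul' := fun c F => by
        change (Λ (ofRealMap (c • F.toContinuousMap))).re = _
        rw [hsmul, map_smul]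
        simp } (fun F hF => by
          obtain ⟨r, hr, h⟩ := hΛpos F.toContinuousMap hF
          change 0 ≤ (Λ (ofRealMap F.toContinuousMap)).re
          rw [h]
          exact hr)
  set ν := RealRMK.rieszMeasure ΛR with hνdef
  have : IsFiniteMeasure ν := ⟨isCompact_univ.measure_lt_top⟩
  have hreal : ∀ F : C(Circle, ℝ), Λ (ofRealMap F) = ((∫ z, F z ∂ν : ℝ) : ℂ) := by
    intro F
    have hint : ∫ z, F z ∂ν = (Λ (ofRealMap F)).re :=
      RealRMK.integral_rieszMeasure ΛR ⟨F, HasCompactSupport.of_compactSpace _⟩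
    rw [hint]
    -- The Riesz measure sees only the real part of `Λ`. Writing `F` as the difference of its
    -- positive and negative parts shows that `Λ F` is real.
    obtain ⟨r, -, h⟩ := hΛpos (F ⊔ 0) fun z => by simp
    obtain ⟨r', -, h'⟩ := hΛpos ((-F) ⊔ 0) fun z => by simp
    have : ofRealMap F = ofRealMap (F ⊔ 0) - ofRealMap ((-F) ⊔ 0) := by
      ext z
      have := max_zero_sub_max_neg_zero_eq_self (F z)
      change (F z : ℂ) = ((max (F z) 0 : ℝ) : ℂ) - ((max (-F z) 0 : ℝ) : ℂ)
      exact_mod_cast this.symm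
    rw [this, map_sub, h, h']
    simp
  have hcomplex : ∀ f : C(Circle, ℂ), Λ f = ∫ z, f z ∂ν := by
    intro f
    obtain ⟨F, G, rfl⟩ := exists_eq_ofRealMap_add f
    rw [map_add, map_smul, hreal, hreal]
    simp only [ContinuousMap.add_apply, ContinuousMap.smul_apply]
    rw [integral_add ((ofRealMap F).integrable_of_compactSpace ν)
      (((ofRealMap G).integrable_of_compactSpace ν).fun_smul Complex.I), integral_smul]
    simp only [ofRealMap_apply, integral_complex_ofReal]
  refine ⟨ν, ⟨?_⟩, fun f => by rw [← hcomplex, ← hcomplex, hΛR]⟩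
  have hone := hcomplex 1
  rw [hΛ1] at hone
  simp only [ContinuousMap.one_apply, integral_const, Complex.real_smul, mul_one] at hone
  have h2 : ν.real Set.univ = 1 := by exact_mod_cast hone.symm
  rw [← ENNReal.toReal_eq_one_iff]
  exact h2

end existence

/-! ### Convergence of the iterates when there are no cycles -/

section convergence
variable {N : ℕ} {m₀ : C(Circle, ℂ)}

theorem IsInvariantMeasure.support_eq_univ (hN : 2 ≤ N)
    (h_zeros : {z : Circle | m₀ z = 0}.Finite) (h1 : transferOp N m₀ 1 = 1)
    (hcyc : ¬ ∃ C : Finset Circle, IsFilterCycle N m₀ C) {ν : Measure Circle}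
    [IsProbabilityMeasure ν] (hν : IsInvariantMeasure N m₀ ν) : ν.support = Set.univ := by
  have : NeZero N := ⟨by omega⟩
  refine (hν.backwardInvariant_support.eq_univ_or_exists_cycle hN h_zeros h1
    Measure.isClosed_support (Measure.nonempty_support (IsProbabilityMeasure.ne_zero ν))).resolve_right ?_
  rintro ⟨C, hC, -⟩
  exact hcyc ⟨C, hC⟩

theorem eq_zero_of_integral_eq_zero {ν : Measure Circle} [IsFiniteMeasure ν]
    (hν : ν.support = Set.univ) {F : Circle → ℝ} (hF : Continuous F) (h0 : ∀ z, 0 ≤ F z)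
    (h : ∫ z, F z ∂ν = 0) (z : Circle) : F z = 0 := by
  rw [integral_eq_zero_iff_of_nonneg h0
    ((⟨F, hF⟩ : C(Circle, ℝ)).integrable_of_compactSpace ν)] at h
  by_contra hz
  have hU : {z | F z ≠ 0} ∈ 𝓝 z := (isOpen_ne_fun hF continuous_const).mem_nhds hz
  exact ((Measure.mem_support_iff_forall z).1 (hν ▸ Set.mem_univ z) _ hU).ne' (ae_iff.1 h)

theorem dense_ne_zero (h_zeros : {z : Circle | m₀ z = 0}.Finite) : Dense {z : Circle | m₀ z ≠ 0} := by
  -- A connected space with more than one point has no isolated points, so removing finitely many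
  -- points from it keeps density.
  have : ConnectedSpace Circle :=
    Circle.exp_surjective.connectedSpace Circle.exp.continuous
  have : Nontrivial Circle := ⟨1, -1, fun h => by
    have := congrArg (fun z : Circle => (z : ℂ).re) h
    norm_num at this⟩
  have := dense_univ.sdiff_finite h_zeros
  rwa [← Set.compl_eq_univ_sdiff] at this

/-- If a step of the transfer operator does not lose `L²`-mass, the function is constant along the
roots of each point. -/
theorem apply_eq_transferOp_of_integral_eq (hN : N ≠ 0)
    (h_zeros : {z : Circle | m₀ z = 0}.Finite) (h1 : transferOp N m₀ 1 = 1) {ν : Measure Circle}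
    [IsFiniteMeasure ν] (hν : IsInvariantMeasure N m₀ ν) (hsupp : ν.support = Set.univ)
    {f : C(Circle, ℂ)} (h : ∫ z, (transferOp N m₀ f * star (transferOp N m₀ f)) z ∂ν =
      ∫ z, (f * star f) z ∂ν) (w : Circle) : f w = transferOp N m₀ f (w ^ N) := by
  have : NeZero N := ⟨hN⟩
  -- `D` is the variance over the fibre. It is nonnegative with integral zero by invariance and `h`,
  -- so it vanishes everywhere since `ν` has full support.
  set D := transferOp N m₀ (f * star f) - transferOp N m₀ f * star (transferOp N m₀ f) with hD
  have hDint : ∫ z, D z ∂ν = 0 := by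
    rw [hD]
    simp only [ContinuousMap.sub_apply]
    rw [integral_sub (ContinuousMap.integrable_of_compactSpace ν _)
      (ContinuousMap.integrable_of_compactSpace ν _), hν, h, sub_self]
  have hDre : ∀ z, (D z).re =
      ∑ w ∈ rootFinset N z, weight N m₀ w * ‖f w - transferOp N m₀ f z‖ ^ 2 := fun z => by
    rw [hD, transferOp_variance h1, Complex.ofReal_re]
  have hterm : ∀ z, ∀ w ∈ rootFinset N z,
      0 ≤ weight N m₀ w * ‖f w - transferOp N m₀ f z‖ ^ 2 := fun z w _ =>
    mul_nonneg (weight_nonneg w) (by positivity)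
  have hDz : ∀ z, (D z).re = 0 := eq_zero_of_integral_eq_zero hsupp
    (Complex.continuous_re.comp D.continuous)
    (fun z => by rw [hDre]; exact Finset.sum_nonneg (hterm z)) (by
      have := integral_re (𝕜 := ℂ) (D.integrable_of_compactSpace ν)
      rw [hDint] at this
      simpa using this)
  have heq : ∀ v ∈ {z : Circle | m₀ z ≠ 0}, f v = transferOp N m₀ f (v ^ N) := by
    intro v hv
    have h0 := hDz (v ^ N)
    rw [hDre, Finset.sum_eq_zero_iff_of_nonneg (hterm _)] at h0
    have h0 := (mul_eq_zero.1 (h0 v (mem_rootFinset.2 rfl))).resolve_left fun h =>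
      hv (weight_eq_zero_iff.1 h)
    exact sub_eq_zero.1 (norm_eq_zero.1 (pow_eq_zero_iff two_ne_zero |>.1 h0))
  -- Vanishing variance says nothing at the zeros of `m₀`; continuity covers them.
  have := Continuous.ext_on (dense_ne_zero h_zeros) f.continuous
    ((transferOp N m₀ f).continuous.comp (continuous_pow N)) heq
  exact congrFun this w

/-- Some point with the same `Nⁿ`-th power as `v` lies within `2π/Nⁿ` of `u`, and `f` takes the
value `f v` there; let `n → ∞`. -/
theorem eq_const_of_factors (hN : 2 ≤ N) {f : C(Circle, ℂ)} {F : ℕ → Circle → ℂ}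
    (h : ∀ n w, f w = F n (w ^ N ^ n)) (u v : Circle) : f u = f v := by
  obtain ⟨w, hw, hlim⟩ := exists_seq_pow_eq_tendsto hN (fun n => v ^ N ^ n) u
  have h1 : Tendsto (fun n => f (w n)) atTop (𝓝 (f u)) := (f.continuous.tendsto u).comp hlim
  have h2 : ∀ n, f (w n) = f v := fun n => by rw [h n, hw, ← h n]
  simp only [h2] at h1
  exact tendsto_nhds_unique tendsto_const_nhds h1 |>.symm

/-- By invariance the difference of the two sides is the integral of the fibre variance. -/
theorem integral_transferOp_mul_star_le [NeZero N] (h1 : transferOp N m₀ 1 = 1) {ν : Measure Circle}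
    [IsFiniteMeasure ν] (hν : IsInvariantMeasure N m₀ ν) (f : C(Circle, ℂ)) :
    (∫ z, (transferOp N m₀ f * star (transferOp N m₀ f)) z ∂ν).re ≤
      (∫ z, (f * star f) z ∂ν).re := by
  rw [← hν (f * star f), ← sub_nonneg, ← Complex.sub_re,
    ← integral_sub (ContinuousMap.integrable_of_compactSpace ν _)
      (ContinuousMap.integrable_of_compactSpace ν _)]
  have := integral_re (𝕜 := ℂ) ((transferOp N m₀ (f * star f) - transferOp N m₀ f *
    star (transferOp N m₀ f)).integrable_of_compactSpace ν)
  simp only [RCLike.re_to_complex, ContinuousMap.sub_apply] at this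
  rw [← this]
  refine integral_nonneg fun z => ?_
  rw [← ContinuousMap.sub_apply, transferOp_variance h1, Complex.ofReal_re]
  exact Finset.sum_nonneg fun w _ => mul_nonneg (weight_nonneg w) (by positivity)

theorem im_integral_mul_star (ν : Measure Circle) (f : C(Circle, ℂ)) :
    (∫ z, (f * star f) z ∂ν).im = 0 := by
  have : ∀ z, (f * star f) z = ((‖f z‖ ^ 2 : ℝ) : ℂ) := fun z => by
    rw [ContinuousMap.mul_apply, ContinuousMap.star_apply, Complex.star_def, Complex.mul_conj,
      Complex.normSq_eq_norm_sq]
  simp only [this, integral_complex_ofReal, Complex.ofReal_im]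

/-- The functional `V g = ∫ |g|² dν` is a Lyapunov function on a relatively compact orbit. It is
constant on the orbit of any limit point, which forces that limit point to be constant. -/
theorem tendsto_transferOp_pow_of_mem_lipschitzClass (hN : 2 ≤ N)
    (h_lipschitz : ∃ K : NNReal, LipschitzWith K m₀)
    (h_zeros : {z : Circle | m₀ z = 0}.Finite) (h1 : transferOp N m₀ 1 = 1)
    {ν : Measure Circle} [IsProbabilityMeasure ν] (hν : IsInvariantMeasure N m₀ ν)
    (hsupp : ν.support = Set.univ) {f : C(Circle, ℂ)} {L B : ℝ} (hf : f ∈ lipschitzClass L B) :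
    Tendsto (fun n => (transferOp N m₀ ^ n) f) atTop
      (𝓝 (ContinuousMap.const Circle (∫ z, f z ∂ν))) := by
  have hN0 : N ≠ 0 := by omega
  have : NeZero N := ⟨hN0⟩
  obtain ⟨G, hG0, hG⟩ := exists_lipschitz_normSq h_lipschitz
  -- The Lipschitz constant is enlarged to at least `G * B`, the condition under which `R` preserves
  -- the class.
  have hf' : f ∈ lipschitzClass (max L (G * B)) B :=
    ⟨hf.1, fun s t => (hf.2 s t).trans (mul_le_mul_of_nonneg_right (le_max_left _ _) (abs_nonneg _))⟩
  have hmem : ∀ n, (transferOp N m₀ ^ n) f ∈ lipschitzClass (max L (G * B)) B := by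
    intro n
    induction n with
    | zero => simpa using hf'
    | succ n ih =>
      rw [pow_succ', Module.End.mul_apply]
      exact transferOp_mem_lipschitzClass hN h1 hG (le_max_right _ _) ih
  set V : C(Circle, ℂ) → ℝ := fun g => (∫ z, (g * star g) z ∂ν).re with hV
  have hVcont : Continuous V := Complex.continuous_re.comp
    ((continuous_integral_continuousMap ν).comp (by fun_prop))
  have hVanti : Antitone fun n => V ((transferOp N m₀ ^ n) f) := antitone_nat_of_succ_le fun n => by
    rw [pow_succ', Module.End.mul_apply]
    exact integral_transferOp_mul_star_le h1 hν _
  have hVnonneg : ∀ g, 0 ≤ V g := fun g => by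
    have := integral_re (𝕜 := ℂ) ((g * star g).integrable_of_compactSpace ν)
    simp only [RCLike.re_to_complex] at this
    change 0 ≤ (∫ z, (g * star g) z ∂ν).re
    rw [← this]
    refine integral_nonneg fun z => ?_
    rw [ContinuousMap.mul_apply, ContinuousMap.star_apply, Complex.star_def, Complex.mul_conj,
      Complex.ofReal_re]
    exact Complex.normSq_nonneg _
  obtain ⟨c, hc⟩ : ∃ c, Tendsto (fun n => V ((transferOp N m₀ ^ n) f)) atTop (𝓝 c) :=
    ⟨_, tendsto_atTop_ciInf hVanti ⟨0, by rintro _ ⟨n, rfl⟩; exact hVnonneg _⟩⟩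
  -- It is enough that every subsequence has a further subsequence that converges to the constant.
  refine tendsto_of_subseq_tendsto fun ns hns => ?_
  obtain ⟨F, -, φ, hφ, hF⟩ := (isCompact_lipschitzClass (max L (G * B)) B).tendsto_subseq
    fun n => hmem (ns n)
  refine ⟨φ, ?_⟩
  have hRcont : ∀ k : ℕ, Continuous ⇑(transferOp N m₀ ^ k) := by
    intro k
    induction k with
    | zero => exact continuous_id
    | succ k ih =>
      rw [pow_succ']
      exact (continuous_transferOp h1).comp ih
  -- `Rᵏ F` is a limit of iterates of `f` with exponents tending to infinity, and `V` tends to `c`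
  -- along all iterates.
  have hVk : ∀ k, V ((transferOp N m₀ ^ k) F) = c := by
    intro k
    have hlim := ((hVcont.comp (hRcont k)).tendsto F).comp hF
    refine tendsto_nhds_unique hlim ?_
    have e : (V ∘ ⇑(transferOp N m₀ ^ k)) ∘ ((fun n => (transferOp N m₀ ^ ns n) f) ∘ φ) =
        (fun n => V ((transferOp N m₀ ^ n) f)) ∘ fun j => k + ns (φ j) := by
      funext j
      simp [pow_add]
    rw [e]
    exact hc.comp (tendsto_atTop_mono (fun j => Nat.le_add_left _ k) (hns.comp hφ.tendsto_atTop))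
  have hstep : ∀ k w, (transferOp N m₀ ^ k) F w = (transferOp N m₀ ^ (k + 1)) F (w ^ N) := by
    intro k w
    rw [pow_succ', Module.End.mul_apply]
    refine apply_eq_transferOp_of_integral_eq hN0 h_zeros h1 hν hsupp ?_ w
    refine Complex.ext ?_ (by rw [im_integral_mul_star, im_integral_mul_star])
    have := hVk (k + 1)
    rw [pow_succ', Module.End.mul_apply] at this
    exact this.trans (hVk k).symm
  have hfac : ∀ n w, F w = (transferOp N m₀ ^ n) F (w ^ N ^ n) := by
    intro n w
    induction n with
    | zero => simp
    | succ n ih => rw [ih, hstep, ← pow_mul, ← pow_succ]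
  have hconst : F = ContinuousMap.const Circle (∫ z, f z ∂ν) := by
    have hFint : ∫ z, F z ∂ν = ∫ z, f z ∂ν := by
      refine tendsto_nhds_unique (((continuous_integral_continuousMap ν).tendsto F).comp hF) ?_
      have e : (fun g : C(Circle, ℂ) => ∫ z, g z ∂ν) ∘ ((fun n => (transferOp N m₀ ^ ns n) f) ∘ φ) =
          fun _ => ∫ z, f z ∂ν := by
        funext j
        exact hν.integral_pow _ f
      rw [e]
      exact tendsto_const_nhds
    ext z
    rw [ContinuousMap.const_apply, ← hFint]
    simp [fun w => eq_const_of_factors hN hfac w z]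
  rw [← hconst]
  exact hF

/-- The maps `f ↦ Rⁿ f` and `f ↦ ν(f)` are contractions, so convergence on the dense set of
Lipschitz functions extends to all of `C(𝕋)`. -/
theorem tendsto_transferOp_pow (hN : 2 ≤ N)
    (h_lipschitz : ∃ K : NNReal, LipschitzWith K m₀)
    (h_zeros : {z : Circle | m₀ z = 0}.Finite) (h1 : transferOp N m₀ 1 = 1)
    {ν : Measure Circle} [IsProbabilityMeasure ν] (hν : IsInvariantMeasure N m₀ ν)
    (hsupp : ν.support = Set.univ) (f : C(Circle, ℂ)) :
    Tendsto (fun n => (transferOp N m₀ ^ n) f) atTop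
      (𝓝 (ContinuousMap.const Circle (∫ z, f z ∂ν))) := by
  have : NeZero N := ⟨by omega⟩
  rw [Metric.tendsto_atTop]
  intro ε hε
  obtain ⟨g, hgf, L, B, hg⟩ := Metric.dense_iff.1 dense_lipschitzClass f (ε / 3) (by positivity)
  rw [Metric.mem_ball] at hgf
  obtain ⟨n₀, hn₀⟩ := Metric.tendsto_atTop.1 (tendsto_transferOp_pow_of_mem_lipschitzClass hN
    h_lipschitz h_zeros h1 hν hsupp hg) (ε / 3) (by positivity)
  refine ⟨n₀, fun n hn => ?_⟩
  have ha : dist ((transferOp N m₀ ^ n) f) ((transferOp N m₀ ^ n) g) ≤ dist g f := by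
    rw [dist_comm g f, dist_eq_norm, ← map_sub, dist_eq_norm]
    exact norm_transferOp_pow_le h1 _ n
  have hb : dist (ContinuousMap.const Circle (∫ z, g z ∂ν))
      (ContinuousMap.const Circle (∫ z, f z ∂ν)) ≤ dist g f := by
    refine (ContinuousMap.dist_le dist_nonneg).2 fun z => ?_
    rw [ContinuousMap.const_apply, ContinuousMap.const_apply, dist_eq_norm,
      ← integral_sub (g.integrable_of_compactSpace ν) (f.integrable_of_compactSpace ν)]
    refine (norm_integral_le_of_norm_le_const (ae_of_all _ fun z => ?_)).trans_eq
      (by rw [probReal_univ, mul_one])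
    rw [dist_eq_norm]
    exact (g - f).norm_coe_le_norm z
  have hc := dist_triangle4 ((transferOp N m₀ ^ n) f) ((transferOp N m₀ ^ n) g)
    (ContinuousMap.const Circle (∫ z, g z ∂ν)) (ContinuousMap.const Circle (∫ z, f z ∂ν))
  linarith [hn₀ n hn]

theorem noCycles_conclusion (hN : 2 ≤ N)
    (h_lipschitz : ∃ K : NNReal, LipschitzWith K m₀)
    (h_zeros : {z : Circle | m₀ z = 0}.Finite) (h1 : transferOp N m₀ 1 = 1)
    (hcyc : ¬ ∃ C : Finset Circle, IsFilterCycle N m₀ C) :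
    (∀ c : ℂ, Module.End.HasEigenvalue (transferOp N m₀) c → ‖c‖ = 1 → c = 1) ∧
    Module.finrank ℂ (Module.End.eigenspace (transferOp N m₀) 1) = 1 ∧
    Module.finrank ℂ (Module.End.maxGenEigenspace (transferOp N m₀) 1) = 1 ∧
    ∃ ν : Measure Circle, IsProbabilityMeasure ν ∧ IsInvariantMeasure N m₀ ν ∧
      (∀ ν' : Measure Circle, IsProbabilityMeasure ν' → IsInvariantMeasure N m₀ ν' → ν' = ν) ∧
      ∀ f : C(Circle, ℂ), TendstoUniformly (fun n : ℕ => ⇑((transferOp N m₀ ^ n) f))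
        (fun _ => ∫ z, f z ∂ν) atTop := by
  have : NeZero N := ⟨by omega⟩
  obtain ⟨ν, hνp, hν⟩ := exists_invariant_probabilityMeasure h1
  have hlim := tendsto_transferOp_pow hN h_lipschitz h_zeros h1 hν
    (hν.support_eq_univ hN h_zeros h1 hcyc)
  have hlim_apply : ∀ f z, Tendsto (fun n => (transferOp N m₀ ^ n) f z) atTop (𝓝 (∫ z, f z ∂ν)) :=
    fun f z => ((continuous_eval_const z).tendsto _).comp (hlim f)
  have hfix : ∀ f, transferOp N m₀ f = f → f = ContinuousMap.const Circle (∫ z, f z ∂ν) := by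
    intro f hf
    have : ∀ n, (transferOp N m₀ ^ n) f = f := by
      intro n
      induction n with
      | zero => simp
      | succ n ih => rw [pow_succ, Module.End.mul_apply, hf, ih]
    have h := hlim f
    simp only [this] at h
    exact tendsto_nhds_unique tendsto_const_nhds h
  -- By induction `(R - 1) f` is the constant given by its own integral, and that integral is zero
  -- by invariance. So a generalized eigenvector is an eigenvector.
  have hgen : ∀ (k : ℕ) (f : C(Circle, ℂ)), ((transferOp N m₀ - 1 : Module.End ℂ C(Circle, ℂ)) ^ k) f = 0 →
      f = ContinuousMap.const Circle (∫ z, f z ∂ν) := by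
    intro k
    induction k with
    | zero =>
      intro f hf
      have : f = 0 := by simpa using hf
      subst this
      ext; simp
    | succ k ih =>
      intro f hf
      rw [pow_succ, Module.End.mul_apply] at hf
      have h := ih _ hf
      have h0 : ∫ z, ((transferOp N m₀ - 1 : Module.End ℂ C(Circle, ℂ)) f) z ∂ν = 0 := by
        simp only [LinearMap.sub_apply, Module.End.one_apply, ContinuousMap.sub_apply]
        rw [integral_sub (ContinuousMap.integrable_of_compactSpace ν _)
          (ContinuousMap.integrable_of_compactSpace ν _), hν, sub_self]
      rw [h0] at h
      refine hfix f (sub_eq_zero.1 ?_)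
      rw [LinearMap.sub_apply, Module.End.one_apply] at h
      rw [h]
      rfl
  have hspan : ∀ S : Submodule ℂ C(Circle, ℂ), (∀ f ∈ S, f = ContinuousMap.const Circle (∫ z, f z ∂ν)) →
      (1 : C(Circle, ℂ)) ∈ S → Module.finrank ℂ S = 1 := by
    intro S hS h1S
    have : S = ℂ ∙ (1 : C(Circle, ℂ)) := by
      refine le_antisymm (fun f hf => ?_) ((Submodule.span_singleton_le_iff_mem _ _).2 h1S)
      rw [hS f hf, Submodule.mem_span_singleton]
      exact ⟨∫ z, f z ∂ν, by ext; simp⟩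
    rw [this]
    exact finrank_span_singleton one_ne_zero
  refine ⟨?_, ?_, ?_, ν, hνp, hν, ?_, ?_⟩
  · intro c hc hc1
    obtain ⟨f, hf, hf0⟩ := hc.exists_hasEigenvector
    rw [Module.End.mem_eigenspace_iff] at hf
    obtain ⟨z, hz⟩ : ∃ z, f z ≠ 0 := by
      by_contra! h
      exact hf0 (ContinuousMap.ext h)
    have hn : ∀ n, (transferOp N m₀ ^ n) f z = c ^ n * f z := by
      intro n
      have : (transferOp N m₀ ^ n) f = c ^ n • f := by
        induction n with
        | zero => simp
        | succ n ih => rw [pow_succ, Module.End.mul_apply, hf, map_smul, ih, smul_smul, pow_succ']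
      rw [this]
      rfl
    have h := hlim_apply f z
    simp only [hn] at h
    -- The sequence `cⁿ f(z)` converges, while its successive differences have the constant norm `|c
    -- - 1| |f(z)|`; this norm must be zero.
    have h2 := ((tendsto_add_atTop_iff_nat 1).2 h).sub h
    rw [sub_self] at h2
    have h3 := h2.norm
    have e : ∀ n, ‖c ^ (n + 1) * f z - c ^ n * f z‖ = ‖c - 1‖ * ‖f z‖ := by
      intro n
      have : c ^ (n + 1) * f z - c ^ n * f z = c ^ n * ((c - 1) * f z) := by ring
      rw [this, norm_mul, norm_pow, hc1, one_pow, one_mul, norm_mul]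
    simp only [e, norm_zero] at h3
    have h4 := tendsto_nhds_unique tendsto_const_nhds h3
    have h5 := (mul_eq_zero.1 h4).resolve_right (norm_ne_zero_iff.2 hz)
    exact sub_eq_zero.1 (norm_eq_zero.1 h5)
  · refine hspan _ (fun f hf => hfix f ?_) ?_
    · simpa [Module.End.mem_eigenspace_iff] using hf
    · simpa [Module.End.mem_eigenspace_iff] using h1
  · refine hspan _ (fun f hf => ?_) ?_
    · rw [Module.End.mem_maxGenEigenspace] at hf
      obtain ⟨k, hk⟩ := hf
      exact hgen k f (by simpa using hk)
    · rw [Module.End.mem_maxGenEigenspace]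
      exact ⟨1, by simp [h1]⟩
  · intro ν' hν'p hν'
    refine measure_eq_of_integral_eq fun f => ?_
    -- Integrating `Rⁿ f → ν(f)` against `ν'` leaves the left side equal to `ν'(f)` for all `n`.
    have h := ((continuous_integral_continuousMap ν').tendsto _).comp (hlim f)
    have e : (fun g : C(Circle, ℂ) => ∫ z, g z ∂ν') ∘ (fun n => (transferOp N m₀ ^ n) f) =
        fun _ => ∫ z, f z ∂ν' := by
      funext n
      exact hν'.integral_pow n f
    rw [e] at h
    simpa using tendsto_nhds_unique tendsto_const_nhds h
  · intro f
    exact ContinuousMap.tendsto_iff_tendstoUniformly.1 (hlim f)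

end convergence

/-! ### Cycle points -/

/-- A Lipschitz low-pass filter with finitely many zeros and `R_{m₀} 1 = 1`. -/
structure IsLipschitzFilter (N : ℕ) (m₀ : C(Circle, ℂ)) : Prop where
  two_le : 2 ≤ N
  lipschitz : ∃ K : NNReal, LipschitzWith K m₀
  finite_zeros : {z : Circle | m₀ z = 0}.Finite
  normalized : transferOp N m₀ 1 = 1

section cyclePoints
variable {N : ℕ} {m₀ : C(Circle, ℂ)}

theorem pow_mem_cyclePoints {z : Circle} (hz : z ∈ cyclePoints N m₀) : z ^ N ∈ cyclePoints N m₀ := by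
  obtain ⟨C, hC, hzC⟩ := hz
  exact ⟨C, hC, hC.pow_mem hzC⟩

theorem norm_sq_of_mem_cyclePoints {z : Circle} (hz : z ∈ cyclePoints N m₀) : ‖m₀ z‖ ^ 2 = N := by
  obtain ⟨C, ⟨p, y, hy, h⟩, hzC⟩ := hz
  rw [← Finset.mem_coe, hy] at hzC
  obtain ⟨i, rfl⟩ := hzC
  exact (h i).2

theorem IsFilterCycle.exists_pow_eq {C : Finset Circle} (hC : IsFilterCycle N m₀ C) {z w : Circle}
    (hz : z ∈ C) (hw : w ∈ C) : ∃ n : ℕ, z ^ N ^ n = w := by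
  obtain ⟨p, y, hy, h⟩ := hC
  rw [← Finset.mem_coe, hy] at hz hw
  obtain ⟨i, rfl⟩ := hz
  obtain ⟨j, rfl⟩ := hw
  have hstep : ∀ n : ℕ, y i ^ N ^ n = y (i + Fin.ofNat (p + 1) n) := by
    intro n
    induction n with
    | zero => simp
    | succ n ih =>
      rw [pow_succ, pow_mul, ih, (h _).1, add_assoc]
      congr 2
      ext
      simp [Fin.val_add]
  refine ⟨(j - i : Fin (p + 1)).val, ?_⟩
  rw [hstep]
  simp

theorem IsFilterCycle.pow_mem' {C : Finset Circle} (hC : IsFilterCycle N m₀ C) {z : Circle}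
    (hz : z ∈ C) (n : ℕ) : z ^ N ^ n ∈ C := by
  induction n with
  | zero => simpa using hz
  | succ n ih =>
    rw [pow_succ, pow_mul]
    exact hC.pow_mem ih

/-- Two cycles with a common point are equal. -/
theorem IsFilterCycle.eq_of_mem {C C' : Finset Circle} (hC : IsFilterCycle N m₀ C)
    (hC' : IsFilterCycle N m₀ C') {z : Circle} (hz : z ∈ C) (hz' : z ∈ C') : C = C' := by
  ext w
  constructor
  · intro hw
    obtain ⟨n, rfl⟩ := hC.exists_pow_eq hz hw
    exact hC'.pow_mem' hz' n
  · intro hw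
    obtain ⟨n, rfl⟩ := hC'.exists_pow_eq hz' hw
    exact hC.pow_mem' hz n

variable (D : IsLipschitzFilter N m₀)
include D

theorem IsLipschitzFilter.neZero : NeZero N := ⟨by have := D.two_le; omega⟩

/-- A cycle point carries the whole weight of its fibre, so `m₀` vanishes at all other roots, and no
two cycle points share a fibre. -/
theorem IsLipschitzFilter.injOn_cyclePoints {z w : Circle} (hz : z ∈ cyclePoints N m₀)
    (hw : w ∈ cyclePoints N m₀) (h : z ^ N = w ^ N) : z = w := by
  have := D.neZero
  by_contra hne
  have h0 := eq_zero_of_pow_eq_of_ne D.normalized (norm_sq_of_mem_cyclePoints hw) h hne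
  have h1 := norm_sq_of_mem_cyclePoints hz
  rw [h0] at h1
  exact NeZero.ne (N : ℝ) (by simpa using h1.symm)

/-- Multiplication by the root of unity `ω ≠ 1` moves a cycle point to another root in its fibre,
which is a zero of `m₀`. This embeds the cycle points into a finite set. -/
theorem IsLipschitzFilter.finite_cyclePoints : (cyclePoints N m₀).Finite := by
  have := D.neZero
  have hN : (N : ℝ) ≠ 0 := Nat.cast_ne_zero.2 (NeZero.ne N)
  set ω : Circle := Circle.exp (2 * Real.pi / N) with hω
  have hω1 : ω ≠ 1 := by
    have h2 : (2 : ℝ) ≤ N := by exact_mod_cast D.two_le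
    intro h
    rw [hω, ← Circle.exp_zero, Circle.exp_eq_exp] at h
    obtain ⟨m, hm⟩ := h
    have hpi := Real.pi_pos.ne'
    field_simp at hm
    have h3 : (1 : ℝ) = m * N := by
      have : Real.pi * 2 * (1 - m * N) = 0 := by linear_combination hm
      linarith [(mul_eq_zero.1 this).resolve_left (by positivity)]
    have h4 : (1 : ℤ) = m * N := by exact_mod_cast h3
    have h5 : (N : ℤ) ∣ 1 := ⟨m, by rw [h4]; ring⟩
    have h6 := Int.le_of_dvd one_pos h5
    have := D.two_le
    omega
  have hωN : ω ^ N = 1 := by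
    rw [hω, ← Circle.exp_nsmul, nsmul_eq_mul, mul_div_cancel₀ _ hN, Circle.exp_two_pi]
  refine Set.Finite.subset (D.finite_zeros.preimage ((mul_left_injective ω).injOn)) ?_
  intro z hz
  refine eq_zero_of_pow_eq_of_ne D.normalized (norm_sq_of_mem_cyclePoints hz) ?_ ?_
  · simp [mul_pow, hωN]
  · simpa using hω1

theorem IsLipschitzFilter.finite_subtype : Finite (cyclePoints N m₀) :=
  D.finite_cyclePoints.to_subtype

/-- The power map as a permutation of the cycle points. -/
noncomputable def IsLipschitzFilter.shift : cyclePoints N m₀ ≃ cyclePoints N m₀ :=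
  Equiv.ofBijective (fun z => ⟨(z : Circle) ^ N, pow_mem_cyclePoints z.2⟩) (by
    have := D.finite_subtype
    refine Finite.injective_iff_bijective.1 fun z w h => ?_
    exact Subtype.ext (D.injOn_cyclePoints z.2 w.2 (congrArg Subtype.val h)))

theorem IsLipschitzFilter.coe_shift (z : cyclePoints N m₀) :
    (D.shift z : Circle) = (z : Circle) ^ N := rfl

theorem IsLipschitzFilter.ne_zero_of_cyclePoint (z : cyclePoints N m₀) : m₀ z ≠ 0 := by
  have := D.neZero
  intro h
  have h1 := norm_sq_of_mem_cyclePoints z.2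
  rw [h] at h1
  exact NeZero.ne (N : ℝ) (by simpa using h1.symm)

theorem IsLipschitzFilter.weight_le_one (z : Circle) : weight N m₀ z ≤ 1 := by
  have := D.neZero
  rw [← sum_weight D.normalized (z ^ N)]
  exact Finset.single_le_sum (f := weight N m₀) (fun w _ => weight_nonneg w) (mem_rootFinset.2 rfl)

end cyclePoints

/-! ### The scaling function on the dual side -/

/-- The point `e^{-2πix}`. -/
noncomputable def phase (x : ℝ) : Circle := Circle.exp (-(2 * Real.pi * x))

@[fun_prop]
theorem continuous_phase : Continuous phase := by unfold phase; fun_prop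

theorem phase_zero : phase 0 = 1 := by simp [phase]

theorem phase_add (x y : ℝ) : phase (x + y) = phase x * phase y := by
  rw [phase, phase, phase, ← Circle.exp_add]
  congr 1
  ring

theorem phase_pow (x : ℝ) (N : ℕ) : phase x ^ N = phase (N * x) := by
  rw [phase, phase, ← Circle.exp_nsmul]
  congr 1
  rw [nsmul_eq_mul]
  ring

theorem phase_eq_phase_iff {x y : ℝ} : phase x = phase y ↔ ∃ k : ℤ, x = y + k := by
  have hpi := Real.pi_pos.ne'
  rw [phase, phase, Circle.exp_eq_exp]
  constructor
  · rintro ⟨m, hm⟩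
    refine ⟨-m, ?_⟩
    have : 2 * Real.pi * (x - (y + ((-m : ℤ) : ℝ))) = 0 := by
      push_cast
      linear_combination -hm
    exact sub_eq_zero.1 ((mul_eq_zero.1 this).resolve_left (by positivity))
  · rintro ⟨k, rfl⟩
    exact ⟨-k, by push_cast; ring⟩

theorem phase_surjective : Function.Surjective phase := by
  intro z
  obtain ⟨t, rfl⟩ := Circle.exp_surjective z
  refine ⟨-t / (2 * Real.pi), ?_⟩
  have hpi := Real.pi_pos.ne'
  rw [phase]
  congr 1
  field_simp

theorem dist_mul_phase (ζ ζ' : Circle) (x y : ℝ) (h : ζ * phase x = ζ' * phase y) :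
    dist ζ ζ' ≤ 2 * Real.pi * (|x| + |y|) := by
  have h1 : ζ = ζ' * phase (y - x) := by
    have : phase y = phase (y - x) * phase x := by rw [← phase_add]; simp
    rw [this, ← mul_assoc] at h
    exact mul_right_cancel h
  have h2 : dist (ζ' * phase (y - x)) (ζ' * 1) = dist (phase (y - x)) 1 := by
    change dist ((ζ' * phase (y - x) : Circle) : ℂ) ((ζ' * 1 : Circle) : ℂ) =
      dist ((phase (y - x) : Circle) : ℂ) ((1 : Circle) : ℂ)
    rw [dist_eq_norm, dist_eq_norm, Circle.coe_mul, Circle.coe_mul, ← mul_sub, norm_mul,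
      Circle.norm_coe, one_mul]
  rw [mul_one] at h2
  rw [h1, h2, phase, ← Circle.exp_zero]
  refine (lipschitzWith_circleExp.dist_le_mul _ _).trans ?_
  rw [NNReal.coe_one, one_mul, dist_zero_right, norm_neg, Real.norm_eq_abs, abs_mul,
    abs_of_pos (by positivity : (0 : ℝ) < 2 * Real.pi)]
  refine mul_le_mul_of_nonneg_left ((abs_sub _ _).trans_eq (add_comm _ _)) (by positivity)

section scaling
variable {N : ℕ} {m₀ : C(Circle, ℂ)}

/-- The point of the circle over `(ζ, x)`. -/
noncomputable def pathPoint (a : cyclePoints N m₀ × ℝ) : Circle := a.1 * phase a.2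

variable (D : IsLipschitzFilter N m₀)

/-- One step back along the path `(ζ, x)`. -/
noncomputable def IsLipschitzFilter.back (a : cyclePoints N m₀ × ℝ) : cyclePoints N m₀ × ℝ :=
  (D.shift.symm a.1, a.2 / N)

/-- One step forward along the path `(ζ, x)`. -/
noncomputable def IsLipschitzFilter.fwd (a : cyclePoints N m₀ × ℝ) : cyclePoints N m₀ × ℝ :=
  (D.shift a.1, N * a.2)

theorem IsLipschitzFilter.natCast_ne_zero (D : IsLipschitzFilter N m₀) : (N : ℝ) ≠ 0 :=
  Nat.cast_ne_zero.2 D.neZero.ne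

theorem IsLipschitzFilter.back_fwd (a : cyclePoints N m₀ × ℝ) : D.back (D.fwd a) = a := by
  have := D.natCast_ne_zero
  simp [IsLipschitzFilter.back, IsLipschitzFilter.fwd, this]

theorem IsLipschitzFilter.fwd_back (a : cyclePoints N m₀ × ℝ) : D.fwd (D.back a) = a := by
  have := D.natCast_ne_zero
  simp [IsLipschitzFilter.back, IsLipschitzFilter.fwd, this, mul_div_cancel₀]

/-- Forward and backward steps as an equivalence. -/
noncomputable def IsLipschitzFilter.fwdEquiv : cyclePoints N m₀ × ℝ ≃ cyclePoints N m₀ × ℝ :=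
  ⟨D.fwd, D.back, D.back_fwd, D.fwd_back⟩

theorem IsLipschitzFilter.pathPoint_fwd (a : cyclePoints N m₀ × ℝ) :
    pathPoint (D.fwd a) = pathPoint a ^ N := by
  simp [pathPoint, IsLipschitzFilter.fwd, mul_pow, phase_pow, D.coe_shift]

theorem IsLipschitzFilter.back_iterate (n : ℕ) (a : cyclePoints N m₀ × ℝ) :
    D.back^[n] a = (D.shift.symm^[n] a.1, a.2 / N ^ n) := by
  induction n with
  | zero => simp
  | succ n ih =>
    rw [Function.iterate_succ_apply', Function.iterate_succ_apply', IsLipschitzFilter.back, ih,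
      pow_succ, div_div]

theorem IsLipschitzFilter.tendsto_div_pow (D : IsLipschitzFilter N m₀) (x : ℝ) :
    Tendsto (fun n : ℕ => x / (N : ℝ) ^ n) atTop (𝓝 0) := by
  have h1 : (1 : ℝ) < N := by exact_mod_cast D.two_le
  exact tendsto_const_nhds.div_atTop (tendsto_pow_atTop_atTop_of_one_lt h1)

/-- The quotient `m₀(ζ e^{-2πix}) / m₀(ζ)`. -/
noncomputable def filterRatio (a : cyclePoints N m₀ × ℝ) : ℂ := m₀ (pathPoint a) / m₀ a.1

theorem continuous_filterRatio (ζ : cyclePoints N m₀) :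
    Continuous fun x : ℝ => filterRatio (ζ, x) := by
  simp only [filterRatio, pathPoint]
  exact (m₀.continuous.comp (by fun_prop)).div_const _

/-- Division by `m₀(ζ)`, of modulus `√N`, turns `m₀` into a square root of the transition
probability with value `1` at `x = 0`, as convergence of the infinite product needs. -/
theorem norm_sq_filterRatio (a : cyclePoints N m₀ × ℝ) :
    ‖filterRatio a‖ ^ 2 = weight N m₀ (pathPoint a) := by
  rw [filterRatio, norm_div, div_pow, norm_sq_of_mem_cyclePoints a.1.2, weight]

include D in
theorem IsLipschitzFilter.norm_filterRatio_le_one (a : cyclePoints N m₀ × ℝ) :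
    ‖filterRatio a‖ ≤ 1 := by
  rw [← sq_le_one_iff₀ (norm_nonneg _), norm_sq_filterRatio]
  exact D.weight_le_one _

include D in
theorem IsLipschitzFilter.exists_norm_filterRatio_sub_one_le :
    ∃ K : ℝ, 0 ≤ K ∧ ∀ a : cyclePoints N m₀ × ℝ, ‖filterRatio a - 1‖ ≤ K * |a.2| := by
  obtain ⟨K, hK⟩ := D.lipschitz
  refine ⟨K * (2 * Real.pi), by positivity, fun a => ?_⟩
  have h0 := D.ne_zero_of_cyclePoint a.1
  have hn : 1 ≤ ‖m₀ a.1‖ := by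
    rw [← one_le_sq_iff₀ (norm_nonneg _), norm_sq_of_mem_cyclePoints a.1.2]
    have := D.two_le
    exact_mod_cast (by omega : 1 ≤ N)
  rw [filterRatio, div_sub_one h0, norm_div]
  refine (div_le_self (norm_nonneg _) hn).trans ?_
  rw [← dist_eq_norm]
  refine (hK.dist_le_mul _ _).trans ?_
  rw [mul_assoc]
  refine mul_le_mul_of_nonneg_left ?_ K.2
  have := dist_mul_phase (pathPoint a) a.1 0 a.2 (by rw [phase_zero, mul_one]; rfl)
  simpa using this

/-- The Fourier transform of the scaling function over the cycle point `ζ`. -/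
noncomputable def IsLipschitzFilter.phiHat (a : cyclePoints N m₀ × ℝ) : ℂ :=
  ∏' k : ℕ, filterRatio (D.back^[k + 1] a)

/-- For `|x| < M` the `k`-th factor differs from `1` by at most `K M / N ^ (k + 1)`, a geometric
series. -/
theorem IsLipschitzFilter.hasProdLocallyUniformlyOn (ζ : cyclePoints N m₀) (M : ℝ) :
    HasProdLocallyUniformlyOn (fun (k : ℕ) (x : ℝ) => filterRatio (D.back^[k + 1] (ζ, x)))
      (fun x => D.phiHat (ζ, x)) (Metric.ball 0 M) := by
  obtain ⟨K, hK0, hK⟩ := D.exists_norm_filterRatio_sub_one_le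
  have h1 : (1 : ℝ) < N := by exact_mod_cast D.two_le
  have hs : Summable fun k : ℕ => K * (M / (N : ℝ) ^ (k + 1)) := by
    have : Summable fun k : ℕ => ((N : ℝ)⁻¹) ^ k :=
      summable_geometric_of_lt_one (by positivity) (inv_lt_one_of_one_lt₀ h1)
    refine (((summable_nat_add_iff 1).2 this).mul_left (K * M)).congr fun k => ?_
    rw [inv_pow]
    ring
  have := hs.hasProdLocallyUniformlyOn_nat_one_add (R := ℂ) (K := Metric.ball (0 : ℝ) M)
    (f := fun k x => filterRatio (D.back^[k + 1] (ζ, x)) - 1) Metric.isOpen_ball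
    (Eventually.of_forall fun k x hx => by
      refine (hK _).trans (mul_le_mul_of_nonneg_left ?_ hK0)
      rw [D.back_iterate, abs_div, abs_of_pos (by positivity : (0 : ℝ) < (N : ℝ) ^ (k + 1))]
      refine div_le_div_of_nonneg_right ?_ (by positivity)
      rw [Metric.mem_ball, Real.dist_eq, sub_zero] at hx
      exact hx.le)
    (fun k => by
      simp only [D.back_iterate]
      exact (((continuous_filterRatio _).comp (continuous_id.div_const _)).sub
        continuous_const).continuousOn)
  simp only [add_sub_cancel] at this
  exact this

theorem IsLipschitzFilter.hasProd_phiHat (a : cyclePoints N m₀ × ℝ) :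
    HasProd (fun k : ℕ => filterRatio (D.back^[k + 1] a)) (D.phiHat a) :=
  (D.hasProdLocallyUniformlyOn a.1 (|a.2| + 1)).hasProd (by simp)

@[fun_prop]
theorem IsLipschitzFilter.continuous_phiHat (ζ : cyclePoints N m₀) :
    Continuous fun x : ℝ => D.phiHat (ζ, x) := by
  rw [continuous_iff_continuousAt]
  intro x
  have h := (D.hasProdLocallyUniformlyOn ζ (|x| + 1)).tendstoLocallyUniformlyOn_finsetRange
  refine (h.continuousOn (Frequently.of_forall fun n => ?_)).continuousAt
    (Metric.isOpen_ball.mem_nhds (by simp))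
  refine Continuous.continuousOn ?_
  refine continuous_finsetProd _ fun k _ => ?_
  simp only [D.back_iterate]
  exact (continuous_filterRatio _).comp (continuous_id.div_const _)

theorem IsLipschitzFilter.phiHat_zero (ζ : cyclePoints N m₀) : D.phiHat (ζ, 0) = 1 := by
  have h : ∀ k : ℕ, filterRatio (D.back^[k + 1] (ζ, (0 : ℝ))) = 1 := by
    intro k
    rw [filterRatio, pathPoint, D.back_iterate, zero_div, phase_zero, mul_one, div_self (D.ne_zero_of_cyclePoint _)]
  simp only [IsLipschitzFilter.phiHat, h, tprod_one]

theorem IsLipschitzFilter.norm_phiHat_le_one (a : cyclePoints N m₀ × ℝ) : ‖D.phiHat a‖ ≤ 1 := by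
  refine le_of_tendsto (D.hasProd_phiHat a).tendsto_prod_nat.norm (Eventually.of_forall fun n => ?_)
  rw [norm_prod]
  exact Finset.prod_le_one (fun _ _ => norm_nonneg _) fun k _ => D.norm_filterRatio_le_one _

/-- The refinement equation of the scaling function. -/
theorem IsLipschitzFilter.phiHat_fwd (a : cyclePoints N m₀ × ℝ) :
    D.phiHat (D.fwd a) = filterRatio a * D.phiHat a := by
  have e : ∀ k : ℕ, D.back^[k + 1] (D.fwd a) = D.back^[k] a := fun k => by
    rw [Function.iterate_succ_apply, D.back_fwd]
  simp only [IsLipschitzFilter.phiHat, e]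
  exact tprod_eq_zero_mul' (f := fun k => filterRatio (D.back^[k] a)) (D.hasProd_phiHat a).multipliable

end scaling

/-! ### Sums over the paths that end at a given point -/

section fiberSum
variable {N : ℕ} {m₀ : C(Circle, ℂ)}

open Classical in
/-- The sum of `Φ` over all the paths `(ζ, x)` that end at `u`. -/
noncomputable def fiberSum (Φ : cyclePoints N m₀ × ℝ → ℝ≥0∞) (u : Circle) : ℝ≥0∞ :=
  ∑' a, if pathPoint a = u then Φ a else 0

/-- The transfer operator on functions with values in `[0, ∞]`. -/
noncomputable def transferENN (N : ℕ) [NeZero N] (m₀ : C(Circle, ℂ)) (F : Circle → ℝ≥0∞)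
    (u : Circle) : ℝ≥0∞ :=
  ∑ w ∈ rootFinset N u, ENNReal.ofReal (weight N m₀ w) * F w

theorem transferENN_mono [NeZero N] {F G : Circle → ℝ≥0∞} (h : ∀ u, F u ≤ G u) (u : Circle) :
    transferENN N m₀ F u ≤ transferENN N m₀ G u :=
  Finset.sum_le_sum fun w _ => mul_le_mul_right (h w) _

theorem sum_ofReal_weight [NeZero N] (h1 : transferOp N m₀ 1 = 1) (u : Circle) :
    ∑ w ∈ rootFinset N u, ENNReal.ofReal (weight N m₀ w) = 1 := by
  rw [← ENNReal.ofReal_sum_of_nonneg fun w _ => weight_nonneg w, sum_weight h1, ENNReal.ofReal_one]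

theorem transferENN_const [NeZero N] (h1 : transferOp N m₀ 1 = 1) (c : ℝ≥0∞) (u : Circle) :
    transferENN N m₀ (fun _ => c) u = c := by
  rw [transferENN, ← Finset.sum_mul, sum_ofReal_weight h1, one_mul]

variable (D : IsLipschitzFilter N m₀)

/-- The paths that end at some root of `u` become, by one forward step, exactly the paths that end
at `u`; the sum is reindexed along this bijection. -/
theorem IsLipschitzFilter.transferENN_fiberSum [NeZero N] (Φ : cyclePoints N m₀ × ℝ → ℝ≥0∞)
    (u : Circle) : transferENN N m₀ (fiberSum Φ) u = fiberSum (fun b =>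
      ENNReal.ofReal (weight N m₀ (pathPoint (D.back b))) * Φ (D.back b)) u := by
  classical
  simp only [transferENN, fiberSum, ← ENNReal.tsum_mul_left]
  rw [← Summable.tsum_finsetSum fun _ _ => ENNReal.summable,
    ← D.fwdEquiv.tsum_eq fun b => if pathPoint b = u then
      ENNReal.ofReal (weight N m₀ (pathPoint (D.back b))) * Φ (D.back b) else 0]
  refine tsum_congr fun a => ?_
  change _ = if pathPoint (D.fwd a) = u then
    ENNReal.ofReal (weight N m₀ (pathPoint (D.back (D.fwd a)))) * Φ (D.back (D.fwd a)) else 0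
  rw [D.pathPoint_fwd, D.back_fwd]
  simp only [mul_ite, mul_zero]
  rw [Finset.sum_ite_eq]
  simp only [mem_rootFinset]

/-- The weight of a path. -/
noncomputable def IsLipschitzFilter.pathWeight (a : cyclePoints N m₀ × ℝ) : ℝ≥0∞ :=
  ENNReal.ofReal (‖D.phiHat a‖ ^ 2)

theorem IsLipschitzFilter.pathWeight_le_one (a : cyclePoints N m₀ × ℝ) : D.pathWeight a ≤ 1 := by
  rw [← ENNReal.ofReal_one]
  exact ENNReal.ofReal_le_ofReal (pow_le_one₀ (norm_nonneg _) (D.norm_phiHat_le_one a))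

/-- This is the squared modulus of the refinement equation: a path has the probability of its last
step times that of the path before this step. It makes `fiberSum D.pathWeight` harmonic. -/
theorem IsLipschitzFilter.weight_mul_pathWeight_back (b : cyclePoints N m₀ × ℝ) :
    ENNReal.ofReal (weight N m₀ (pathPoint (D.back b))) * D.pathWeight (D.back b) =
      D.pathWeight b := by
  conv_rhs => rw [← D.fwd_back b]
  rw [IsLipschitzFilter.pathWeight, IsLipschitzFilter.pathWeight, D.phiHat_fwd, norm_mul, mul_pow,
    norm_sq_filterRatio, ENNReal.ofReal_mul (weight_nonneg _)]

theorem IsLipschitzFilter.transferENN_fiberSum_mul [NeZero N] (Φ : cyclePoints N m₀ × ℝ → ℝ≥0∞)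
    (u : Circle) : transferENN N m₀ (fiberSum fun a => D.pathWeight a * Φ a) u =
      fiberSum (fun b => D.pathWeight b * Φ (D.back b)) u := by
  rw [D.transferENN_fiberSum]
  simp only [← mul_assoc, D.weight_mul_pathWeight_back]

/-- Relative to the path weights, `Rⁿ` only evaluates an observable `n` steps back, where paths are
close to the cycles. -/
theorem IsLipschitzFilter.iterate_transferENN_fiberSum_mul [NeZero N]
    (Φ : cyclePoints N m₀ × ℝ → ℝ≥0∞) (n : ℕ) :
    (transferENN N m₀)^[n] (fiberSum fun a => D.pathWeight a * Φ a) =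
      fiberSum (fun b => D.pathWeight b * Φ (D.back^[n] b)) := by
  induction n with
  | zero => rfl
  | succ n ih =>
    rw [Function.iterate_succ_apply', ih]
    funext u
    rw [D.transferENN_fiberSum_mul]
    simp only [← Function.iterate_succ_apply]

theorem iterate_transferENN_le [NeZero N] (h1 : transferOp N m₀ 1 = 1) {F : Circle → ℝ≥0∞}
    {c : ℝ≥0∞} (h : ∀ u, F u ≤ c) (n : ℕ) (u : Circle) : (transferENN N m₀)^[n] F u ≤ c := by
  induction n generalizing u with
  | zero => exact h u
  | succ n ih =>
    rw [Function.iterate_succ_apply']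
    exact (transferENN_mono ih u).trans_eq (transferENN_const h1 c u)

/-- For small `δ` the arcs around the finitely many cycle points are disjoint, and `δ < 1/2` makes
`phase` injective on `(-δ, δ)`. -/
theorem IsLipschitzFilter.exists_injective_radius (D : IsLipschitzFilter N m₀) :
    ∃ δ : ℝ, 0 < δ ∧ ∀ a b : cyclePoints N m₀ × ℝ, |a.2| < δ → |b.2| < δ →
      pathPoint a = pathPoint b → a = b := by
  have := D.finite_subtype
  have hpi := Real.pi_pos
  have h1 : ∀ᶠ δ : ℝ in 𝓝[>] 0, ∀ ζ ζ' : cyclePoints N m₀, ζ ≠ ζ' →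
      2 * Real.pi * (δ + δ) < dist (ζ : Circle) ζ' := by
    refine eventually_all.2 fun ζ => eventually_all.2 fun ζ' => ?_
    by_cases h : ζ = ζ'
    · exact Eventually.of_forall fun _ hne => absurd h hne
    · have hd : 0 < dist (ζ : Circle) ζ' := dist_pos.2 fun h' => h (Subtype.ext h')
      have hc : Tendsto (fun δ : ℝ => 2 * Real.pi * (δ + δ)) (𝓝[>] 0) (𝓝 0) := by
        have : Continuous fun δ : ℝ => 2 * Real.pi * (δ + δ) := by fun_prop
        simpa using (this.tendsto 0).mono_left nhdsWithin_le_nhds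
      filter_upwards [hc.eventually_lt_const hd] with δ hδ _ using hδ
  have h2 : ∀ᶠ δ : ℝ in 𝓝[>] 0, δ < 1 / 2 :=
    nhdsWithin_le_nhds (gt_mem_nhds (by norm_num))
  obtain ⟨δ, ⟨hδ1, hδ2⟩, hδ⟩ := ((h1.and h2).and self_mem_nhdsWithin).exists
  refine ⟨δ, hδ, ?_⟩
  rintro ⟨ζ, x⟩ ⟨ζ', y⟩ hx hy h
  simp only at hx hy
  simp only [pathPoint] at h
  have hζ : ζ = ζ' := by
    by_contra hne
    have h3 := dist_mul_phase _ _ _ _ h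
    have h4 := hδ1 ζ ζ' hne
    nlinarith
  subst hζ
  obtain ⟨k, hk⟩ := phase_eq_phase_iff.1 (mul_left_cancel h)
  have hk1 : |(k : ℝ)| < 1 := by
    have : (k : ℝ) = x - y := by rw [hk]; ring
    rw [this]
    exact (abs_sub _ _).trans_lt (by linarith)
  have hk0 : k = 0 := by
    rw [← Int.cast_abs] at hk1
    exact Int.abs_lt_one_iff.1 (by exact_mod_cast hk1)
  rw [hk, hk0]
  simp

/-- The total weight of the paths that end at a point is at most one. -/
theorem IsLipschitzFilter.fiberSum_pathWeight_le_one (u : Circle) : fiberSum D.pathWeight u ≤ 1 := by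
  classical
  have := D.neZero
  obtain ⟨δ, hδ, hinj⟩ := D.exists_injective_radius
  set χ : cyclePoints N m₀ × ℝ → ℝ≥0∞ := fun a => if |a.2| < δ then 1 else 0 with hχ
  have h0 : ∀ v, fiberSum (fun a => D.pathWeight a * χ a) v ≤ 1 := by
    intro v
    have hle : ∀ a, (if pathPoint a = v then D.pathWeight a * χ a else 0) ≤ 1 := fun a => by
      have := D.pathWeight_le_one a
      simp only [hχ]
      split_ifs <;> simp [this]
    by_cases h : ∃ a : cyclePoints N m₀ × ℝ, pathPoint a = v ∧ |a.2| < δ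
    · obtain ⟨a, ha, ha'⟩ := h
      rw [fiberSum, tsum_eq_single a]
      · exact hle a
      · intro b hb
        by_contra hne
        simp only [hχ, ite_eq_right_iff, mul_eq_zero, Classical.not_imp, not_or,
          one_ne_zero, imp_false, not_not] at hne
        exact hb (hinj b a hne.2.2 ha' (hne.1.trans ha.symm))
    · push Not at h
      rw [fiberSum, ENNReal.tsum_eq_zero.2]
      · exact zero_le_one
      · intro a
        by_cases ha : pathPoint a = v
        · simp [hχ, not_lt.2 (h a ha)]
        · simp [ha]
  have h1 : ∀ n, fiberSum (fun b => D.pathWeight b * χ (D.back^[n] b)) u ≤ 1 := fun n => by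
    rw [← D.iterate_transferENN_fiberSum_mul]
    exact iterate_transferENN_le D.normalized h0 n u
  rw [fiberSum, ENNReal.tsum_eq_iSup_sum]
  refine iSup_le fun s => ?_
  have hev : ∀ᶠ n in atTop, ∀ a ∈ s, χ (D.back^[n] a) = 1 := by
    rw [eventually_all_finset]
    intro a _
    have := (D.tendsto_div_pow a.2).abs
    rw [abs_zero] at this
    filter_upwards [this.eventually_lt_const hδ] with n hn
    simp only [hχ]
    rw [D.back_iterate, if_pos hn]
  obtain ⟨n, hn⟩ := hev.exists
  refine le_trans ?_ (h1 n)
  refine le_trans (Finset.sum_le_sum fun a ha => ?_) (ENNReal.sum_le_tsum s)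
  simp only [hn a ha, mul_one, le_refl]

/-- Over a fixed `ζ` the end point determines `x` up to an integer. So the fibre sum becomes a
periodization in the angle `t`. -/
theorem fiberSum_exp {Φ : cyclePoints N m₀ × ℝ → ℝ≥0∞} {α : cyclePoints N m₀ → ℝ}
    (hα : ∀ ζ : cyclePoints N m₀, (ζ : Circle) * phase (α ζ) = 1) (t : ℝ) :
    fiberSum Φ (phase t) = ∑' (ζ : cyclePoints N m₀) (k : ℤ), Φ (ζ, t + α ζ + k) := by
  classical
  rw [fiberSum, ENNReal.tsum_prod']
  refine tsum_congr fun ζ => ?_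
  have hmem : ∀ x, pathPoint (ζ, x) = phase t ↔ ∃ k : ℤ, t + α ζ + k = x := by
    intro x
    have : (ζ : Circle) = (phase (α ζ))⁻¹ := eq_inv_of_mul_eq_one_left (hα ζ)
    rw [pathPoint, this, inv_mul_eq_iff_eq_mul, ← phase_add, phase_eq_phase_iff]
    refine exists_congr fun k => ?_
    rw [add_comm (α ζ) t]
    exact eq_comm
  have hinj : Function.Injective fun k : ℤ => t + α ζ + k := fun k l h => by
    simpa using h
  rw [← hinj.tsum_eq]
  · refine tsum_congr fun k => ?_
    rw [if_pos ((hmem _).2 ⟨k, rfl⟩)]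
  · intro x hx
    simp only [Function.mem_support, ne_eq, ite_eq_right_iff, Classical.not_imp] at hx
    exact (hmem x).1 hx.1

theorem exists_angle (N : ℕ) (m₀ : C(Circle, ℂ)) :
    ∃ α : cyclePoints N m₀ → ℝ, ∀ ζ : cyclePoints N m₀, (ζ : Circle) * phase (α ζ) = 1 := by
  choose α hα using fun ζ : cyclePoints N m₀ => phase_surjective ((ζ : Circle)⁻¹)
  exact ⟨α, fun ζ => by rw [hα, mul_inv_cancel]⟩

theorem isQuotientMap_phase : IsQuotientMap phase := by
  have h : phase = Circle.exp ∘ fun x : ℝ => -(2 * Real.pi) * x := by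
    funext x
    simp [phase]
  have hpi := Real.pi_pos.ne'
  rw [h]
  exact isQuotientMap_circleExp.comp
    (Homeomorph.mulLeft₀ (-(2 * Real.pi)) (by simp [hpi])).isQuotientMap

/-- In the angle this is a sum of nonnegative continuous functions, and open superlevel sets descend
along the quotient map `phase`. -/
theorem IsLipschitzFilter.lowerSemicontinuous_fiberSum :
    LowerSemicontinuous (fiberSum D.pathWeight) := by
  obtain ⟨α, hα⟩ := exists_angle N m₀
  have h : LowerSemicontinuous fun t : ℝ => fiberSum D.pathWeight (phase t) := by
    simp only [fiberSum_exp hα]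
    refine lowerSemicontinuous_tsum fun ζ => lowerSemicontinuous_tsum fun k => ?_
    refine Continuous.lowerSemicontinuous ?_
    unfold IsLipschitzFilter.pathWeight
    exact ENNReal.continuous_ofReal.comp
      (((D.continuous_phiHat ζ).comp (by fun_prop)).norm.pow 2)
  rw [lowerSemicontinuous_iff_isOpen_preimage] at h ⊢
  intro c
  rw [← isQuotientMap_phase.isOpen_preimage]
  exact h c

/-- If there is a cycle, the weights of the paths that end at a point add up to one. -/
theorem IsLipschitzFilter.fiberSum_pathWeight (hcyc : ∃ C : Finset Circle, IsFilterCycle N m₀ C)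
    (u : Circle) : fiberSum D.pathWeight u = 1 := by
  have := D.neZero
  refine le_antisymm (D.fiberSum_pathWeight_le_one u) ?_
  obtain ⟨v, -, hv⟩ := LowerSemicontinuousOn.exists_isMinOn (s := (Set.univ : Set Circle))
    Set.univ_nonempty isCompact_univ (D.lowerSemicontinuous_fiberSum.lowerSemicontinuousOn _)
  have hmin : ∀ w, fiberSum D.pathWeight v ≤ fiberSum D.pathWeight w := fun w =>
    hv (Set.mem_univ w)
  refine le_trans ?_ (hmin u)
  set m := fiberSum D.pathWeight v with hm
  have hmfin : m ≠ ∞ := ((D.fiberSum_pathWeight_le_one v).trans_lt ENNReal.one_lt_top).ne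
  have hcl : IsClosed {w | fiberSum D.pathWeight w ≤ m} :=
    D.lowerSemicontinuous_fiberSum.isClosed_preimage m
  -- Minimum principle: if a root of positive weight had a value above the minimum `m`, the average
  -- at `w ^ N`, which is the value there by harmonicity, would exceed `m`.
  have hinv : BackwardInvariant N m₀ {w | fiberSum D.pathWeight w ≤ m} := by
    intro w hw hw0
    by_contra hlt
    have hlt : m < fiberSum D.pathWeight w := not_le.1 hlt
    have hharm : transferENN N m₀ (fiberSum D.pathWeight) (w ^ N) =
        fiberSum D.pathWeight (w ^ N) := by
      simpa using D.transferENN_fiberSum_mul (fun _ => 1) (w ^ N)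
    have hstrict : m < transferENN N m₀ (fiberSum D.pathWeight) (w ^ N) := by
      rw [← transferENN_const (m₀ := m₀) D.normalized m (w ^ N)]
      classical
      rw [transferENN, transferENN, ← Finset.add_sum_erase _ _ (mem_rootFinset.2 rfl),
        ← Finset.add_sum_erase _ (fun v => ENNReal.ofReal (weight N m₀ v) * fiberSum D.pathWeight v)
          (mem_rootFinset.2 rfl)]
      have hpos : ENNReal.ofReal (weight N m₀ w) ≠ 0 := by
        rw [ne_eq, ENNReal.ofReal_eq_zero, not_le]
        exact (weight_nonneg w).lt_of_ne' fun h => hw0 (weight_eq_zero_iff.1 h)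
      refine ENNReal.add_lt_add_of_lt_of_le ?_
        ((ENNReal.mul_lt_mul_iff_right hpos ENNReal.ofReal_ne_top).2 hlt)
        (Finset.sum_le_sum fun v _ => mul_le_mul_right (hmin v) _)
      rw [← Finset.sum_mul]
      refine ENNReal.mul_ne_top (ENNReal.sum_ne_top.2 fun _ _ => ENNReal.ofReal_ne_top) hmfin
    rw [hharm] at hstrict
    exact absurd hw (not_le.2 hstrict)
  -- The path `(ζ, 0)` that stays on the cycle ends at `ζ` and has weight one.
  have hone : ∀ ζ ∈ cyclePoints N m₀, 1 ≤ fiberSum D.pathWeight ζ := by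
    classical
    intro ζ hζ
    refine le_trans ?_ (ENNReal.le_tsum ((⟨ζ, hζ⟩, 0) : cyclePoints N m₀ × ℝ))
    rw [if_pos (by simp [pathPoint, phase_zero]), IsLipschitzFilter.pathWeight, D.phiHat_zero]
    simp
  have hmem : ∃ ζ ∈ cyclePoints N m₀, fiberSum D.pathWeight ζ ≤ m := by
    have hne : ∀ C : Finset Circle, IsFilterCycle N m₀ C → ∃ z, z ∈ C := by
      rintro C ⟨p, y, hy, -⟩
      exact ⟨y 0, by rw [← Finset.mem_coe, hy]; exact ⟨0, rfl⟩⟩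
    -- In either case of the dichotomy the minimum set contains a cycle point; the case of the whole
    -- circle uses `hcyc`.
    obtain h | ⟨C, hC, hsub⟩ := hinv.eq_univ_or_exists_cycle D.two_le D.finite_zeros D.normalized
      hcl ⟨v, hm.ge⟩
    · obtain ⟨C, hC⟩ := hcyc
      obtain ⟨z, hz⟩ := hne C hC
      have : z ∈ {w | fiberSum D.pathWeight w ≤ m} := h ▸ Set.mem_univ z
      exact ⟨z, ⟨C, hC, hz⟩, this⟩
    · obtain ⟨z, hz⟩ := hne C hC
      exact ⟨z, ⟨C, hC, hz⟩, hsub hz⟩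
  obtain ⟨ζ, hζ, hle⟩ := hmem
  exact (hone ζ hζ).trans hle

end fiberSum

/-! ### Invariant measures when there are cycles -/

section cycleMeasures
variable {N : ℕ} {m₀ : C(Circle, ℂ)}

theorem ofReal_transferReal [NeZero N] {F : C(Circle, ℝ)} (hF : ∀ z, 0 ≤ F z) (u : Circle) :
    ENNReal.ofReal (transferReal N m₀ F u) = transferENN N m₀ (fun z => ENNReal.ofReal (F z)) u := by
  rw [transferReal_apply, transferENN,
    ENNReal.ofReal_sum_of_nonneg fun w _ => mul_nonneg (weight_nonneg w) (hF w)]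
  exact Finset.sum_congr rfl fun w _ => ENNReal.ofReal_mul (weight_nonneg w)

theorem ofReal_iterate_transferReal [NeZero N] {F : C(Circle, ℝ)} (hF : ∀ z, 0 ≤ F z) (n : ℕ) :
    (∀ u, 0 ≤ (transferReal N m₀)^[n] F u) ∧
      (fun u => ENNReal.ofReal ((transferReal N m₀)^[n] F u)) =
        (transferENN N m₀)^[n] fun z => ENNReal.ofReal (F z) := by
  induction n with
  | zero => exact ⟨hF, rfl⟩
  | succ n ih =>
    rw [Function.iterate_succ_apply', Function.iterate_succ_apply', ← ih.2]
    exact ⟨transferReal_nonneg ih.1, funext fun u => ofReal_transferReal ih.1 u⟩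

theorem iterate_transferReal_le [NeZero N] (h1 : transferOp N m₀ 1 = 1) {F : C(Circle, ℝ)} {c : ℝ}
    (hF : ∀ z, F z ≤ c) (n : ℕ) (u : Circle) : (transferReal N m₀)^[n] F u ≤ c := by
  induction n generalizing u with
  | zero => exact hF u
  | succ n ih =>
    rw [Function.iterate_succ_apply', transferReal_apply]
    refine (Finset.sum_le_sum fun w _ =>
      mul_le_mul_of_nonneg_left (ih w) (weight_nonneg w)).trans_eq ?_
    rw [← Finset.sum_mul, sum_weight h1, one_mul]

theorem IsInvariantMeasure.integral_iterate_transferReal [NeZero N] {ν : Measure Circle}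
    (hν : IsInvariantMeasure N m₀ ν) (F : C(Circle, ℝ)) (n : ℕ) :
    ∫ z, (transferReal N m₀)^[n] F z ∂ν = ∫ z, F z ∂ν := by
  induction n with
  | zero => rfl
  | succ n ih => rw [Function.iterate_succ_apply', hν.integral_transferReal, ih]

theorem fiberSum_mul_comp_pathPoint (Φ : cyclePoints N m₀ × ℝ → ℝ≥0∞) (g : Circle → ℝ≥0∞)
    (u : Circle) : fiberSum (fun a => Φ a * g (pathPoint a)) u = fiberSum Φ u * g u := by
  classical
  rw [fiberSum, fiberSum, ← ENNReal.tsum_mul_right]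
  refine tsum_congr fun a => ?_
  split_ifs with h
  · rw [h]
  · rw [zero_mul]

variable (D : IsLipschitzFilter N m₀)

/-- Dominated convergence over the paths that end at `u`, whose weights are summable. -/
theorem IsLipschitzFilter.tendsto_toReal_fiberSum (D : IsLipschitzFilter N m₀)
    {Φ : ℕ → cyclePoints N m₀ × ℝ → ℝ} {c : ℝ}
    (h0 : ∀ n a, 0 ≤ Φ n a) (hc : ∀ n a, Φ n a ≤ c)
    (hΦ : ∀ a, Tendsto (fun n => Φ n a) atTop (𝓝 0)) (u : Circle) :
    Tendsto (fun n => (fiberSum (fun a => D.pathWeight a * ENNReal.ofReal (Φ n a)) u).toReal) atTop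
      (𝓝 0) := by
  classical
  have htop : ∀ a, D.pathWeight a ≠ ∞ := fun a => ENNReal.ofReal_ne_top
  set p : cyclePoints N m₀ × ℝ → ℝ := fun a => (if pathPoint a = u then D.pathWeight a else 0).toReal
  have hp : Summable p := by
    refine ENNReal.summable_toReal ?_
    exact ((D.fiberSum_pathWeight_le_one u).trans_lt ENNReal.one_lt_top).ne
  have e : ∀ n, (fiberSum (fun a => D.pathWeight a * ENNReal.ofReal (Φ n a)) u).toReal =
      ∑' a, p a * Φ n a := by
    intro n
    rw [fiberSum, ENNReal.tsum_toReal_eq]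
    · refine tsum_congr fun a => ?_
      simp only [p]
      split_ifs
      · rw [ENNReal.toReal_mul, ENNReal.toReal_ofReal (h0 n a)]
      · simp
    · intro a
      split_ifs
      · exact ENNReal.mul_ne_top (htop a) ENNReal.ofReal_ne_top
      · exact ENNReal.zero_ne_top
  simp only [e]
  have := tendsto_tsum_of_dominated_convergence (β := cyclePoints N m₀ × ℝ) (𝓕 := atTop)
    (f := fun n a => p a * Φ n a) (g := fun _ => 0) (bound := fun a => p a * c) (hp.mul_right c)
    (fun a => by simpa using (hΦ a).const_mul (p a))
    (Eventually.of_forall fun n a => by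
      have hpa : 0 ≤ p a := ENNReal.toReal_nonneg
      rw [Real.norm_of_nonneg (mul_nonneg hpa (h0 n a))]
      exact mul_le_mul_of_nonneg_left (hc n a) hpa)
  simpa using this

/-- For `F` the distance to the cycle points, `Rⁿ F(u)` is the weighted sum of `F` over the `n`-th
ancestors of the paths ending at `u`, because the weights add up to one. It tends to zero, while
invariance keeps `∫ Rⁿ F dν` equal to `∫ F dν`. -/
theorem IsLipschitzFilter.measure_compl_cyclePoints (D : IsLipschitzFilter N m₀)
    (hcyc : ∃ C : Finset Circle, IsFilterCycle N m₀ C)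
    {ν : Measure Circle} [IsFiniteMeasure ν] (hν : IsInvariantMeasure N m₀ ν) :
    ν (cyclePoints N m₀)ᶜ = 0 := by
  have := D.neZero
  have hne : (cyclePoints N m₀).Nonempty := by
    obtain ⟨C, hC⟩ := hcyc
    obtain ⟨p, y, hy, -⟩ := id hC
    exact ⟨y 0, C, hC, by rw [← Finset.mem_coe, hy]; exact ⟨0, rfl⟩⟩
  set F : C(Circle, ℝ) :=
    ⟨fun v => Metric.infDist v (cyclePoints N m₀), Metric.continuous_infDist_pt _⟩ with hFdef
  have hF0 : ∀ z, 0 ≤ F z := fun z => Metric.infDist_nonneg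
  have hF : ∀ z, F z ≤ ‖F‖ := fun z => (le_abs_self _).trans (F.norm_coe_le_norm z)
  have hback : ∀ n a, F (pathPoint (D.back^[n] a)) ≤ 2 * Real.pi * |a.2 / (N : ℝ) ^ n| := by
    intro n a
    refine (Metric.infDist_le_dist_of_mem (D.back^[n] a).1.2).trans ?_
    have := dist_mul_phase (pathPoint (D.back^[n] a)) (D.back^[n] a).1 0 (D.back^[n] a).2
      (by rw [phase_zero, mul_one]; rfl)
    rw [abs_zero, zero_add] at this
    refine this.trans_eq ?_
    rw [D.back_iterate]
  have hlim : ∀ u, Tendsto (fun n => (transferReal N m₀)^[n] F u) atTop (𝓝 0) := by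
    intro u
    have h := D.tendsto_toReal_fiberSum (Φ := fun n a => F (pathPoint (D.back^[n] a)))
      (fun n a => hF0 _) (fun n a => hF _) (fun a => by
        refine squeeze_zero (fun n => hF0 _) (fun n => hback n a) ?_
        simpa using (D.tendsto_div_pow a.2).abs.const_mul (2 * Real.pi)) u
    refine h.congr fun n => ?_
    rw [← D.iterate_transferENN_fiberSum_mul (fun a => ENNReal.ofReal (F (pathPoint a)))]
    have e : fiberSum (fun a => D.pathWeight a * ENNReal.ofReal (F (pathPoint a))) =
        fun z => ENNReal.ofReal (F z) := by
      funext v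
      rw [fiberSum_mul_comp_pathPoint D.pathWeight fun z => ENNReal.ofReal (F z),
        D.fiberSum_pathWeight hcyc, one_mul]
    obtain ⟨h1, h2⟩ := ofReal_iterate_transferReal (N := N) (m₀ := m₀) hF0 n
    rw [e, ← h2, ENNReal.toReal_ofReal (h1 u)]
  have hint : ∫ z, F z ∂ν = 0 := by
    have h := tendsto_integral_of_dominated_convergence (μ := ν) (fun _ => ‖F‖)
      (F := fun n z => (transferReal N m₀)^[n] F z) (f := fun _ => 0)
      (fun n => (ContinuousMap.continuous _).aestronglyMeasurable) (integrable_const _)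
      (fun n => ae_of_all _ fun z => by
        rw [Real.norm_of_nonneg ((ofReal_iterate_transferReal hF0 n).1 z)]
        exact iterate_transferReal_le D.normalized hF n z) (ae_of_all _ hlim)
    simp only [hν.integral_iterate_transferReal, integral_zero] at h
    exact tendsto_nhds_unique tendsto_const_nhds h
  rw [integral_eq_zero_iff_of_nonneg hF0 (F.integrable_of_compactSpace ν)] at hint
  refine measure_mono_null (fun z hz => ?_) (ae_iff.1 hint)
  exact ((D.finite_cyclePoints.isClosed.notMem_iff_infDist_pos hne).1 hz).ne'

theorem measure_eq_sum_dirac {X : Type*} [MeasurableSpace X] [MeasurableSingletonClass X]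
    {S : Set X} (hS : S.Countable) {ν : Measure X} (h : ν Sᶜ = 0) :
    ν = Measure.sum fun z : S => ν {(z : X)} • Measure.dirac (z : X) := by
  have := hS.to_subtype
  ext s hs
  rw [Measure.sum_apply _ hs]
  simp only [Measure.smul_apply, Measure.dirac_apply' _ hs, smul_eq_mul]
  have h1 : ν s = ν (s ∩ S) := by
    refine le_antisymm ?_ (measure_mono Set.inter_subset_left)
    calc ν s ≤ ν (s ∩ S ∪ Sᶜ) := measure_mono fun x hx => by
          by_cases hxS : x ∈ S
          · exact Or.inl ⟨hx, hxS⟩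
          · exact Or.inr hxS
      _ ≤ ν (s ∩ S) + ν Sᶜ := measure_union_le _ _
      _ = ν (s ∩ S) := by rw [h, add_zero]
  have h2 : s ∩ S = ⋃ z : S, {(z : X)} ∩ s := by
    ext x
    simp [and_comm]
  rw [h1, h2, measure_iUnion]
  · refine tsum_congr fun z => ?_
    by_cases hz : (z : X) ∈ s
    · simp [hz]
    · simp [hz]
  · intro z w hzw
    refine Set.disjoint_left.2 fun x hx hx' => hzw (Subtype.ext ?_)
    exact hx.1.symm.trans hx'.1
  · exact fun z => (measurableSet_singleton _).inter hs

end cycleMeasures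

/-! ### The functional calculus of a unitary operator -/

/-- Induction on continuous functions on the circle by the Stone-Weierstrass theorem. -/
theorem circle_induction {P : C(Circle, ℂ) → Prop} (hclosed : IsClosed {f | P f})
    (hadd : ∀ f g, P f → P g → P (f + g)) (hmul : ∀ f g, P f → P g → P (f * g))
    (hstar : ∀ f, P f → P (star f)) (hconst : ∀ c : ℂ, P (algebraMap ℂ _ c))
    (hcoord : P circleCoord) (f : C(Circle, ℂ)) : P f := by
  let A : StarSubalgebra ℂ C(Circle, ℂ) :=
    { carrier := {f | P f}
      mul_mem' := fun {f g} hf hg => hmul f g hf hg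
      add_mem' := fun {f g} hf hg => hadd f g hf hg
      algebraMap_mem' := hconst
      star_mem' := fun {f} hf => hstar f hf }
  have hsep : A.SeparatesPoints := fun x y hxy =>
    ⟨_, ⟨circleCoord, hcoord, rfl⟩, fun h => hxy (Subtype.ext h)⟩
  have htop := ContinuousMap.starSubalgebra_topologicalClosure_eq_top_of_separatesPoints A hsep
  have hf : f ∈ A.topologicalClosure := htop ▸ StarSubalgebra.mem_top
  have : f ∈ closure {f | P f} := hf
  rwa [hclosed.closure_eq] at this

/-- A unitary operator as a bounded operator. -/
noncomputable abbrev unitaryCLM {H : Type*} [NormedAddCommGroup H] [InnerProductSpace ℂ H]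
    (T : H ≃ₗᵢ[ℂ] H) : H →L[ℂ] H := ((T : H ≃L[ℂ] H) : H →L[ℂ] H)

theorem unitaryCLM_pow {H : Type*} [NormedAddCommGroup H] [InnerProductSpace ℂ H]
    (T : H ≃ₗᵢ[ℂ] H) (n : ℕ) : unitaryCLM (T ^ n) = unitaryCLM T ^ n := by
  induction n with
  | zero => rfl
  | succ n ih => rw [pow_succ, pow_succ, ← ih]; rfl

section calculus
variable {H : Type*} [NormedAddCommGroup H] [InnerProductSpace ℂ H] [CompleteSpace H]
variable {H' : Type*} [NormedAddCommGroup H'] [InnerProductSpace ℂ H'] [CompleteSpace H']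

theorem star_unitaryCLM (T : H ≃ₗᵢ[ℂ] H) : star (unitaryCLM T) = unitaryCLM T.symm := by
  rw [ContinuousLinearMap.star_eq_adjoint]
  exact LinearIsometryEquiv.adjoint_eq_symm T

theorem unitaryCLM_mem_unitary (T : H ≃ₗᵢ[ℂ] H) : unitaryCLM T ∈ unitary (H →L[ℂ] H) := by
  rw [Unitary.mem_iff, star_unitaryCLM]
  constructor <;> ext x <;> simp [unitaryCLM]

theorem isStarNormal_unitaryCLM (T : H ≃ₗᵢ[ℂ] H) : IsStarNormal (unitaryCLM T) := by
  constructor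
  have h := Unitary.mem_iff.1 (unitaryCLM_mem_unitary T)
  exact h.1.trans h.2.symm

theorem spectrum_unitaryCLM (T : H ≃ₗᵢ[ℂ] H) :
    spectrum ℂ (unitaryCLM T) ⊆ Metric.sphere (0 : ℂ) 1 :=
  spectrum.subset_circle_of_unitary (unitaryCLM_mem_unitary T)

theorem extend_coeHom_apply (f : C(Circle, ℂ)) (z : Circle) :
    Function.extend Circle.coeHom f 0 (z : ℂ) = f z :=
  Function.Injective.extend_apply (f := fun z : Circle => (z : ℂ)) Subtype.coe_injective f 0 z

theorem exists_circle_of_mem_spectrum {T : H ≃ₗᵢ[ℂ] H} {z : ℂ} (hz : z ∈ spectrum ℂ (unitaryCLM T)) :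
    ∃ w : Circle, (w : ℂ) = z :=
  ⟨⟨z, spectrum_unitaryCLM T hz⟩, rfl⟩

theorem continuousOn_extend_coeHom (f : C(Circle, ℂ)) :
    ContinuousOn (Function.extend Circle.coeHom f 0) (Metric.sphere (0 : ℂ) 1) := by
  rw [continuousOn_iff_continuous_domRestrict]
  have h : (Metric.sphere (0 : ℂ) 1).domRestrict (Function.extend Circle.coeHom f 0) =
      fun z : Metric.sphere (0 : ℂ) 1 => f (⟨z.1, z.2⟩ : Circle) := by
    funext z
    exact extend_coeHom_apply f ⟨z.1, z.2⟩
  rw [h]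
  exact f.continuous.comp (continuous_induced_rng.2 continuous_subtype_val)

/-- The functional calculus as a homomorphism of star algebras. -/
noncomputable def calculusHom (T : H ≃ₗᵢ[ℂ] H) : C(Circle, ℂ) →⋆ₐ[ℂ] (H →L[ℂ] H) where
  toFun := unitaryCalculus T
  map_one' := by
    have := isStarNormal_unitaryCLM T
    rw [unitaryCalculus, ← cfc_one ℂ (unitaryCLM T)]
    refine cfc_congr fun z hz => ?_
    obtain ⟨w, rfl⟩ := exists_circle_of_mem_spectrum hz
    rw [extend_coeHom_apply]
    rfl
  map_zero' := by
    rw [unitaryCalculus, ← cfc_zero ℂ (unitaryCLM T)]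
    refine cfc_congr fun z hz => ?_
    obtain ⟨w, rfl⟩ := exists_circle_of_mem_spectrum hz
    rw [extend_coeHom_apply]
    rfl
  map_add' f g := by
    have hc := fun f => (continuousOn_extend_coeHom f).mono (spectrum_unitaryCLM T)
    rw [unitaryCalculus, unitaryCalculus, unitaryCalculus, ← cfc_add _ _ _ (hc f) (hc g)]
    refine cfc_congr fun z hz => ?_
    obtain ⟨w, rfl⟩ := exists_circle_of_mem_spectrum hz
    simp only [extend_coeHom_apply, ContinuousMap.add_apply]
  map_mul' f g := by
    have hc := fun f => (continuousOn_extend_coeHom f).mono (spectrum_unitaryCLM T)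
    rw [unitaryCalculus, unitaryCalculus, unitaryCalculus, ← cfc_mul _ _ _ (hc f) (hc g)]
    refine cfc_congr fun z hz => ?_
    obtain ⟨w, rfl⟩ := exists_circle_of_mem_spectrum hz
    simp only [extend_coeHom_apply, ContinuousMap.mul_apply]
  commutes' c := by
    have := isStarNormal_unitaryCLM T
    rw [unitaryCalculus, ← cfc_const c (unitaryCLM T)]
    refine cfc_congr fun z hz => ?_
    obtain ⟨w, rfl⟩ := exists_circle_of_mem_spectrum hz
    rw [extend_coeHom_apply]
    simp [Algebra.algebraMap_eq_smul_one]
  map_star' f := by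
    rw [unitaryCalculus, unitaryCalculus, ← cfc_star]
    refine cfc_congr fun z hz => ?_
    obtain ⟨w, rfl⟩ := exists_circle_of_mem_spectrum hz
    simp only [extend_coeHom_apply, ContinuousMap.star_apply]

theorem calculusHom_apply (T : H ≃ₗᵢ[ℂ] H) (f : C(Circle, ℂ)) :
    calculusHom T f = unitaryCalculus T f := rfl

theorem continuous_calculusHom (T : H ≃ₗᵢ[ℂ] H) : Continuous (calculusHom T) :=
  AddMonoidHomClass.continuous_of_bound (calculusHom T) 1 fun f => by
    simpa using NonUnitalStarAlgHom.norm_apply_le (calculusHom T) f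

theorem calculusHom_circleCoord (T : H ≃ₗᵢ[ℂ] H) : calculusHom T circleCoord = unitaryCLM T := by
  have := isStarNormal_unitaryCLM T
  rw [calculusHom_apply, unitaryCalculus]
  conv_rhs => rw [← cfc_id ℂ (unitaryCLM T)]
  refine cfc_congr fun z hz => ?_
  obtain ⟨w, rfl⟩ := exists_circle_of_mem_spectrum hz
  rw [extend_coeHom_apply]
  rfl

theorem calculusHom_star_circleCoord (T : H ≃ₗᵢ[ℂ] H) :
    calculusHom T (star circleCoord) = unitaryCLM T.symm := by
  rw [map_star, calculusHom_circleCoord, star_unitaryCLM]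

/-- Operators that intertwine two unitaries intertwine their functional calculi. -/
theorem calculusHom_intertwine (A : H →L[ℂ] H') {T : H ≃ₗᵢ[ℂ] H} {T' : H' ≃ₗᵢ[ℂ] H'}
    (h : ∀ x, A (T x) = T' (A x)) (f : C(Circle, ℂ)) (x : H) :
    A (calculusHom T f x) = calculusHom T' f (A x) := by
  -- The claim is proved for `f` and `star f` together, so that it is stable under `star` in the
  -- Stone-Weierstrass induction.
  suffices hP : (∀ x, A (calculusHom T f x) = calculusHom T' f (A x)) ∧
      ∀ x, A (calculusHom T (star f) x) = calculusHom T' (star f) (A x) from hP.1 x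
  refine circle_induction (P := fun f => (∀ x, A (calculusHom T f x) = calculusHom T' f (A x)) ∧
      ∀ x, A (calculusHom T (star f) x) = calculusHom T' (star f) (A x)) ?_ ?_ ?_ ?_ ?_ ?_ f
  · have hc : ∀ (f : C(Circle, ℂ) → C(Circle, ℂ)), Continuous f → ∀ x,
        IsClosed {g | A (calculusHom T (f g) x) = calculusHom T' (f g) (A x)} := fun f hf x =>
      isClosed_eq
        (A.continuous.comp (((continuous_calculusHom T).comp hf).clm_apply continuous_const))
        (((continuous_calculusHom T').comp hf).clm_apply continuous_const)
    simp only [Set.ofPred_and, Set.ofPred_forall]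
    exact (isClosed_iInter fun x => hc id continuous_id x).inter
      (isClosed_iInter fun x => hc star continuous_star x)
  · rintro f g ⟨hf, hf'⟩ ⟨hg, hg'⟩
    simp [star_add, hf, hg, hf', hg']
  · rintro f g ⟨hf, hf'⟩ ⟨hg, hg'⟩
    simp [star_mul, hf, hg, hf', hg']
  · rintro f ⟨hf, hf'⟩
    exact ⟨hf', by rwa [star_star]⟩
  · intro c
    constructor <;> intro x
    · simp only [Algebra.algebraMap_eq_smul_one]
      simp
    · rw [← algebraMap_star_comm]
      simp only [Algebra.algebraMap_eq_smul_one]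
      simp
  · constructor <;> intro x
    · rw [calculusHom_circleCoord, calculusHom_circleCoord]
      exact h x
    · rw [calculusHom_star_circleCoord, calculusHom_star_circleCoord]
      change A (T.symm x) = T'.symm (A x)
      rw [LinearIsometryEquiv.eq_symm_apply, ← h, LinearIsometryEquiv.apply_symm_apply]

/-- Composition with the power map of the circle. -/
noncomputable def powComp (N : ℕ) (f : C(Circle, ℂ)) : C(Circle, ℂ) :=
  f.comp ⟨fun z => z ^ N, continuous_pow N⟩

@[simp] theorem powComp_apply (N : ℕ) (f : C(Circle, ℂ)) (z : Circle) : powComp N f z = f (z ^ N) := rfl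

theorem calculusHom_pow (T : H ≃ₗᵢ[ℂ] H) (N : ℕ) (f : C(Circle, ℂ)) :
    calculusHom (T ^ N) f = calculusHom T (powComp N f) := by
  refine circle_induction (P := fun f => calculusHom (T ^ N) f = calculusHom T (powComp N f))
    ?_ ?_ ?_ ?_ ?_ ?_ f
  · exact isClosed_eq (continuous_calculusHom _)
      ((continuous_calculusHom _).comp (ContinuousMap.continuous_precomp _))
  · intro f g hf hg
    rw [map_add, hf, hg, ← map_add]
    rfl
  · intro f g hf hg
    rw [map_mul, hf, hg, ← map_mul]
    rfl
  · intro f hf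
    rw [map_star, hf, ← map_star]
    rfl
  · intro c
    have : powComp N (algebraMap ℂ _ c) = algebraMap ℂ _ c := rfl
    rw [this, AlgHomClass.commutes, AlgHomClass.commutes]
  · have : powComp N circleCoord = circleCoord ^ N := by
      ext z
      simp
    rw [this, map_pow, calculusHom_circleCoord, calculusHom_circleCoord, unitaryCLM_pow]

theorem calculusHom_circleCoord_pow_mul (T : H ≃ₗᵢ[ℂ] H) (n : ℕ) (f : C(Circle, ℂ)) (x : H) :
    (T ^ n) (calculusHom T f x) = calculusHom T (circleCoord ^ n * f) x := by
  rw [map_mul, map_pow, calculusHom_circleCoord, ← unitaryCLM_pow]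
  rfl

theorem inner_calculusHom (T : H ≃ₗᵢ[ℂ] H) (f g : C(Circle, ℂ)) (x y : H) :
    inner ℂ (calculusHom T f x) (calculusHom T g y) = inner ℂ x (calculusHom T (star f * g) y) := by
  rw [map_mul, map_star, ContinuousLinearMap.star_eq_adjoint, mul_apply_eq_comp,
    ContinuousLinearMap.adjoint_inner_right]

end calculus

/-! ### Uniqueness of wavelet representations -/

theorem inner_linearCombination {H : Type*} [NormedAddCommGroup H] [InnerProductSpace ℂ H]
    {ι : Type*} (v : ι → H) (x y : ι →₀ ℂ) :
    inner ℂ (Finsupp.linearCombination ℂ v x) (Finsupp.linearCombination ℂ v y) =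
      x.sum fun i a => y.sum fun j b => star a * (b * inner ℂ (v i) (v j)) := by
  rw [Finsupp.linearCombination_apply, Finsupp.linearCombination_apply, Finsupp.sum_inner]
  refine Finsupp.sum_congr fun i _ => ?_
  rw [Finsupp.inner_sum]
  refine Finsupp.sum_congr fun j _ => ?_
  rw [inner_smul_left, inner_smul_right]
  rfl

section uniqueness
variable {H : Type*} [NormedAddCommGroup H] [InnerProductSpace ℂ H] [CompleteSpace H]
variable {H' : Type*} [NormedAddCommGroup H'] [InnerProductSpace ℂ H'] [CompleteSpace H']

/-- Two total families with the same Gram matrix are unitarily equivalent. -/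
theorem exists_linearIsometryEquiv_of_inner_eq {ι : Type*} {v : ι → H} {v' : ι → H'}
    (hv : (Submodule.span ℂ (Set.range v)).topologicalClosure = ⊤)
    (hv' : (Submodule.span ℂ (Set.range v')).topologicalClosure = ⊤)
    (h : ∀ i j, inner ℂ (v i) (v j) = inner ℂ (v' i) (v' j)) :
    ∃ J : H ≃ₗᵢ[ℂ] H', ∀ i, J (v i) = v' i := by
  have hd : DenseRange (Finsupp.linearCombination ℂ v) := by
    rw [DenseRange, ← LinearMap.coe_range, Finsupp.range_linearCombination,
      Submodule.dense_iff_topologicalClosure_eq_top]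
    exact hv
  have hd' : DenseRange (Finsupp.linearCombination ℂ v') := by
    rw [DenseRange, ← LinearMap.coe_range, Finsupp.range_linearCombination,
      Submodule.dense_iff_topologicalClosure_eq_top]
    exact hv'
  have hnorm : ∀ x, ‖Finsupp.linearCombination ℂ v' (LinearEquiv.refl ℂ _ x)‖ =
      ‖Finsupp.linearCombination ℂ v x‖ := by
    intro x
    rw [norm_eq_sqrt_re_inner (𝕜 := ℂ), norm_eq_sqrt_re_inner (𝕜 := ℂ), LinearEquiv.refl_apply,
      inner_linearCombination, inner_linearCombination]
    simp only [h]
  refine ⟨(LinearEquiv.refl ℂ (ι →₀ ℂ)).extendOfIsometry (Finsupp.linearCombination ℂ v)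
    (Finsupp.linearCombination ℂ v') hd hd' hnorm, fun i => ?_⟩
  have := LinearEquiv.extendOfIsometry_eq (LinearEquiv.refl ℂ (ι →₀ ℂ)) _ _ hd hd' hnorm
    (Finsupp.single i 1)
  simpa using this

variable {N : ℕ} {m₀ : C(Circle, ℂ)} {U T : H ≃ₗᵢ[ℂ] H} {φ : H}
  {U' T' : H' ≃ₗᵢ[ℂ] H'} {φ' : H'}

/-- The operation on coefficient functions that corresponds to dilation. -/
noncomputable def dilateCoeff (N : ℕ) (m₀ f : C(Circle, ℂ)) : C(Circle, ℂ) := powComp N f * m₀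

/-- The vector `U⁻ⁿ f(T) φ`. -/
noncomputable def waveletVector (U T : H ≃ₗᵢ[ℂ] H) (φ : H) (i : ℕ × C(Circle, ℂ)) : H :=
  (U⁻¹ ^ i.1) (calculusHom T i.2 φ)

/-- By covariance `U` intertwines `T` with `T ^ N`, hence also `f(T)` with `f(T ^ N)`. -/
theorem IsWaveletRepresentation.apply_calculusHom (h : IsWaveletRepresentation N m₀ 1 U T φ)
    (f : C(Circle, ℂ)) (x : H) : U (calculusHom T f x) = calculusHom T (powComp N f) (U x) := by
  rw [← calculusHom_pow]
  refine calculusHom_intertwine (unitaryCLM U) (T' := T ^ N) (fun y => ?_) f x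
  rw [← h.covariance]
  change U (T y) = U (T (U⁻¹ (U y)))
  congr 2
  exact (U.symm_apply_apply y).symm

/-- By the scaling identity `U f(T) φ` is again of the form `g(T) φ`, so a vector of level `n` can
be rewritten at any higher level. -/
theorem IsWaveletRepresentation.waveletVector_add (h : IsWaveletRepresentation N m₀ 1 U T φ)
    (n k : ℕ) (f : C(Circle, ℂ)) : waveletVector U T φ (n, f) =
      waveletVector U T φ (n + k, (dilateCoeff N m₀)^[k] f) := by
  induction k with
  | zero => rfl
  | succ k ih =>
    rw [ih, Function.iterate_succ_apply', ← add_assoc]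
    simp only [waveletVector]
    have e : calculusHom T (dilateCoeff N m₀ ((dilateCoeff N m₀)^[k] f)) φ =
        U (calculusHom T ((dilateCoeff N m₀)^[k] f) φ) := by
      rw [dilateCoeff, map_mul, h.apply_calculusHom, h.scaling]
      rfl
    rw [e, pow_succ]
    change _ = (U⁻¹ ^ (n + k)) (U.symm (U _))
    rw [U.symm_apply_apply]

/-- Both vectors are raised to the common level `i.1 + j.1`, where the unitary power of `U⁻¹`
cancels. What remains is a correlation, so the Gram matrix depends on `N` and `m₀` alone. -/
theorem IsWaveletRepresentation.inner_waveletVector (h : IsWaveletRepresentation N m₀ 1 U T φ)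
    (i j : ℕ × C(Circle, ℂ)) : inner ℂ (waveletVector U T φ i) (waveletVector U T φ j) =
      haarIntegral fun z => (star ((dilateCoeff N m₀)^[j.1] i.2) * (dilateCoeff N m₀)^[i.1] j.2) z *
        (1 : C(Circle, ℂ)) z := by
  rw [← h.correlation, ← calculusHom_apply, ← inner_calculusHom,
    show i = (i.1, i.2) from rfl, show j = (j.1, j.2) from rfl, h.waveletVector_add i.1 j.1,
    h.waveletVector_add j.1 i.1, add_comm j.1]
  exact LinearIsometryEquiv.inner_map_map _ _ _

theorem IsWaveletRepresentation.span_waveletVector (h : IsWaveletRepresentation N m₀ 1 U T φ) :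
    (Submodule.span ℂ (Set.range (waveletVector U T φ))).topologicalClosure = ⊤ := by
  rw [← h.cyclic]
  congr 2
  ext x
  constructor
  · rintro ⟨⟨n, f⟩, rfl⟩
    exact ⟨n, f, rfl⟩
  · rintro ⟨n, f, rfl⟩
    exact ⟨(n, f), rfl⟩

theorem IsWaveletRepresentation.translate_waveletVector (h : IsWaveletRepresentation N m₀ 1 U T φ)
    (n : ℕ) (f : C(Circle, ℂ)) : T (waveletVector U T φ (n, f)) =
      waveletVector U T φ (n, circleCoord ^ N ^ n * f) := by
  have hcomm : T * U⁻¹ = U⁻¹ * T ^ N := by rw [← h.covariance]; group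
  have hpow : ∀ k, T ^ k * U⁻¹ = U⁻¹ * T ^ (N * k) := by
    intro k
    induction k with
    | zero => simp
    | succ k ih => rw [pow_succ, mul_assoc, hcomm, ← mul_assoc, ih, mul_assoc, ← pow_add, mul_add_one]
  have hn : T * U⁻¹ ^ n = U⁻¹ ^ n * T ^ N ^ n := by
    induction n with
    | zero => simp
    | succ n ih => rw [pow_succ, ← mul_assoc, ih, mul_assoc, hpow, mul_assoc, pow_succ' N]
  have := congrArg (fun S : H ≃ₗᵢ[ℂ] H => S (calculusHom T f φ)) hn
  refine this.trans ?_
  change (U⁻¹ ^ n) ((T ^ N ^ n) (calculusHom T f φ)) = _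
  rw [calculusHom_circleCoord_pow_mul]
  rfl

theorem IsWaveletRepresentation.dilate_waveletVector (h : IsWaveletRepresentation N m₀ 1 U T φ)
    (n : ℕ) (f : C(Circle, ℂ)) : U (waveletVector U T φ (n, f)) =
      waveletVector U T φ (n, dilateCoeff N m₀ f) := by
  rw [h.waveletVector_add n 1 f]
  simp only [waveletVector, Function.iterate_one]
  rw [pow_succ']
  exact U.apply_symm_apply _

/-- The wavelet representation is unique up to unitary equivalence. -/
theorem IsWaveletRepresentation.exists_equiv (h : IsWaveletRepresentation N m₀ 1 U T φ)
    (h' : IsWaveletRepresentation N m₀ 1 U' T' φ') :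
    ∃ J : H ≃ₗᵢ[ℂ] H', (∀ x, J (U x) = U' (J x)) ∧ ∀ x, J (T x) = T' (J x) := by
  obtain ⟨J, hJ⟩ := exists_linearIsometryEquiv_of_inner_eq h.span_waveletVector
    h'.span_waveletVector fun i j => by rw [h.inner_waveletVector, h'.inner_waveletVector]
  have hdense : Dense (Submodule.span ℂ (Set.range (waveletVector U T φ)) : Set H) :=
    Submodule.dense_iff_topologicalClosure_eq_top.2 h.span_waveletVector
  have hext : ∀ (S : H ≃ₗᵢ[ℂ] H) (S' : H' ≃ₗᵢ[ℂ] H'),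
      (∀ i, J (S (waveletVector U T φ i)) = S' (J (waveletVector U T φ i))) →
      ∀ x, J (S x) = S' (J x) := by
    intro S S' hS x
    have := ContinuousLinearMap.ext_on (f := ((J : H ≃L[ℂ] H') : H →L[ℂ] H').comp (unitaryCLM S))
      (g := (unitaryCLM S').comp ((J : H ≃L[ℂ] H') : H →L[ℂ] H')) hdense (by
        rintro _ ⟨i, rfl⟩
        exact hS i)
    exact congrArg (fun A : H →L[ℂ] H' => A x) this
  refine ⟨J, hext U U' ?_, hext T T' ?_⟩
  · rintro ⟨n, f⟩
    rw [h.dilate_waveletVector, hJ, hJ, h'.dilate_waveletVector]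
  · rintro ⟨n, f⟩
    rw [h.translate_waveletVector, hJ, hJ, h'.translate_waveletVector]

end uniqueness

/-! ### Weighted composition operators on `L²(ℝ)` -/

theorem norm_sq_L2R (ψ : L2R) : ‖ψ‖ ^ 2 = ∫ x, ‖ψ x‖ ^ 2 := by
  have h := L2.inner_def (𝕜 := ℂ) ψ ψ
  rw [inner_self_eq_norm_sq_to_K] at h
  simp only [inner_self_eq_norm_sq_to_K] at h
  have e : ∀ x, ((‖ψ x‖ : ℂ)) ^ 2 = ((‖ψ x‖ ^ 2 : ℝ) : ℂ) := fun x => by push_cast; rfl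
  simp only [Complex.coe_algebraMap, e, integral_complex_ofReal] at h
  exact_mod_cast h

theorem ae_comp_mul_left {a : ℝ} (ha : a ≠ 0) {p : ℝ → Prop} (h : ∀ᵐ x, p x) : ∀ᵐ x : ℝ, p (a * x) := by
  have hq : Measure.QuasiMeasurePreserving (fun x : ℝ => a * x) volume volume := by
    refine ⟨measurable_const_mul a, ?_⟩
    rw [Real.map_volume_mul_left ha]
    exact Measure.smul_absolutelyContinuous
  exact hq.ae h

theorem memLp_weightedComp {a : ℝ} (ha : 0 < a) (u : C(ℝ, Circle)) (ψ : L2R) :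
    MemLp (fun x : ℝ => (u x : ℂ) * (Real.sqrt a : ℂ) * ψ (a * x)) 2 volume := by
  have hm : MemLp (ψ : ℝ → ℂ) 2 (Measure.map (fun x : ℝ => a * x) volume) := by
    rw [Real.map_volume_mul_left ha.ne']
    exact (Lp.memLp ψ).smul_measure ENNReal.ofReal_ne_top
  have h2 : MemLp (fun x : ℝ => ψ (a * x)) 2 volume :=
    hm.comp_of_map (measurable_const_mul a).aemeasurable
  refine h2.of_le_mul (c := Real.sqrt a) (AEStronglyMeasurable.mul ?_ h2.1) (ae_of_all _ fun x => ?_)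
  · exact Continuous.aestronglyMeasurable (by fun_prop)
  · rw [norm_mul, norm_mul, Circle.norm_coe, one_mul, Complex.norm_of_nonneg (Real.sqrt_nonneg a)]

/-- The function `x ↦ u(x) √a ψ(ax)` as an element of `L²(ℝ)`. -/
noncomputable def weightedCompFun {a : ℝ} (ha : 0 < a) (u : C(ℝ, Circle)) (ψ : L2R) : L2R :=
  (memLp_weightedComp ha u ψ).toLp _

theorem coeFn_weightedCompFun {a : ℝ} (ha : 0 < a) (u : C(ℝ, Circle)) (ψ : L2R) :
    weightedCompFun ha u ψ =ᵐ[volume] fun x => (u x : ℂ) * (Real.sqrt a : ℂ) * ψ (a * x) :=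
  MemLp.coeFn_toLp _

theorem norm_weightedCompFun {a : ℝ} (ha : 0 < a) (u : C(ℝ, Circle)) (ψ : L2R) :
    ‖weightedCompFun ha u ψ‖ = ‖ψ‖ := by
  rw [← sq_eq_sq₀ (norm_nonneg _) (norm_nonneg _), norm_sq_L2R, norm_sq_L2R]
  have h : ∫ x, ‖weightedCompFun ha u ψ x‖ ^ 2 = ∫ x : ℝ, a * ‖ψ (a * x)‖ ^ 2 := by
    refine integral_congr_ae ?_
    filter_upwards [coeFn_weightedCompFun ha u ψ] with x hx
    rw [hx, norm_mul, norm_mul, Circle.norm_coe, one_mul, Complex.norm_of_nonneg (Real.sqrt_nonneg a),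
      mul_pow, Real.sq_sqrt ha.le]
  rw [h, integral_const_mul, Measure.integral_comp_mul_left (fun x => ‖ψ x‖ ^ 2), smul_eq_mul,
    abs_of_pos (inv_pos.2 ha), ← mul_assoc, mul_inv_cancel₀ ha.ne', one_mul]

/-- The weight of the inverse of a weighted composition operator. -/
noncomputable def inverseWeight (a : ℝ) (u : C(ℝ, Circle)) : C(ℝ, Circle) :=
  ⟨fun x => (u (a⁻¹ * x))⁻¹, by fun_prop⟩

theorem weightedCompFun_comp {a b : ℝ} (ha : 0 < a) (hb : 0 < b) (hab : a * b = 1)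
    (u v : C(ℝ, Circle)) (huv : ∀ x, u x * v (a * x) = 1) (ψ : L2R) :
    weightedCompFun ha u (weightedCompFun hb v ψ) = ψ := by
  refine Lp.ext ?_
  filter_upwards [coeFn_weightedCompFun ha u (weightedCompFun hb v ψ),
    ae_comp_mul_left ha.ne' (coeFn_weightedCompFun hb v ψ)] with x hx hx'
  have h1 : (u x : ℂ) * (v (a * x) : ℂ) = 1 := by
    rw [← Circle.coe_mul, huv, Circle.coe_one]
  have h2 : (Real.sqrt a : ℂ) * (Real.sqrt b : ℂ) = 1 := by
    rw [← Complex.ofReal_mul, ← Real.sqrt_mul ha.le, hab, Real.sqrt_one, Complex.ofReal_one]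
  have h3 : b * (a * x) = x := by rw [← mul_assoc, mul_comm b, hab, one_mul]
  rw [hx, hx', h3]
  linear_combination (u x * v (a * x) * ψ x) * h2 + ψ x * h1

/-- The unitary operator `ψ ↦ u(x) √a ψ(ax)` on `L²(ℝ)`. -/
noncomputable def weightedComp {a : ℝ} (ha : 0 < a) (u : C(ℝ, Circle)) : L2R ≃ₗᵢ[ℂ] L2R where
  toFun := weightedCompFun ha u
  invFun := weightedCompFun (inv_pos.2 ha) (inverseWeight a u)
  map_add' ψ χ := by
    refine Lp.ext ?_
    filter_upwards [coeFn_weightedCompFun ha u (ψ + χ), coeFn_weightedCompFun ha u ψ,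
      coeFn_weightedCompFun ha u χ, ae_comp_mul_left ha.ne' (Lp.coeFn_add ψ χ),
      Lp.coeFn_add (weightedCompFun ha u ψ) (weightedCompFun ha u χ)] with x h1 h2 h3 h4 h5
    rw [h1, h5, Pi.add_apply, h2, h3, h4, Pi.add_apply, mul_add]
  map_smul' c ψ := by
    refine Lp.ext ?_
    filter_upwards [coeFn_weightedCompFun ha u (c • ψ), coeFn_weightedCompFun ha u ψ,
      ae_comp_mul_left ha.ne' (Lp.coeFn_smul c ψ),
      Lp.coeFn_smul c (weightedCompFun ha u ψ)] with x h1 h2 h3 h4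
    rw [h1, RingHom.id_apply, h4, Pi.smul_apply, h2, h3, Pi.smul_apply, smul_eq_mul, smul_eq_mul]
    ring
  left_inv ψ := weightedCompFun_comp _ _ (inv_mul_cancel₀ ha.ne') _ _
    (fun x => by simp [inverseWeight]) ψ
  right_inv ψ := weightedCompFun_comp _ _ (mul_inv_cancel₀ ha.ne') _ _
    (fun x => by simp [inverseWeight, ha.ne']) ψ
  norm_map' ψ := norm_weightedCompFun ha u ψ

theorem coeFn_weightedComp {a : ℝ} (ha : 0 < a) (u : C(ℝ, Circle)) (ψ : L2R) :
    weightedComp ha u ψ =ᵐ[volume] fun x => (u x : ℂ) * (Real.sqrt a : ℂ) * ψ (a * x) :=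
  coeFn_weightedCompFun ha u ψ

/-- Multiplication by a unimodular function. -/
noncomputable abbrev mulUnitary (u : C(ℝ, Circle)) : L2R ≃ₗᵢ[ℂ] L2R := weightedComp one_pos u

theorem coeFn_mulUnitary (u : C(ℝ, Circle)) (ψ : L2R) :
    mulUnitary u ψ =ᵐ[volume] fun x => (u x : ℂ) * ψ x := by
  filter_upwards [coeFn_weightedComp one_pos u ψ] with x hx
  simpa using hx

theorem coeFn_mulUnitary_symm (u : C(ℝ, Circle)) (ψ : L2R) :
    (mulUnitary u).symm ψ =ᵐ[volume] fun x => star (u x : ℂ) * ψ x := by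
  filter_upwards [coeFn_mulUnitary u ((mulUnitary u).symm ψ)] with x hx
  rw [LinearIsometryEquiv.apply_symm_apply] at hx
  rw [hx, ← mul_assoc, Complex.star_def, ← Complex.normSq_eq_conj_mul_self, Circle.normSq_coe]
  simp

/-- The functional calculus of a multiplication operator. -/
theorem coeFn_calculusHom_mulUnitary (u : C(ℝ, Circle)) (f : C(Circle, ℂ)) (ψ : L2R) :
    calculusHom (mulUnitary u) f ψ =ᵐ[volume] fun x => f (u x) * ψ x := by
  suffices h : (∀ ψ, calculusHom (mulUnitary u) f ψ =ᵐ[volume] fun x => f (u x) * ψ x) ∧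
      ∀ ψ, calculusHom (mulUnitary u) (star f) ψ =ᵐ[volume] fun x => star f (u x) * ψ x from h.1 ψ
  refine circle_induction (P := fun f =>
    (∀ ψ, calculusHom (mulUnitary u) f ψ =ᵐ[volume] fun x => f (u x) * ψ x) ∧
      ∀ ψ, calculusHom (mulUnitary u) (star f) ψ =ᵐ[volume] fun x => star f (u x) * ψ x)
    ?_ ?_ ?_ ?_ ?_ ?_ f
  · have hc : IsClosed {f : C(Circle, ℂ) |
        ∀ ψ, calculusHom (mulUnitary u) f ψ =ᵐ[volume] fun x => f (u x) * ψ x} := by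
      refine isClosed_of_closure_subset fun f hf ψ => ?_
      -- Convergence in `L²` gives convergence almost everywhere along a subsequence, which
      -- identifies the limit pointwise.
      obtain ⟨g, hg, hlim⟩ := mem_closure_iff_seq_limit.1 hf
      have h1 : Tendsto (fun n => calculusHom (mulUnitary u) (g n) ψ) atTop
          (𝓝 (calculusHom (mulUnitary u) f ψ)) :=
        (((continuous_calculusHom (mulUnitary u)).clm_apply continuous_const).tendsto f).comp hlim
      obtain ⟨ns, hns, hae⟩ := (tendstoInMeasure_of_tendsto_Lp h1).exists_seq_tendsto_ae
      filter_upwards [hae, ae_all_iff.2 fun n => hg n ψ] with x hx hx'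
      refine tendsto_nhds_unique hx ?_
      simp only [hx']
      exact (((continuous_eval_const (u x)).tendsto f).comp
        (hlim.comp hns.tendsto_atTop)).mul_const _
    exact hc.inter (hc.preimage continuous_star)
  · have hadd : ∀ f g : C(Circle, ℂ),
        (∀ ψ, calculusHom (mulUnitary u) f ψ =ᵐ[volume] fun x => f (u x) * ψ x) →
        (∀ ψ, calculusHom (mulUnitary u) g ψ =ᵐ[volume] fun x => g (u x) * ψ x) →
        ∀ ψ, calculusHom (mulUnitary u) (f + g) ψ =ᵐ[volume] fun x => (f + g) (u x) * ψ x := by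
      intro f g hf hg ψ
      rw [map_add, add_apply]
      filter_upwards [hf ψ, hg ψ, Lp.coeFn_add (calculusHom (mulUnitary u) f ψ)
        (calculusHom (mulUnitary u) g ψ)] with x h1 h2 h3
      rw [h3, Pi.add_apply, h1, h2, ContinuousMap.add_apply, add_mul]
    rintro f g ⟨hf, hf'⟩ ⟨hg, hg'⟩
    refine ⟨hadd f g hf hg, ?_⟩
    rw [star_add]
    exact hadd _ _ hf' hg'
  · have hmul : ∀ f g : C(Circle, ℂ),
        (∀ ψ, calculusHom (mulUnitary u) f ψ =ᵐ[volume] fun x => f (u x) * ψ x) →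
        (∀ ψ, calculusHom (mulUnitary u) g ψ =ᵐ[volume] fun x => g (u x) * ψ x) →
        ∀ ψ, calculusHom (mulUnitary u) (f * g) ψ =ᵐ[volume] fun x => (f * g) (u x) * ψ x := by
      intro f g hf hg ψ
      rw [map_mul, mul_apply_eq_comp]
      filter_upwards [hf (calculusHom (mulUnitary u) g ψ), hg ψ] with x h1 h2
      rw [h1, h2, ContinuousMap.mul_apply, mul_assoc]
    rintro f g ⟨hf, hf'⟩ ⟨hg, hg'⟩
    refine ⟨hmul f g hf hg, ?_⟩
    rw [star_mul]
    exact hmul _ _ hg' hf'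
  · rintro f ⟨hf, hf'⟩
    exact ⟨hf', by rwa [star_star]⟩
  · have hconst : ∀ (c : ℂ) (ψ : L2R), calculusHom (mulUnitary u) (algebraMap ℂ _ c) ψ =ᵐ[volume]
        fun x => (algebraMap ℂ C(Circle, ℂ) c) (u x) * ψ x := by
      intro c ψ
      rw [AlgHomClass.commutes, Algebra.algebraMap_eq_smul_one, Algebra.algebraMap_eq_smul_one]
      filter_upwards [Lp.coeFn_smul c ψ] with x hx
      change (c • ψ) x = _
      rw [hx]
      simp
    intro c
    refine ⟨hconst c, ?_⟩
    rw [← algebraMap_star_comm]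
    exact hconst _
  · refine ⟨fun ψ => ?_, fun ψ => ?_⟩
    · rw [calculusHom_circleCoord]
      exact coeFn_mulUnitary u ψ
    · rw [calculusHom_star_circleCoord]
      exact coeFn_mulUnitary_symm u ψ

/-! ### Integration over paths -/

theorem lintegral_eq_tsum_intervals (f : ℝ → ℝ≥0∞) :
    ∫⁻ x, f x = ∑' k : ℤ, ∫⁻ x in Set.Ioc (0 : ℝ) 1, f (x + k) := by
  rw [← setLIntegral_univ, ← iUnion_Ioc_intCast ℝ, lintegral_iUnion (fun _ => measurableSet_Ioc)
    (Set.pairwise_disjoint_Ioc_intCast ℝ)]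
  refine tsum_congr fun k => ?_
  have h := (measurePreserving_add_right (volume : Measure ℝ) (k : ℝ)).setLIntegral_comp_preimage_emb
    (measurableEmbedding_addRight (k : ℝ)) f (Set.Ioc (k : ℝ) (k + 1))
  rw [← h]
  congr 2
  ext x
  simp

theorem haarIntegral_eq_setIntegral_phase (f : Circle → ℂ) :
    haarIntegral f = ∫ t in Set.Ioc (0 : ℝ) 1, f (phase t) := by
  rw [← intervalIntegral.integral_of_le zero_le_one]
  have h1 : ∫ t in (0 : ℝ)..1, f (phase t) = ∫ t in (0 : ℝ)..1, f (Circle.exp (2 * Real.pi * t)) := by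
    -- The reflection `t ↦ 1 - t` removes the minus sign in the exponent of `phase`.
    have := intervalIntegral.integral_comp_sub_left (a := 0) (b := 1) (fun t => f (phase t)) (1 : ℝ)
    simp only [sub_self, sub_zero] at this
    rw [← this]
    refine intervalIntegral.integral_congr fun t _ => ?_
    congr 1
    rw [phase, Circle.exp_eq_exp]
    exact ⟨-1, by push_cast; ring⟩
  have hpi : (2 * Real.pi) ≠ 0 := by positivity
  rw [h1, intervalIntegral.integral_comp_mul_left (fun t => f (Circle.exp t)) hpi, haarIntegral,
    one_div, mul_zero, mul_one]

section path
variable {N : ℕ} {m₀ : C(Circle, ℂ)} (D : IsLipschitzFilter N m₀)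

theorem continuous_pathPoint (ζ : cyclePoints N m₀) : Continuous fun x : ℝ => pathPoint (ζ, x) := by
  unfold pathPoint
  fun_prop

theorem IsLipschitzFilter.continuous_pathWeight (ζ : cyclePoints N m₀) :
    Continuous fun x : ℝ => D.pathWeight (ζ, x) :=
  ENNReal.continuous_ofReal.comp ((D.continuous_phiHat ζ).norm.pow 2)

/-- The paths, weighted by `|φ̂|²`, are distributed according to Haar measure. -/
theorem IsLipschitzFilter.sum_lintegral_pathWeight [Fintype (cyclePoints N m₀)]
    (hcyc : ∃ C : Finset Circle, IsFilterCycle N m₀ C) {F : Circle → ℝ≥0∞} (hF : Measurable F) :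
    ∑ ζ : cyclePoints N m₀, ∫⁻ x, D.pathWeight (ζ, x) * F (pathPoint (ζ, x)) =
      ∫⁻ t in Set.Ioc (0 : ℝ) 1, F (phase t) := by
  obtain ⟨α, hα⟩ := exists_angle N m₀
  have hshift : ∀ (ζ : cyclePoints N m₀) (t : ℝ) (k : ℤ), pathPoint (ζ, t + k + α ζ) = phase t := by
    intro ζ t k
    rw [pathPoint, add_comm, phase_add, ← mul_assoc, hα, one_mul, phase_eq_phase_iff]
    exact ⟨k, rfl⟩
  have hmeas : ∀ (ζ : cyclePoints N m₀) (k : ℤ), Measurable fun t : ℝ => D.pathWeight (ζ, t + α ζ + k) :=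
    fun ζ k => ((D.continuous_pathWeight ζ).comp (by fun_prop)).measurable
  have hmeas' : ∀ (ζ : cyclePoints N m₀) (k : ℤ),
      Measurable fun t : ℝ => D.pathWeight (ζ, t + α ζ + k) * F (phase t) :=
    fun ζ k => (hmeas ζ k).mul (hF.comp continuous_phase.measurable)
  have hmeas'' : ∀ ζ : cyclePoints N m₀,
      Measurable fun t : ℝ => (∑' k : ℤ, D.pathWeight (ζ, t + α ζ + k)) * F (phase t) :=
    fun ζ => (Measurable.tsum (hmeas ζ)).mul (hF.comp continuous_phase.measurable)
  have h1 : ∀ ζ : cyclePoints N m₀, ∫⁻ x, D.pathWeight (ζ, x) * F (pathPoint (ζ, x)) =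
      ∫⁻ t in Set.Ioc (0 : ℝ) 1, (∑' k : ℤ, D.pathWeight (ζ, t + α ζ + k)) * F (phase t) := by
    intro ζ
    -- After a shift by `α ζ` the end point of the path over `t + k` is `phase t`. Cutting the line
    -- into unit intervals then produces the fibre sums, which are one.
    rw [← lintegral_add_right_eq_self _ (α ζ), lintegral_eq_tsum_intervals]
    simp only [← ENNReal.tsum_mul_right]
    rw [lintegral_tsum fun k => (hmeas' ζ k).aemeasurable]
    refine tsum_congr fun k => lintegral_congr fun t => ?_
    rw [hshift, add_right_comm]
  simp only [h1]
  rw [← lintegral_finsetSum _ fun ζ _ => hmeas'' ζ]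
  refine lintegral_congr fun t => ?_
  have h2 := fiberSum_exp (Φ := D.pathWeight) hα t
  rw [D.fiberSum_pathWeight hcyc, tsum_fintype] at h2
  rw [← Finset.sum_mul, ← h2, one_mul]

/-- With `F = 1`, the squared norms of all the components add up to one. -/
theorem IsLipschitzFilter.memLp_phiHat (hcyc : ∃ C : Finset Circle, IsFilterCycle N m₀ C)
    (ζ : cyclePoints N m₀) : MemLp (fun x : ℝ => D.phiHat (ζ, x)) 2 volume := by
  have := D.finite_subtype
  have : Fintype (cyclePoints N m₀) := Fintype.ofFinite _
  refine ⟨(D.continuous_phiHat ζ).aestronglyMeasurable, ?_⟩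
  rw [eLpNorm_lt_top_iff_lintegral_rpow_enorm_lt_top two_ne_zero ENNReal.ofNat_ne_top]
  have h := D.sum_lintegral_pathWeight hcyc (F := fun _ => 1) measurable_const
  simp only [mul_one, lintegral_const, Measure.restrict_apply MeasurableSet.univ, Set.univ_inter,
    Real.volume_Ioc, sub_zero, ENNReal.ofReal_one] at h
  have e : ∀ x : ℝ, ‖D.phiHat (ζ, x)‖ₑ ^ (2 : ℝ≥0∞).toReal = D.pathWeight (ζ, x) := by
    intro x
    rw [IsLipschitzFilter.pathWeight, ENNReal.ofReal_pow (norm_nonneg _), ofReal_norm]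
    simp
  simp only [e]
  refine lt_of_le_of_lt ?_ ENNReal.one_lt_top
  rw [← h]
  exact Finset.single_le_sum (f := fun ζ => ∫⁻ x, D.pathWeight (ζ, x)) (fun _ _ => zero_le)
    (Finset.mem_univ ζ)

/-- The images on the circle of the measures `|φ̂_ζ|² dx` are finite and sum to Haar measure, which
allows integration of complex functions. -/
theorem IsLipschitzFilter.sum_integral_phiHat [Fintype (cyclePoints N m₀)]
    (hcyc : ∃ C : Finset Circle, IsFilterCycle N m₀ C) (f : C(Circle, ℂ)) :
    ∑ ζ : cyclePoints N m₀, ∫ x : ℝ, ((‖D.phiHat (ζ, x)‖ ^ 2 : ℝ) : ℂ) * f (pathPoint (ζ, x)) =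
      haarIntegral f := by
  set κ : cyclePoints N m₀ → Measure Circle := fun ζ =>
    (volume.withDensity fun x => D.pathWeight (ζ, x)).map fun x => pathPoint (ζ, x)
  have hmp : ∀ ζ : cyclePoints N m₀, Measurable fun x : ℝ => pathPoint (ζ, x) := fun ζ =>
    (continuous_pathPoint ζ).measurable
  have hmw : ∀ ζ : cyclePoints N m₀, Measurable fun x : ℝ => D.pathWeight (ζ, x) := fun ζ =>
    (D.continuous_pathWeight ζ).measurable
  have hm : ∑ ζ, κ ζ = (volume.restrict (Set.Ioc (0 : ℝ) 1)).map phase := by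
    refine Measure.ext_of_lintegral _ fun F hF => ?_
    rw [lintegral_finsetSum_measure, lintegral_map hF continuous_phase.measurable,
      ← D.sum_lintegral_pathWeight hcyc hF]
    refine Finset.sum_congr rfl fun ζ _ => ?_
    rw [lintegral_map hF (hmp ζ)]
    exact lintegral_withDensity_eq_lintegral_mul volume (hmw ζ) (hF.comp (hmp ζ))
  have hfin : ∀ ζ, IsFiniteMeasure (κ ζ) := by
    intro ζ
    have : IsFiniteMeasure (∑ ζ, κ ζ) := by rw [hm]; infer_instance
    exact isFiniteMeasure_of_le (∑ ζ, κ ζ)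
      (Finset.single_le_sum (f := κ) (fun _ _ => bot_le) (Finset.mem_univ ζ))
  rw [haarIntegral_eq_setIntegral_phase,
    ← integral_map continuous_phase.measurable.aemeasurable f.continuous.aestronglyMeasurable, ← hm,
    integral_finsetSum_measure fun ζ _ => f.integrable_of_compactSpace (κ ζ)]
  refine Finset.sum_congr rfl fun ζ _ => ?_
  rw [integral_map (hmp ζ).aemeasurable f.continuous.aestronglyMeasurable,
    integral_withDensity_eq_integral_toReal_smul (hmw ζ) (ae_of_all _ fun x => ENNReal.ofReal_lt_top)]
  refine integral_congr_ae (ae_of_all _ fun x => ?_)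
  simp only [IsLipschitzFilter.pathWeight]
  rw [ENNReal.toReal_ofReal (by positivity), Complex.real_smul]

end path

/-! ### The model of the wavelet representation -/

section model
variable {N : ℕ} {m₀ : C(Circle, ℂ)} (D : IsLipschitzFilter N m₀)

/-- The Hilbert space `⨁_{ζ} L²(ℝ)` over all the cycle points. -/
abbrev ModelSpace (N : ℕ) (m₀ : C(Circle, ℂ)) : Type := PiLp 2 (fun _ : cyclePoints N m₀ => L2R)

/-- The function `x ↦ ζ e^{-2πix}`. -/
noncomputable def pathMap (ζ : cyclePoints N m₀) : C(ℝ, Circle) :=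
  ⟨fun x => pathPoint (ζ, x), continuous_pathPoint ζ⟩

theorem IsLipschitzFilter.natCast_pos (D : IsLipschitzFilter N m₀) : (0 : ℝ) < N :=
  Nat.cast_pos.2 (by have := D.two_le; omega)

/-- The unimodular number `m₀(ζ) / √N`. -/
noncomputable def IsLipschitzFilter.cyclePhase (D : IsLipschitzFilter N m₀) (ζ : cyclePoints N m₀) :
    Circle :=
  ⟨m₀ ζ / (Real.sqrt N : ℂ), by
    change _ ∈ Metric.sphere (0 : ℂ) 1
    rw [mem_sphere_zero_iff_norm]
    have hN := D.natCast_pos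
    rw [norm_div, Complex.norm_of_nonneg (Real.sqrt_nonneg _), div_eq_one_iff_eq
      (Real.sqrt_pos.2 hN).ne', ← sq_eq_sq₀ (norm_nonneg _) (Real.sqrt_nonneg _), Real.sq_sqrt hN.le,
      norm_sq_of_mem_cyclePoints ζ.2]⟩

theorem IsLipschitzFilter.coe_cyclePhase (ζ : cyclePoints N m₀) :
    (D.cyclePhase ζ : ℂ) = m₀ ζ / (Real.sqrt N : ℂ) := rfl

/-- The cyclic vector of the model. -/
noncomputable def IsLipschitzFilter.modelPhi (hcyc : ∃ C : Finset Circle, IsFilterCycle N m₀ C) :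
    ModelSpace N m₀ :=
  WithLp.toLp 2 fun ζ => (D.memLp_phiHat hcyc ζ).toLp _

theorem IsLipschitzFilter.coeFn_modelPhi (hcyc : ∃ C : Finset Circle, IsFilterCycle N m₀ C)
    (ζ : cyclePoints N m₀) : D.modelPhi hcyc ζ =ᵐ[volume] fun x => D.phiHat (ζ, x) :=
  MemLp.coeFn_toLp (D.memLp_phiHat hcyc ζ)

variable [Fintype (cyclePoints N m₀)]

/-- Translation in the model: multiplication by `ζ e^{-2πix}` over `ζ`. -/
noncomputable def modelT : ModelSpace N m₀ ≃ₗᵢ[ℂ] ModelSpace N m₀ :=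
  LinearIsometryEquiv.piLpCongrRight 2 fun ζ => mulUnitary (pathMap ζ)

/-- Dilation in the model: `(Uξ)_ζ(x) = m₀(ζ) ξ_{ζ^N}(Nx)`. -/
noncomputable def IsLipschitzFilter.modelU : ModelSpace N m₀ ≃ₗᵢ[ℂ] ModelSpace N m₀ :=
  (LinearIsometryEquiv.piLpCongrLeft 2 ℂ L2R D.shift.symm).trans
    (LinearIsometryEquiv.piLpCongrRight 2 fun ζ =>
      weightedComp D.natCast_pos (ContinuousMap.const ℝ (D.cyclePhase ζ)))

theorem modelT_apply (ξ : ModelSpace N m₀) (ζ : cyclePoints N m₀) :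
    modelT ξ ζ = mulUnitary (pathMap ζ) (ξ ζ) := rfl

theorem IsLipschitzFilter.modelU_apply (ξ : ModelSpace N m₀) (ζ : cyclePoints N m₀) :
    D.modelU ξ ζ = weightedComp D.natCast_pos (ContinuousMap.const ℝ (D.cyclePhase ζ))
      (ξ (D.shift ζ)) := rfl

theorem IsLipschitzFilter.coeFn_modelU (ξ : ModelSpace N m₀) (ζ : cyclePoints N m₀) :
    D.modelU ξ ζ =ᵐ[volume] fun x => m₀ ζ * ξ (D.shift ζ) (N * x) := by
  rw [D.modelU_apply]
  have hN : (Real.sqrt N : ℂ) ≠ 0 := by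
    exact_mod_cast (Real.sqrt_pos.2 D.natCast_pos).ne'
  filter_upwards [coeFn_weightedComp D.natCast_pos (ContinuousMap.const ℝ (D.cyclePhase ζ))
    (ξ (D.shift ζ))] with x hx
  rw [hx, ContinuousMap.const_apply, D.coe_cyclePhase, div_mul_cancel₀ _ hN]

theorem calculusHom_modelT_apply (f : C(Circle, ℂ)) (ξ : ModelSpace N m₀) (ζ : cyclePoints N m₀) :
    calculusHom modelT f ξ ζ = calculusHom (mulUnitary (pathMap ζ)) f (ξ ζ) :=
  calculusHom_intertwine (PiLp.proj 2 (fun _ : cyclePoints N m₀ => L2R) ζ)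
    (T := modelT) (T' := mulUnitary (pathMap ζ)) (fun _ => rfl) f ξ

theorem coeFn_calculusHom_modelT (f : C(Circle, ℂ)) (ξ : ModelSpace N m₀) (ζ : cyclePoints N m₀) :
    calculusHom modelT f ξ ζ =ᵐ[volume] fun x => f (pathPoint (ζ, x)) * ξ ζ x := by
  rw [calculusHom_modelT_apply]
  exact coeFn_calculusHom_mulUnitary (pathMap ζ) f (ξ ζ)

theorem coeFn_modelT_pow (n : ℕ) (ξ : ModelSpace N m₀) (ζ : cyclePoints N m₀) :
    (modelT ^ n) ξ ζ =ᵐ[volume] fun x => (pathPoint (ζ, x) : ℂ) ^ n * ξ ζ x := by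
  have h := calculusHom_circleCoord_pow_mul (modelT (N := N) (m₀ := m₀)) n 1 ξ
  have h1 : calculusHom (modelT (N := N) (m₀ := m₀)) 1 ξ = ξ := by rw [map_one]; rfl
  rw [h1, mul_one] at h
  rw [h]
  filter_upwards [coeFn_calculusHom_modelT (circleCoord ^ n) ξ ζ] with x hx
  rw [hx]
  rfl

theorem IsLipschitzFilter.model_covariance : D.modelU * modelT * D.modelU⁻¹ = modelT ^ N := by
  rw [mul_inv_eq_iff_eq_mul]
  refine LinearIsometryEquiv.ext fun ξ => PiLp.ext fun ζ => Lp.ext ?_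
  change D.modelU (modelT ξ) ζ =ᵐ[volume] (modelT ^ N) (D.modelU ξ) ζ
  filter_upwards [D.coeFn_modelU (modelT ξ) ζ, coeFn_modelT_pow N (D.modelU ξ) ζ,
    D.coeFn_modelU ξ ζ, ae_comp_mul_left D.natCast_pos.ne'
      (coeFn_mulUnitary (pathMap (D.shift ζ)) (ξ (D.shift ζ)))] with x h1 h2 h3 h4
  rw [h1, h2, h3, modelT_apply, h4]
  have : pathMap (D.shift ζ) (N * x) = pathPoint (ζ, x) ^ N := D.pathPoint_fwd (ζ, x)
  rw [this, Circle.coe_pow]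
  ring

/-- This is the refinement equation `phiHat_fwd` in operator form. -/
theorem IsLipschitzFilter.model_scaling (hcyc : ∃ C : Finset Circle, IsFilterCycle N m₀ C) :
    D.modelU (D.modelPhi hcyc) = calculusHom modelT m₀ (D.modelPhi hcyc) := by
  refine PiLp.ext fun ζ => Lp.ext ?_
  filter_upwards [D.coeFn_modelU (D.modelPhi hcyc) ζ,
    coeFn_calculusHom_modelT m₀ (D.modelPhi hcyc) ζ, D.coeFn_modelPhi hcyc ζ,
    ae_comp_mul_left D.natCast_pos.ne' (D.coeFn_modelPhi hcyc (D.shift ζ))] with x h1 h2 h3 h4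
  have h5 : D.phiHat (D.shift ζ, N * x) = filterRatio (ζ, x) * D.phiHat (ζ, x) :=
    D.phiHat_fwd (ζ, x)
  rw [h1, h2, h3, h4, h5, filterRatio, ← mul_assoc, mul_div_cancel₀ _ (D.ne_zero_of_cyclePoint ζ)]

theorem IsLipschitzFilter.model_correlation (hcyc : ∃ C : Finset Circle, IsFilterCycle N m₀ C)
    (f : C(Circle, ℂ)) :
    inner ℂ (D.modelPhi hcyc) (calculusHom modelT f (D.modelPhi hcyc)) = haarIntegral f := by
  rw [PiLp.inner_apply, ← D.sum_integral_phiHat hcyc]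
  refine Finset.sum_congr rfl fun ζ _ => ?_
  rw [L2.inner_def]
  refine integral_congr_ae ?_
  filter_upwards [coeFn_calculusHom_modelT f (D.modelPhi hcyc) ζ, D.coeFn_modelPhi hcyc ζ]
    with x h1 h2
  rw [h1, h2, RCLike.inner_apply, mul_assoc, ← Complex.star_def, Complex.star_def, Complex.mul_conj,
    Complex.normSq_eq_norm_sq, mul_comm]

end model

/-! ### Cyclicity of the model -/

/-- As `θ` vanishes at `±1/2`, its restriction to one period closes up to a continuous function on
the circle, in the coordinate centred at `ζ`. -/
theorem exists_circle_extension (ζ : Circle) {θ : ℝ → ℂ} (hθ : Continuous θ)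
    (h0 : ∀ x, 1 / 2 ≤ |x| → θ x = 0) :
    ∃ f : C(Circle, ℂ), ∀ x, |x| < 1 / 2 → f (ζ * phase x) = θ x := by
  have hpi := Real.pi_pos
  have : Fact ((0 : ℝ) < 2 * Real.pi) := ⟨by positivity⟩
  set g : ℝ → ℂ := fun t => θ (-t / (2 * Real.pi))
  have hg : Continuous g := by fun_prop
  have hends : g (-Real.pi) = g (-Real.pi + 2 * Real.pi) := by
    have e1 : -(-Real.pi) / (2 * Real.pi) = 1 / 2 := by field_simp
    have e2 : -(-Real.pi + 2 * Real.pi) / (2 * Real.pi) = -(1 / 2) := by field_simp; ring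
    simp only [g, e1, e2]
    rw [h0 _ (by norm_num), h0 _ (by norm_num)]
  refine ⟨⟨fun w => AddCircle.liftIco (2 * Real.pi) (-Real.pi) g
    (AddCircle.homeomorphCircle'.symm (ζ⁻¹ * w)), ?_⟩, fun x hx => ?_⟩
  · exact (AddCircle.liftIco_continuous hends hg.continuousOn).comp (by fun_prop)
  · have e : AddCircle.homeomorphCircle'.symm (ζ⁻¹ * (ζ * phase x)) =
        ((-(2 * Real.pi * x) : ℝ) : AddCircle (2 * Real.pi)) := by
      rw [inv_mul_cancel_left, Homeomorph.symm_apply_eq, AddCircle.homeomorphCircle'_apply_mk, phase]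
    rw [abs_lt] at hx
    simp only [ContinuousMap.coe_mk]
    rw [e, AddCircle.liftIco_coe_apply ⟨by nlinarith, by nlinarith⟩]
    simp only [g]
    congr 1
    field_simp

theorem haarIntegral_eq_intervalIntegral_mul_phase (ζ : Circle) (f : Circle → ℂ) :
    haarIntegral f = ∫ x in (-(1 / 2) : ℝ)..(1 / 2), f (ζ * phase x) := by
  obtain ⟨β, rfl⟩ := phase_surjective ζ
  have hper : Function.Periodic (fun t => f (phase t)) 1 := fun t =>
    congrArg f (phase_eq_phase_iff.2 ⟨1, by simp⟩)
  have h1 := hper.intervalIntegral_add_eq 0 (-(1 / 2) + β)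
  rw [zero_add, intervalIntegral.integral_of_le zero_le_one, ← haarIntegral_eq_setIntegral_phase] at h1
  rw [h1]
  have h2 := intervalIntegral.integral_comp_add_left (a := -(1 / 2)) (b := 1 / 2)
    (fun t => f (phase t)) β
  simp only [← phase_add]
  rw [h2]
  congr 1 <;> ring

section cyclicity
variable {N : ℕ} {m₀ : C(Circle, ℂ)} (D : IsLipschitzFilter N m₀)
  (hcyc : ∃ C : Finset Circle, IsFilterCycle N m₀ C)

theorem IsLipschitzFilter.exists_phiHat_near_one {ε : ℝ} (hε : 0 < ε) : ∃ δ > 0, δ < 1 / 2 ∧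
    ∀ (ζ : cyclePoints N m₀) (x : ℝ), |x| < δ → ‖D.phiHat (ζ, x) - 1‖ ≤ ε := by
  have := D.finite_subtype
  have h : ∀ ζ : cyclePoints N m₀, ∀ᶠ x in 𝓝 (0 : ℝ), ‖D.phiHat (ζ, x) - 1‖ ≤ ε := by
    intro ζ
    have h1 : Tendsto (fun x : ℝ => ‖D.phiHat (ζ, x) - 1‖) (𝓝 0) (𝓝 0) := by
      have := ((D.continuous_phiHat ζ).sub (continuous_const (y := (1 : ℂ)))).norm.tendsto 0
      simpa [D.phiHat_zero] using this
    exact (h1.eventually (gt_mem_nhds hε)).mono fun _ h => h.le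
  obtain ⟨δ, hδ, hδ'⟩ := Metric.eventually_nhds_iff.1 (eventually_all.2 h)
  refine ⟨min δ (1 / 4), by positivity, (min_le_right _ _).trans_lt (by norm_num), fun ζ x hx => ?_⟩
  exact hδ' (by rw [Real.dist_eq, sub_zero]; exact hx.trans_le (min_le_left _ _)) ζ

variable [Fintype (cyclePoints N m₀)]

/-- Functions that live near `0` over a single cycle point are approximated by translates. -/
theorem IsLipschitzFilter.exists_calculusHom_near [DecidableEq (cyclePoints N m₀)] {ε δ : ℝ}
    (hδ' : δ < 1 / 2)
    (hphi : ∀ (ζ : cyclePoints N m₀) (x : ℝ), |x| < δ → ‖D.phiHat (ζ, x) - 1‖ ≤ ε)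
    (ζ : cyclePoints N m₀) {θ : ℝ → ℂ} (hθ : Continuous θ) (h0 : ∀ x, δ ≤ |x| → θ x = 0) {ψ : L2R}
    (hψ : ψ =ᵐ[volume] θ) :
    ∃ f : C(Circle, ℂ), ‖calculusHom modelT f (D.modelPhi hcyc) - PiLp.single 2 ζ ψ‖ ^ 2 ≤
      2 * ε * ‖ψ‖ ^ 2 := by
  obtain ⟨f, hf⟩ := exists_circle_extension ζ hθ fun x hx => h0 x (hδ'.le.trans hx)
  refine ⟨f, ?_⟩
  have hmem : MemLp θ 2 volume := (memLp_congr_ae hψ).1 (Lp.memLp ψ)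
  have hint : Integrable (fun x => ‖θ x‖ ^ 2) := (memLp_two_iff_integrable_sq_norm hmem.1).1 hmem
  have hψn : ‖ψ‖ ^ 2 = ∫ x, ‖θ x‖ ^ 2 := by
    rw [norm_sq_L2R]
    exact integral_congr_ae (hψ.mono fun x hx => by simp only [hx])
  -- The correlation identity gives `f(T)φ` exactly the norm of `ψ`. So the components over the
  -- other cycle points need no separate estimate: a lower bound `(1 - ε)‖ψ‖²` for the real part of
  -- the inner product already bounds the squared distance by `2ε‖ψ‖²`.
  have hnorm : ‖calculusHom modelT f (D.modelPhi hcyc)‖ ^ 2 = ‖ψ‖ ^ 2 := by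
    have h1 : ((‖calculusHom modelT f (D.modelPhi hcyc)‖ ^ 2 : ℝ) : ℂ) = ((‖ψ‖ ^ 2 : ℝ) : ℂ) := by
      have e := inner_self_eq_norm_sq_to_K (𝕜 := ℂ) (calculusHom modelT f (D.modelPhi hcyc))
      rw [inner_calculusHom, D.model_correlation, haarIntegral_eq_intervalIntegral_mul_phase ζ] at e
      push_cast
      refine e.symm.trans ?_
      rw [← Complex.ofReal_pow, hψn, ← integral_complex_ofReal,
        ← intervalIntegral.integral_eq_integral_of_support_subset (a := -(1 / 2)) (b := 1 / 2)]
      · refine intervalIntegral.integral_congr_ae ?_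
        -- The values of `f` are prescribed only on the open interval; the end point is negligible.
        have hne : ∀ᵐ x : ℝ, x ≠ 1 / 2 := by simp [ae_iff, measure_singleton]
        filter_upwards [hne] with x hx hx'
        rw [Set.uIoc_of_le (by norm_num)] at hx'
        have : f (ζ * phase x) = θ x := hf x (abs_lt.2 ⟨hx'.1, lt_of_le_of_ne hx'.2 hx⟩)
        rw [ContinuousMap.mul_apply, ContinuousMap.star_apply, this, Complex.star_def,
          ← Complex.normSq_eq_conj_mul_self, Complex.normSq_eq_norm_sq]
      · intro x hx
        by_contra hx'
        refine hx ?_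
        have : θ x = 0 := by
          refine h0 x (hδ'.le.trans ?_)
          by_contra! hlt
          rw [abs_lt] at hlt
          exact hx' ⟨hlt.1, hlt.2.le⟩
        simp [this]
    exact_mod_cast h1
  have hinner : RCLike.re (inner ℂ (PiLp.single 2 ζ ψ : ModelSpace N m₀)
      (calculusHom modelT f (D.modelPhi hcyc))) = ∫ x, ‖θ x‖ ^ 2 * (D.phiHat (ζ, x)).re := by
    have e1 : inner ℂ (PiLp.single 2 ζ ψ : ModelSpace N m₀)
        (calculusHom modelT f (D.modelPhi hcyc)) =
        inner ℂ ψ (calculusHom modelT f (D.modelPhi hcyc) ζ) := by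
      rw [PiLp.inner_apply, Finset.sum_eq_single ζ]
      · rw [PiLp.single_eq_same]
      · intro ζ' _ hne
        rw [PiLp.single_eq_of_ne _ hne, inner_zero_left]
      · simp
    have e2 : inner ℂ ψ (calculusHom modelT f (D.modelPhi hcyc) ζ) =
        ∫ x, ((‖θ x‖ ^ 2 : ℝ) : ℂ) * D.phiHat (ζ, x) := by
      rw [L2.inner_def]
      refine integral_congr_ae ?_
      filter_upwards [hψ, coeFn_calculusHom_modelT f (D.modelPhi hcyc) ζ,
        D.coeFn_modelPhi hcyc ζ] with x h1 h2 h3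
      rw [h1, h2, h3, RCLike.inner_apply]
      by_cases hx : |x| < δ
      · rw [show pathPoint (ζ, x) = ζ * phase x from rfl, hf x (hx.trans hδ'), ← Complex.normSq_eq_norm_sq,
          Complex.normSq_eq_conj_mul_self]
        ring
      · simp [h0 x (not_lt.1 hx)]
    rw [e1, e2]
    have hint2 : Integrable fun x => ((‖θ x‖ ^ 2 : ℝ) : ℂ) * D.phiHat (ζ, x) := by
      have hintC : Integrable fun x => ((‖θ x‖ ^ 2 : ℝ) : ℂ) := hint.ofReal
      refine hintC.mono (hintC.1.mul
        (D.continuous_phiHat ζ).aestronglyMeasurable) (ae_of_all _ fun x => ?_)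
      rw [norm_mul]
      exact mul_le_of_le_one_right (norm_nonneg _) (D.norm_phiHat_le_one _)
    rw [← integral_re hint2]
    refine integral_congr_ae (ae_of_all _ fun x => ?_)
    exact Complex.re_ofReal_mul _ _
  have hlow : (1 - ε) * ‖ψ‖ ^ 2 ≤ ∫ x, ‖θ x‖ ^ 2 * (D.phiHat (ζ, x)).re := by
    rw [hψn, ← integral_const_mul]
    refine integral_mono (hint.const_mul _) ?_ fun x => ?_
    · refine Integrable.mono hint (hint.1.mul
        (Complex.continuous_re.comp (D.continuous_phiHat ζ)).aestronglyMeasurable)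
        (ae_of_all _ fun x => ?_)
      rw [norm_mul]
      exact mul_le_of_le_one_right (norm_nonneg _)
        ((Complex.abs_re_le_norm _).trans (D.norm_phiHat_le_one _))
    · change (1 - ε) * ‖θ x‖ ^ 2 ≤ _
      by_cases hx : |x| < δ
      · rw [mul_comm]
        refine mul_le_mul_of_nonneg_left ?_ (by positivity)
        have := (Complex.abs_re_le_norm _).trans (hphi ζ x hx)
        rw [Complex.sub_re, Complex.one_re, abs_le] at this
        linarith
      · simp [h0 x (not_lt.1 hx)]
  rw [← norm_neg, neg_sub, @norm_sub_sq ℂ, hinner, hnorm, PiLp.norm_single]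
  nlinarith

/-- `y` is given by a continuous function on `(-M, M)` over a single cycle point. -/
def IsBump [DecidableEq (cyclePoints N m₀)] (M : ℝ) (y : ModelSpace N m₀) : Prop :=
  ∃ (ζ : cyclePoints N m₀) (ψ : L2R) (θ : ℝ → ℂ), y = PiLp.single 2 ζ ψ ∧ Continuous θ ∧
    (∀ x, M ≤ |x| → θ x = 0) ∧ ψ =ᵐ[volume] θ

variable [DecidableEq (cyclePoints N m₀)]

theorem IsLipschitzFilter.modelU_single (ζ : cyclePoints N m₀) (ψ : L2R) :
    D.modelU (PiLp.single 2 ζ ψ) = PiLp.single 2 (D.shift.symm ζ)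
      (weightedComp D.natCast_pos (ContinuousMap.const ℝ (D.cyclePhase (D.shift.symm ζ))) ψ) := by
  rw [IsLipschitzFilter.modelU, LinearIsometryEquiv.trans_apply,
    LinearIsometryEquiv.piLpCongrLeft_single, LinearIsometryEquiv.piLpCongrRight_single]

theorem IsBump.modelU {M : ℝ} {y : ModelSpace N m₀} (h : IsBump M y) :
    IsBump (M / N) (D.modelU y) := by
  obtain ⟨ζ, ψ, θ, rfl, hθ, h0, hψ⟩ := h
  have hN := D.natCast_pos
  refine ⟨_, _, fun x => (D.cyclePhase (D.shift.symm ζ) : ℂ) * (Real.sqrt N : ℂ) * θ (N * x),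
    D.modelU_single ζ ψ, by fun_prop, fun x hx => ?_, ?_⟩
  · change _ * θ (N * x) = 0
    rw [h0, mul_zero]
    rw [abs_mul, abs_of_pos hN]
    exact (div_le_iff₀' hN).1 hx
  · filter_upwards [coeFn_weightedComp hN (ContinuousMap.const ℝ (D.cyclePhase (D.shift.symm ζ))) ψ,
      ae_comp_mul_left hN.ne' hψ] with x h1 h2
    rw [h1, h2, ContinuousMap.const_apply]

theorem IsBump.modelU_pow {M : ℝ} {y : ModelSpace N m₀} (h : IsBump M y) (n : ℕ) :
    IsBump (M / (N : ℝ) ^ n) ((D.modelU ^ n) y) := by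
  induction n with
  | zero => simpa using h
  | succ n ih =>
    rw [pow_succ, ← div_div, pow_succ']
    exact ih.modelU D

/-- Each dilation compresses the support by the factor `N`. Once it lies where `φ̂` is close to `1`,
the bump is approximated by some `f(T)φ`, and the isometry `U⁻ⁿ` carries the approximation back. -/
theorem IsBump.mem_closure {M : ℝ} {y : ModelSpace N m₀} (h : IsBump M y) :
    y ∈ closure (Set.range (waveletVector D.modelU modelT (D.modelPhi hcyc))) := by
  rw [Metric.mem_closure_iff]
  intro ε hε
  -- This makes `2η‖y‖² < ε²`, also when `y = 0`.
  set η : ℝ := ε ^ 2 / (4 * (‖y‖ ^ 2 + 1)) with hη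
  have hηp : 0 < η := by positivity
  obtain ⟨δ, hδ, hδ', hphi⟩ := D.exists_phiHat_near_one hηp
  obtain ⟨n, hn⟩ := ((D.tendsto_div_pow M).eventually (gt_mem_nhds hδ)).exists
  obtain ⟨ζ, ψ, θ, hy, hθ, h0, hψ⟩ := h.modelU_pow D n
  obtain ⟨f, hf⟩ := D.exists_calculusHom_near hcyc hδ' hphi ζ hθ (fun x hx => h0 x (hn.le.trans hx)) hψ
  refine ⟨_, ⟨(n, f), rfl⟩, ?_⟩
  have hyn : ‖ψ‖ = ‖y‖ := by
    rw [← PiLp.norm_single 2 (fun _ : cyclePoints N m₀ => L2R) ζ ψ, ← hy, LinearIsometryEquiv.norm_map]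
  have e : D.modelU⁻¹ ^ n = (D.modelU ^ n)⁻¹ := inv_pow _ _
  have hd : ‖y - waveletVector D.modelU modelT (D.modelPhi hcyc) (n, f)‖ ^ 2 < ε ^ 2 := by
    have e2 : y = (D.modelU ^ n)⁻¹ (PiLp.single 2 ζ ψ) := by
      rw [← hy]
      exact ((D.modelU ^ n).symm_apply_apply y).symm
    have e3 : y - waveletVector D.modelU modelT (D.modelPhi hcyc) (n, f) = (D.modelU ^ n)⁻¹
        (PiLp.single 2 ζ ψ - calculusHom modelT f (D.modelPhi hcyc)) := by
      rw [map_sub, ← e2, ← e]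
      rfl
    rw [e3, LinearIsometryEquiv.norm_map, norm_sub_rev]
    refine hf.trans_lt ?_
    rw [hyn, hη, mul_div_assoc', div_mul_eq_mul_div, div_lt_iff₀ (by positivity)]
    nlinarith [sq_nonneg ‖y‖, pow_pos hε 2]
  rw [dist_eq_norm]
  exact lt_of_pow_lt_pow_left₀ 2 hε.le hd

theorem eq_sum_single (y : ModelSpace N m₀) : y = ∑ ζ, PiLp.single 2 ζ (y ζ) := by
  refine PiLp.ext fun ζ => ?_
  rw [WithLp.ofLp_sum, Finset.sum_apply, Finset.sum_eq_single ζ]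
  · rw [PiLp.single_eq_same]
  · intro ζ' _ hne
    exact PiLp.single_eq_of_ne' _ hne _
  · simp

theorem IsLipschitzFilter.model_span : (Submodule.span ℂ
    (Set.range (waveletVector D.modelU modelT (D.modelPhi hcyc)))).topologicalClosure = ⊤ := by
  rw [eq_top_iff]
  rintro y -
  rw [eq_sum_single y]
  refine Submodule.sum_mem _ fun ζ _ => ?_
  generalize y ζ = ψ
  change _ ∈ closure _
  rw [← closure_closure, Metric.mem_closure_iff]
  intro ε hε
  obtain ⟨g, hgs, hge, hgc, hgm⟩ := (Lp.memLp ψ).exists_hasCompactSupport_eLpNorm_sub_le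
    ENNReal.ofNat_ne_top (ε := ENNReal.ofReal (ε / 2)) (by simpa using hε)
  obtain ⟨M, hM⟩ := hgs.isBounded.subset_closedBall 0
  refine ⟨PiLp.single 2 ζ (hgm.toLp g), ?_, ?_⟩
  -- The support lies in the closed ball of radius `M`, and a bump must vanish at the boundary of
  -- its interval as well; hence `M + 1`.
  · refine closure_mono Submodule.subset_span (IsBump.mem_closure (M := M + 1) D hcyc
      ⟨ζ, _, g, rfl, hgc, fun x hx => ?_, hgm.coeFn_toLp⟩)
    refine image_eq_zero_of_notMem_tsupport fun hx' => ?_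
    have := hM hx'
    rw [Metric.mem_closedBall, Real.dist_eq, sub_zero] at this
    linarith
  · rw [dist_eq_norm, ← PiLp.single_sub, PiLp.norm_single, ← Lp.toLp_coeFn ψ (Lp.memLp ψ),
      ← MemLp.toLp_sub, Lp.norm_toLp]
    refine lt_of_le_of_lt (ENNReal.toReal_mono ENNReal.ofReal_ne_top hge) ?_
    rw [ENNReal.toReal_ofReal (by positivity)]
    linarith

theorem IsLipschitzFilter.isWaveletRepresentation_model :
    IsWaveletRepresentation N m₀ 1 D.modelU modelT (D.modelPhi hcyc) where
  covariance := D.model_covariance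
  scaling := D.model_scaling hcyc
  correlation f := by
    simp only [ContinuousMap.one_apply, mul_one]
    exact D.model_correlation hcyc f
  cyclic := by
    rw [← D.model_span hcyc]
    congr 2
    ext x
    constructor
    · rintro ⟨n, f, rfl⟩
      exact ⟨(n, f), rfl⟩
    · rintro ⟨⟨n, f⟩, rfl⟩
      exact ⟨n, f, rfl⟩

end cyclicity

/-! ### The Fourier transform on `L²(ℝ)` -/

/-- The Plancherel transform on `L²(ℝ)`. -/
noncomputable abbrev plancherel : L2R ≃ₗᵢ[ℂ] L2R := Lp.fourierTransformₗᵢ ℝ ℂ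

theorem plancherel_toLp (s : SchwartzMap ℝ ℂ) :
    plancherel (s.toLp 2) = (FourierTransform.fourier s).toLp 2 :=
  SchwartzMap.toLp_fourier_eq s

theorem coeFn_plancherel_toLp (s : SchwartzMap ℝ ℂ) :
    plancherel (s.toLp 2) =ᵐ[volume] fun x => ∫ v : ℝ, (phase (v * x) : ℂ) * s v := by
  rw [plancherel_toLp]
  filter_upwards [(FourierTransform.fourier s).coeFn_toLp 2] with x hx
  rw [hx, SchwartzMap.fourier_coe, Real.fourier_real_eq_integral_exp_smul]
  refine integral_congr_ae (ae_of_all _ fun v => ?_)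
  simp only [phase, Circle.coe_exp, smul_eq_mul]
  congr 3
  push_cast
  ring

theorem plancherel_induction {P : L2R → Prop} (hclosed : IsClosed {f | P f})
    (h : ∀ s : SchwartzMap ℝ ℂ, P (s.toLp 2)) (f : L2R) : P f :=
  DenseRange.induction_on (SchwartzMap.denseRange_toLpCLM (p := 2) ENNReal.ofNat_ne_top) f hclosed h

theorem ae_toLp_schwartz (s : SchwartzMap ℝ ℂ) : ∀ᵐ x : ℝ, (s.toLp 2 : L2R) x = s x :=
  s.coeFn_toLp 2 volume

/-- The character `x ↦ e^{-2πix}`. -/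
noncomputable def phaseMap : C(ℝ, Circle) := ⟨phase, continuous_phase⟩

theorem coeFn_translationL2 (f : L2R) : translationL2 f =ᵐ[volume] fun x => f (x - 1) :=
  Lp.coeFn_compMeasurePreserving f (measurePreserving_sub_right volume 1)

theorem plancherel_translationL2 (f : L2R) :
    plancherel (translationL2 f) = mulUnitary phaseMap (plancherel f) := by
  refine plancherel_induction (P := fun f => plancherel (translationL2 f) =
    mulUnitary phaseMap (plancherel f)) ?_ ?_ f
  · refine isClosed_eq (plancherel.continuous.comp ?_)
      ((mulUnitary phaseMap).continuous.comp plancherel.continuous)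
    exact (Lp.compMeasurePreservingₗᵢ ℂ (fun x : ℝ => x - 1)
      (measurePreserving_sub_right volume 1)).continuous
  · intro s
    have e : translationL2 (s.toLp 2) = (SchwartzMap.compSubConstCLM ℂ 1 s).toLp 2 := by
      refine Lp.ext ?_
      filter_upwards [coeFn_translationL2 (s.toLp 2), (SchwartzMap.compSubConstCLM ℂ 1 s).coeFn_toLp 2,
        (measurePreserving_sub_right volume (1 : ℝ)).quasiMeasurePreserving.ae (ae_toLp_schwartz s)]
        with x h1 h2 h3
      rw [h1, h2, h3, SchwartzMap.compSubConstCLM_apply]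
    rw [e]
    refine Lp.ext ?_
    filter_upwards [coeFn_plancherel_toLp (SchwartzMap.compSubConstCLM ℂ 1 s),
      coeFn_mulUnitary phaseMap (plancherel (s.toLp 2)), coeFn_plancherel_toLp s] with x h1 h2 h3
    rw [h1, h2, h3, ← integral_const_mul, ← integral_add_right_eq_self _ (1 : ℝ)]
    refine integral_congr_ae (ae_of_all _ fun v => ?_)
    simp only [SchwartzMap.compSubConstCLM_apply, add_sub_cancel_right]
    rw [add_mul, one_mul, phase_add, Circle.coe_mul]
    change _ = (phase x : ℂ) * _
    ring

/-- On Schwartz functions the substitution gives the Jacobian `a`, and `√(a⁻¹) · a = √a`; density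
does the rest. -/
theorem plancherel_weightedComp_inv {a : ℝ} (ha : 0 < a) (f : L2R) :
    plancherel (weightedComp (inv_pos.2 ha) 1 f) = weightedComp ha 1 (plancherel f) := by
  refine plancherel_induction (P := fun f => plancherel (weightedComp (inv_pos.2 ha) 1 f) =
    weightedComp ha 1 (plancherel f)) ?_ ?_ f
  · exact isClosed_eq (plancherel.continuous.comp (weightedComp _ 1).continuous)
      ((weightedComp ha 1).continuous.comp plancherel.continuous)
  · intro s
    set g : ℝ ≃L[ℝ] ℝ := ContinuousLinearEquiv.smulLeft (Units.mk0 a⁻¹ (inv_pos.2 ha).ne')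
    have hg : ∀ x, g x = a⁻¹ * x := fun x => rfl
    set s' : SchwartzMap ℝ ℂ := SchwartzMap.compCLMOfContinuousLinearEquiv ℂ g s
    have hs' : ∀ x, s' x = s (a⁻¹ * x) := fun x => rfl
    have e : weightedComp (inv_pos.2 ha) 1 (s.toLp 2) =
        (Real.sqrt a⁻¹ : ℂ) • (s'.toLp 2 : L2R) := by
      refine Lp.ext ?_
      filter_upwards [coeFn_weightedComp (inv_pos.2 ha) 1 (s.toLp 2),
        Lp.coeFn_smul (Real.sqrt a⁻¹ : ℂ) (s'.toLp 2), s'.coeFn_toLp 2,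
        ae_comp_mul_left (inv_pos.2 ha).ne' (ae_toLp_schwartz s)] with x h1 h2 h3 h4
      rw [h1, h2, Pi.smul_apply, h3, h4, hs']
      simp
    rw [e, map_smul]
    refine Lp.ext ?_
    filter_upwards [coeFn_plancherel_toLp s', coeFn_weightedComp ha 1 (plancherel (s.toLp 2)),
      Lp.coeFn_smul (Real.sqrt a⁻¹ : ℂ) (plancherel (s'.toLp 2)),
      ae_comp_mul_left ha.ne' (coeFn_plancherel_toLp s)] with x h1 h2 h3 h4
    have h5 : ∫ v : ℝ, (phase (v * x) : ℂ) * s' v = (a : ℂ) * ∫ v : ℝ, (phase (v * (a * x)) : ℂ) * s v := by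
      have := Measure.integral_comp_mul_left (fun v : ℝ => (phase (v * (a * x)) : ℂ) * s v) a⁻¹
      rw [inv_inv, abs_of_pos ha, Complex.real_smul] at this
      rw [← this]
      refine integral_congr_ae (ae_of_all _ fun v => ?_)
      simp only [hs']
      congr 3
      field_simp
    have h6 : (Real.sqrt a⁻¹ : ℂ) * a = Real.sqrt a := by
      have : Real.sqrt a⁻¹ * a = Real.sqrt a := by
        rw [Real.sqrt_inv]
        nth_rewrite 2 [← Real.mul_self_sqrt ha.le]
        rw [inv_mul_cancel_left₀ (Real.sqrt_pos.2 ha).ne']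
      exact_mod_cast this
    rw [h3, Pi.smul_apply, h1, h2, h4, h5, smul_eq_mul, ← mul_assoc, h6]
    simp

/-! ### Cyclic amplifications as summands of the model -/

section amplification
variable {N : ℕ} {m₀ : C(Circle, ℂ)} (D : IsLipschitzFilter N m₀)

theorem IsLipschitzFilter.plancherel_dilationL2 (D : IsLipschitzFilter N m₀) (f : L2R) :
    plancherel (dilationL2 N f) = weightedComp D.natCast_pos 1 (plancherel f) := by
  rw [← plancherel_weightedComp_inv]
  congr 1
  refine Lp.ext ?_
  filter_upwards [(memLp_comp_div N f).coeFn_toLp,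
    coeFn_weightedComp (inv_pos.2 D.natCast_pos) 1 f] with x h1 h2
  rw [dilationL2, h1, h2, Real.sqrt_inv, one_div, div_eq_inv_mul]
  simp

/-- The inclusion of a cycle into the set of all cycle points. -/
def FilterCycle.inclusion (C : FilterCycle N m₀) (c : C.1) : cyclePoints N m₀ := ⟨c, C.1, C.2, c.2⟩

variable [Fintype (cyclePoints N m₀)]

open scoped Classical in
/-- The Plancherel transform of a cyclic amplification, as a summand of the model. -/
noncomputable def amplificationEmbedding (C : FilterCycle N m₀) :
    AmplificationSpace C.1 →ₗᵢ[ℂ] ModelSpace N m₀ where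
  toFun ξ := WithLp.toLp 2 fun ζ => if h : (ζ : Circle) ∈ C.1 then plancherel (ξ ⟨ζ, h⟩) else 0
  map_add' ξ η := by
    refine PiLp.ext fun ζ => ?_
    by_cases h : (ζ : Circle) ∈ C.1 <;> simp [h]
  map_smul' c ξ := by
    refine PiLp.ext fun ζ => ?_
    by_cases h : (ζ : Circle) ∈ C.1 <;> simp [h]
  norm_map' ξ := by
    rw [← sq_eq_sq₀ (norm_nonneg _) (norm_nonneg _), PiLp.norm_sq_eq_of_L2, PiLp.norm_sq_eq_of_L2]
    refine (Fintype.sum_of_injective C.inclusion ?_ _ _ ?_ ?_).symm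
    · intro c d h
      exact Subtype.ext (congrArg (fun ζ : cyclePoints N m₀ => (ζ : Circle)) h)
    · intro ζ hζ
      have h : (ζ : Circle) ∉ C.1 := fun h => hζ ⟨⟨ζ, h⟩, rfl⟩
      simp [h]
    · intro c
      simp [FilterCycle.inclusion]

theorem amplificationEmbedding_of_mem {C : FilterCycle N m₀} {ζ : cyclePoints N m₀}
    (h : (ζ : Circle) ∈ C.1) (ξ : AmplificationSpace C.1) :
    amplificationEmbedding C ξ ζ = plancherel (ξ ⟨ζ, h⟩) := dif_pos h

theorem amplificationEmbedding_of_notMem {C : FilterCycle N m₀} {ζ : cyclePoints N m₀}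
    (h : (ζ : Circle) ∉ C.1) (ξ : AmplificationSpace C.1) :
    amplificationEmbedding C ξ ζ = 0 := dif_neg h

/-- The cycles partition the cycle points: disjointness gives orthogonality, and covering gives
totality. -/
theorem isHilbertSum_amplificationEmbedding :
    IsHilbertSum ℂ (fun C : FilterCycle N m₀ => AmplificationSpace C.1) amplificationEmbedding := by
  classical
  refine IsHilbertSum.mk ?_ ?_
  · intro C C' hne ξ η
    rw [PiLp.inner_apply]
    refine Finset.sum_eq_zero fun ζ _ => ?_
    by_cases h : (ζ : Circle) ∈ C.1
    · have h' : (ζ : Circle) ∉ C'.1 := fun h' => hne (Subtype.ext (C.2.eq_of_mem C'.2 h h'))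
      rw [amplificationEmbedding_of_notMem h', inner_zero_right]
    · rw [amplificationEmbedding_of_notMem h, inner_zero_left]
  · refine le_trans ?_ (Submodule.le_topologicalClosure _)
    rintro y -
    have hsum : y = ∑ ζ, PiLp.single 2 ζ (y ζ) := eq_sum_single y
    rw [hsum]
    refine Submodule.sum_mem _ fun ζ _ => ?_
    obtain ⟨C, hC, hζ⟩ := ζ.2
    refine Submodule.mem_iSup_of_mem (⟨C, hC⟩ : FilterCycle N m₀)
      ⟨PiLp.single 2 ⟨ζ, hζ⟩ (plancherel.symm (y ζ)), PiLp.ext fun ζ' => ?_⟩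
    change amplificationEmbedding (⟨C, hC⟩ : FilterCycle N m₀) _ ζ' = _
    by_cases h : ζ' = ζ
    · subst h
      rw [amplificationEmbedding_of_mem (C := ⟨C, hC⟩) hζ, PiLp.single_eq_same, PiLp.single_eq_same,
        LinearIsometryEquiv.apply_symm_apply]
    · rw [PiLp.single_eq_of_ne _ h]
      by_cases h' : (ζ' : Circle) ∈ C
      · rw [amplificationEmbedding_of_mem (C := ⟨C, hC⟩) h', PiLp.single_eq_of_ne, map_zero]
        exact fun e => h (Subtype.ext (congrArg (fun c : C => (c : Circle)) e))
      · exact amplificationEmbedding_of_notMem (C := ⟨C, hC⟩) h' _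

theorem modelT_amplificationEmbedding (C : FilterCycle N m₀) (ξ : AmplificationSpace C.1) :
    modelT (amplificationEmbedding C ξ) = amplificationEmbedding C (amplifiedTranslation C.1 ξ) := by
  refine PiLp.ext fun ζ => ?_
  rw [modelT_apply]
  by_cases h : (ζ : Circle) ∈ C.1
  · rw [amplificationEmbedding_of_mem h, amplificationEmbedding_of_mem h]
    change _ = plancherel (((ζ : Circle) : ℂ) • translationL2 (ξ ⟨ζ, h⟩))
    rw [map_smul, plancherel_translationL2]
    refine Lp.ext ?_
    filter_upwards [coeFn_mulUnitary (pathMap ζ) (plancherel (ξ ⟨ζ, h⟩)),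
      coeFn_mulUnitary phaseMap (plancherel (ξ ⟨ζ, h⟩)),
      Lp.coeFn_smul ((ζ : Circle) : ℂ) (mulUnitary phaseMap (plancherel (ξ ⟨ζ, h⟩)))]
      with x h1 h2 h3
    rw [h1, h3, Pi.smul_apply, h2, smul_eq_mul, ← mul_assoc, ← Circle.coe_mul]
    rfl
  · rw [amplificationEmbedding_of_notMem h, amplificationEmbedding_of_notMem h, map_zero]

theorem IsLipschitzFilter.modelU_amplificationEmbedding (C : FilterCycle N m₀)
    (ξ : AmplificationSpace C.1) : D.modelU (amplificationEmbedding C ξ) =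
      amplificationEmbedding C (amplifiedDilation N m₀ C ξ) := by
  refine PiLp.ext fun ζ => ?_
  rw [D.modelU_apply]
  by_cases h : (ζ : Circle) ∈ C.1
  · have h' : (D.shift ζ : Circle) ∈ C.1 := C.2.pow_mem h
    rw [amplificationEmbedding_of_mem h, amplificationEmbedding_of_mem h']
    change _ = plancherel ((m₀ ζ / ((Real.sqrt N : ℝ) : ℂ)) • dilationL2 N (ξ ⟨D.shift ζ, h'⟩))
    rw [map_smul, D.plancherel_dilationL2]
    generalize plancherel (ξ ⟨D.shift ζ, h'⟩) = ψ
    refine Lp.ext ?_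
    filter_upwards [coeFn_weightedComp D.natCast_pos (ContinuousMap.const ℝ (D.cyclePhase ζ)) ψ,
      coeFn_weightedComp D.natCast_pos 1 ψ,
      Lp.coeFn_smul (m₀ ζ / ((Real.sqrt N : ℝ) : ℂ)) (weightedComp D.natCast_pos 1 ψ)]
      with x h1 h2 h3
    rw [h1, h3, Pi.smul_apply, h2, ContinuousMap.const_apply, D.coe_cyclePhase, smul_eq_mul,
      ContinuousMap.one_apply, Circle.coe_one, one_mul, mul_assoc]
  -- If `ζ ^ N` were in `C`, the cycle through `ζ` would share this point with `C` and so coincide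
  -- with it.
  · have h' : (D.shift ζ : Circle) ∉ C.1 := by
      intro h'
      obtain ⟨C', hC', hζ⟩ := ζ.2
      exact h (C.2.eq_of_mem hC' h' (hC'.pow_mem hζ) ▸ hζ)
    rw [amplificationEmbedding_of_notMem h, amplificationEmbedding_of_notMem h', map_zero]

theorem IsLipschitzFilter.isSumOfCyclicAmplifications_model :
    IsSumOfCyclicAmplifications N m₀ D.modelU modelT :=
  ⟨amplificationEmbedding, isHilbertSum_amplificationEmbedding, fun C ξ =>
    ⟨D.modelU_amplificationEmbedding C ξ, modelT_amplificationEmbedding C ξ⟩⟩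

end amplification

/-! ### Transport along a unitary equivalence -/

section transport
variable {H : Type*} [NormedAddCommGroup H] [InnerProductSpace ℂ H] [CompleteSpace H]
variable {H' : Type*} [NormedAddCommGroup H'] [InnerProductSpace ℂ H'] [CompleteSpace H']

/-- Being a sum of cyclic amplifications is invariant under unitary equivalence. -/
theorem IsSumOfCyclicAmplifications.transport {N : ℕ} {m₀ : C(Circle, ℂ)} {U T : H ≃ₗᵢ[ℂ] H}
    {U' T' : H' ≃ₗᵢ[ℂ] H'} (h : IsSumOfCyclicAmplifications N m₀ U T) (J : H ≃ₗᵢ[ℂ] H')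
    (hU : ∀ x, J (U x) = U' (J x)) (hT : ∀ x, J (T x) = T' (J x)) :
    IsSumOfCyclicAmplifications N m₀ U' T' := by
  obtain ⟨W, hW, hWi⟩ := h
  refine ⟨fun C => J.toLinearIsometry.comp (W C), ?_, fun C ξ => ?_⟩
  · have hV : OrthogonalFamily ℂ (fun C : FilterCycle N m₀ => AmplificationSpace C.1)
        fun C => J.toLinearIsometry.comp (W C) := fun C C' hne ξ η =>
      (J.inner_map_map _ _).trans (hW.OrthogonalFamily hne ξ η)
    refine ⟨hV, fun y => ?_⟩
    obtain ⟨w, hw⟩ := hW.surjective_isometry (J.symm y)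
    refine ⟨w, ((hV.hasSum_linearIsometry w).unique ?_)⟩
    have := (hW.OrthogonalFamily.hasSum_linearIsometry w).mapL (J : H →L[ℂ] H')
    rw [hw] at this
    simpa using this
  · change U' (J (W C ξ)) = J (W C _) ∧ T' (J (W C ξ)) = J (W C _)
    rw [← hU, ← hT, (hWi C ξ).1, (hWi C ξ).2]
    exact ⟨rfl, rfl⟩

end transport

theorem mainTheorem5 (N : ℕ) (hN : 2 ≤ N) (m₀ : C(Circle, ℂ))
    (h_lipschitz : ∃ K : NNReal, LipschitzWith K m₀)
    (h_zeros : {z : Circle | m₀ z = 0}.Finite)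
    (h_normalized : transferOp N m₀ 1 = 1) :
    Xor
      -- there are cycles
      ((∃ C : Finset Circle, IsFilterCycle N m₀ C) ∧
        (∀ ν : Measure Circle, IsFiniteMeasure ν → IsInvariantMeasure N m₀ ν →
          ν (cyclePoints N m₀)ᶜ = 0 ∧
          ν = Measure.sum fun z : cyclePoints N m₀ => ν {(z : Circle)} • Measure.dirac (z : Circle)) ∧
        (∃ (H : Type) (_ : NormedAddCommGroup H) (_ : InnerProductSpace ℂ H) (_ : CompleteSpace H)
          (U T : H ≃ₗᵢ[ℂ] H) (φ : H), IsWaveletRepresentation N m₀ 1 U T φ) ∧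
        (∀ (H : Type*) [NormedAddCommGroup H] [InnerProductSpace ℂ H] [CompleteSpace H]
          (U T : H ≃ₗᵢ[ℂ] H) (φ : H), IsWaveletRepresentation N m₀ 1 U T φ →
            IsSumOfCyclicAmplifications N m₀ U T))
      -- there are no cycles
      ((¬ ∃ C : Finset Circle, IsFilterCycle N m₀ C) ∧
        (∀ c : ℂ, Module.End.HasEigenvalue (transferOp N m₀) c → ‖c‖ = 1 → c = 1) ∧
        Module.finrank ℂ (Module.End.eigenspace (transferOp N m₀) 1) = 1 ∧
        Module.finrank ℂ (Module.End.maxGenEigenspace (transferOp N m₀) 1) = 1 ∧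
        (∃ ν : Measure Circle, IsProbabilityMeasure ν ∧ IsInvariantMeasure N m₀ ν ∧
          (∀ ν' : Measure Circle, IsProbabilityMeasure ν' → IsInvariantMeasure N m₀ ν' → ν' = ν) ∧
          ∀ f : C(Circle, ℂ), TendstoUniformly (fun n : ℕ => ⇑((transferOp N m₀ ^ n) f))
            (fun _ => ∫ z, f z ∂ν) atTop)) := by
  have D : IsLipschitzFilter N m₀ := ⟨hN, h_lipschitz, h_zeros, h_normalized⟩
  by_cases hcyc : ∃ C : Finset Circle, IsFilterCycle N m₀ C
  · refine Or.inl ⟨⟨hcyc, fun ν _ hν => ?_, ?_, ?_⟩, fun h => h.1 hcyc⟩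
    · have h0 := D.measure_compl_cyclePoints hcyc hν
      exact ⟨h0, measure_eq_sum_dirac D.finite_cyclePoints.countable h0⟩
    · have := D.finite_subtype
      have : Fintype (cyclePoints N m₀) := Fintype.ofFinite _
      classical
      exact ⟨ModelSpace N m₀, inferInstance, inferInstance, inferInstance, D.modelU, modelT,
        D.modelPhi hcyc, D.isWaveletRepresentation_model hcyc⟩
    · intro H _ _ _ U T φ h
      have := D.finite_subtype
      have : Fintype (cyclePoints N m₀) := Fintype.ofFinite _
      classical
      -- Uniqueness carries the decomposition from the model to an arbitrary representation.
      obtain ⟨J, hU, hT⟩ := (D.isWaveletRepresentation_model hcyc).exists_equiv h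
      exact D.isSumOfCyclicAmplifications_model.transport J hU hT
  · exact Or.inr ⟨⟨hcyc, noCycles_conclusion hN h_lipschitz h_zeros h_normalized hcyc⟩,
      fun h => hcyc h.1⟩
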